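/- **Setting.** Fix $d$ and $S=\{1,\dots,d\}$. The combinatorial type $\pi$ of a labelled interval exchange with $d$ bands consists of two words (top and bottom of an interval, read from left to right) in which every label of $S$ occurs exactly twice in total; a band is orientation reversing if both its ends are on the same side. Let $S_t,S_b$ be the labels of the orientation reversing bands on the top and the bottom. The configuration space of $\pi$ is $$W=\Big\{\lambda\in\mathbb R_{\ge0}^d:\ \sum_\alpha\lambda_\alpha=1,\ \sum_{\alpha\in S_t}\lambda_\alpha=\sum_{\alpha\in S_b}\lambda_\alpha\Big\}.$$ The type is *non-classical* if it is recurrent (the equation $\sum_{S_t}\lambda_\alpha=\sum_{S_b}\lambda_\alpha$ has a strictly positive solution) and its train track is complete in some oriented surface: each boundary curve of the thickened track (interval with untwisted bands) has either exactly three cusps (ideal triangle) or exactly one cusp (once punctured monogon). A *split* (Rauzy induction) of $\pi$ is defined when the bands $w\ne l$ in the two rightmost positions admit strictly positive widths satisfying the above equation with $\lambda_w>\lambda_l$: the rightmost end of $l$ is moved next to the other end of $w$, on its right if $w$ is orientation preserving and on its left if $w$ is orientation reversing; the widths change by $\lambda=E\lambda'$, where $E=I+M_{wl}$ and $M_{wl}$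 has its only non-zero entry, $1$, at $(w,l)$. The type $\pi_0$ *lies in a sink* if every unlabelled type that can be reached by splittings from $\pi_0$ (including $\pi_0$) can be split back, in at least one step, to the unlabelled type of $\pi_0$. A *stage* is a finite splitting sequence $\pi_0\to\dots\to\pi_n=\pi$; its matrix is $Q=E_1\cdots E_n$, with columns $Q(\alpha)$, $\alpha\in S$, and $JQ(y)=Qy/|Qy|$, where $|y|=\sum_i|y_i|$. Let $W_0,W$ be the configuration spaces of $\pi_0,\pi$, and let $\ell$ be the $(d-2)$-dimensional volume on $W_0$, normalised to total mass $1$. For $C>1$, a set of columns is *$C$-distributed* if $1/C<|u|/|v|<C$ for all $u,v$ in it. **Proposition.** For every $d$ and $C_0>1$ there are constants $c_1\in(0,1)$ and $C_1>1$, depending only on $C_0$ and $d$, such that the following holds. Let $\pi_0$ be a non-classical type that lies in a sink, let $\pi$ be any stage starting from $\pi_0$, with matrix $Q$ and configuration space $W$, and let $\mathcal A_0\subsetneq S$ be a set of labels whose columns $Q(\alpha)$ are $C_0$-distributed and include a column of largest norm among all columns of $Q$. Then there are finitely many stages $\pi_\theta$, each obtained from $\pi$ by at least one further split, with matrices $Q_\theta$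 and configuration spaces $W_\theta$, such that 1. the sets $JQ_\theta(W_\theta)$ have pairwise disjoint (relative) interiors, and $\sum_\theta\ell(JQ_\theta(W_\theta))\ \ge\ c_1\,\ell(JQ(W))$; 2. for every $\theta$ there is a set of labels $\mathcal A_\theta\supsetneq\mathcal A_0$ whose columns $Q_\theta(\alpha)$ are $C_1$-distributed and include a column of largest norm among all columns of $Q_\theta$. -/

import Mathlib

open MeasureTheory ProbabilityTheory
open scoped ENNReal

/-- The combinatorics of a labelled interval exchange with `d` bands: the labels of the band ends
met on the top and on the bottom of the interval, read from left to right. Each band has two ends.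
A band is orientation reversing if both of its ends are on the same side of the interval. -/
@[ext]
structure IntervalExchange (d : ℕ) where
  top : List (Fin d)
  bot : List (Fin d)
  count_two : ∀ α, (top ++ bot).count α = 2

namespace IntervalExchange

variable {d : ℕ}

/-! ### Widths and configuration spaces -/

/-- Labels of the orientation reversing bands on the top. -/
def revTop (π : IntervalExchange d) : Finset (Fin d) :=
  Finset.univ.filter fun α => π.top.count α = 2

/-- Labels of the orientation reversing bands on the bottom. -/
def revBot (π : IntervalExchange d) : Finset (Fin d) :=
  Finset.univ.filter fun α => π.bot.count α = 2

def SwitchCondition (π : IntervalExchange d) (w : Fin d → ℝ) : Prop :=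
  ∑ α ∈ π.revTop, w α = ∑ α ∈ π.revBot, w α

/-- The configuration space: normalised non-negative widths that satisfy the switch condition. -/
def configSpace (π : IntervalExchange d) : Set (EuclideanSpace ℝ (Fin d)) :=
  {x | (∀ α, 0 ≤ x α) ∧ ∑ α, x α = 1 ∧ π.SwitchCondition x}

/-- Recurrence: there are strictly positive widths satisfying the switch condition. -/
def IsRecurrent (π : IntervalExchange d) : Prop :=
  ∃ w : Fin d → ℝ, (∀ α, 0 < w α) ∧ π.SwitchCondition w

/-! ### Complementary regions

Thickening the interval and its bands gives an oriented surface with boundary. Each boundary curve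
is made of sides of bands, joined at cusps (between neighbouring band ends on the same side of the
interval) and smoothly at the left and the right end of the interval. The complementary regions
of the track in a surface that it fills correspond to these boundary curves. -/

def row (π : IntervalExchange d) : Bool → List (Fin d)
  | true => π.top
  | false => π.bot

/-- A band end: `true`/`false` for top/bottom, and its position from the left. -/
abbrev BandEnd (π : IntervalExchange d) := Σ s : Bool, Fin (π.row s).length

def label (π : IntervalExchange d) (e : π.BandEnd) : Fin d := (π.row e.1).get e.2

/-- Adjacency along the boundary of the thickened track. A pair `(e, false)` is the left side of
the band at its end `e`, and `(e, true)` is the right side. -/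
inductive Adjacent (π : IntervalExchange d) : π.BandEnd × Bool → π.BandEnd × Bool → Prop
  /-- along an orientation preserving band, which is glued by a translation -/
  | preserving (e e' : π.BandEnd) (b : Bool) :
      π.label e = π.label e' → e.1 ≠ e'.1 → Adjacent π (e, b) (e', b)
  /-- along an orientation reversing band, which is glued by a half-turn -/
  | reversing (e e' : π.BandEnd) (b : Bool) :
      π.label e = π.label e' → e ≠ e' → e.1 = e'.1 → Adjacent π (e, b) (e', !b)
  /-- through the cusp between two neighbouring ends -/
  | cusp (e e' : π.BandEnd) :
      e.1 = e'.1 → (e.2 : ℕ) + 1 = e'.2 → Adjacent π (e, true) (e', false)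
  /-- around the left end of the interval -/
  | left (e e' : π.BandEnd) :
      e.1 ≠ e'.1 → (e.2 : ℕ) = 0 → (e'.2 : ℕ) = 0 → Adjacent π (e, false) (e', false)
  /-- around the right end of the interval -/
  | right (e e' : π.BandEnd) :
      e.1 ≠ e'.1 → (e.2 : ℕ) + 1 = (π.row e.1).length → (e'.2 : ℕ) + 1 = (π.row e'.1).length →
        Adjacent π (e, true) (e', true)

/-- The cusps, each named by the end on its left, on the boundary curve through `x`. -/
def cuspsAlong (π : IntervalExchange d) (x : π.BandEnd × Bool) : Set π.BandEnd :=
  {e | (e.2 : ℕ) + 1 < (π.row e.1).length ∧ Relation.EqvGen π.Adjacent x (e, true)}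

/-- The track is a complete train track in some surface: every boundary curve of the thickened
track carries three cusps, and then bounds an ideal triangle, or one cusp, and then bounds a once
punctured monogon. -/
def IsComplete (π : IntervalExchange d) : Prop :=
  ∀ x : π.BandEnd × Bool, (π.cuspsAlong x).ncard = 3 ∨ (π.cuspsAlong x).ncard = 1

/-- Non-classical interval exchanges. -/
def IsNonclassical (π : IntervalExchange d) : Prop := π.IsRecurrent ∧ π.IsComplete

/-! ### Rauzy induction -/

/-- `Moves π w l π'`: the bands in the two critical (rightmost) positions of `π` are `w` and `l`,
and slicing `w`, which is to be the wider one, along `l` gives the combinatorics `π'`. The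
critical end of `l` flows along `w` and is reinserted next to the other end of `w`, on its right
if `w` is orientation preserving and on its left if `w` is orientation reversing. -/
inductive Moves : IntervalExchange d → Fin d → Fin d → IntervalExchange d → Prop
  | topPreserving (w l : Fin d) (A B C : List (Fin d)) (h h') :
      Moves ⟨A ++ [w], B ++ [w] ++ C ++ [l], h⟩ w l ⟨A ++ [w], B ++ [w, l] ++ C, h'⟩
  | topReversing (w l : Fin d) (A B C : List (Fin d)) (h h') :
      Moves ⟨A ++ [w] ++ B ++ [w], C ++ [l], h⟩ w l ⟨A ++ [l, w] ++ B ++ [w], C, h'⟩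
  | botPreserving (w l : Fin d) (A B C : List (Fin d)) (h h') :
      Moves ⟨B ++ [w] ++ C ++ [l], A ++ [w], h⟩ w l ⟨B ++ [w, l] ++ C, A ++ [w], h'⟩
  | botReversing (w l : Fin d) (A B C : List (Fin d)) (h h') :
      Moves ⟨C ++ [l], A ++ [w] ++ B ++ [w], h⟩ w l ⟨C, A ++ [l, w] ++ B ++ [w], h'⟩

/-- `π'` results from splitting `π`: the move is the one prescribed by some admissible widths. -/
def Split (π : IntervalExchange d) (w l : Fin d) (π' : IntervalExchange d) : Prop :=
  Moves π w l π' ∧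
    ∃ x : Fin d → ℝ, (∀ α, 0 < x α) ∧ π.SwitchCondition x ∧ x l < x w

/-- Old widths in terms of new widths: `x = E x'` with `E = 1 + M`, where the only non-zero entry
of `M` is `1` at `(w, l)`. -/
def splitMatrix (w l : Fin d) : Matrix (Fin d) (Fin d) ℝ := 1 + Matrix.single w l 1

/-- `SplitPath n π π' Q`: there is a splitting sequence of `n` splits from `π` to `π'`, with
associated matrix `Q = E₁ E₂ ⋯ Eₙ`. Labels are carried along. -/
inductive SplitPath :
    ℕ → IntervalExchange d → IntervalExchange d → Matrix (Fin d) (Fin d) ℝ → Prop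
  | nil (π : IntervalExchange d) : SplitPath 0 π π 1
  | snoc {n : ℕ} {π π' π'' : IntervalExchange d} {Q : Matrix (Fin d) (Fin d) ℝ} {w l : Fin d} :
      SplitPath n π π' Q → Split π' w l π'' → SplitPath (n + 1) π π'' (Q * splitMatrix w l)

/-! ### The reduced Rauzy diagram -/

def relabel (σ : Equiv.Perm (Fin d)) (π : IntervalExchange d) : IntervalExchange d where
  top := π.top.map σ
  bot := π.bot.map σ
  count_two α := by
    rw [← List.map_append, ← σ.apply_symm_apply α,
      List.count_map_of_injective _ _ σ.injective]
    exact π.count_two _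

/-- Arrows of the reduced Rauzy diagram, in which labels are forgotten. -/
def ReducedArrow (π π' : IntervalExchange d) : Prop :=
  ∃ (σ τ : Equiv.Perm (Fin d)) (w l : Fin d), Split (π.relabel σ) w l (π'.relabel τ)

/-- `π` lies in a sink: from every type that `π` splits to (and from `π` itself) one can split, in
at least one step, to `π`. -/
def InSink (π : IntervalExchange d) : Prop :=
  ∀ π', Relation.ReflTransGen ReducedArrow π π' → Relation.TransGen ReducedArrow π' π

/-! ### Columns, images and measure -/

/-- The norm `|y| = ∑ |yᵢ|`. -/
def norm₁ (y : Fin d → ℝ) : ℝ := ∑ i, |y i|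

/-- The columns of `Q` with labels in `A` are `C`-distributed. -/
def Distributed (C : ℝ) (Q : Matrix (Fin d) (Fin d) ℝ) (A : Finset (Fin d)) : Prop :=
  ∀ α ∈ A, ∀ β ∈ A,
    1 / C < norm₁ (Q.col α) / norm₁ (Q.col β) ∧ norm₁ (Q.col α) / norm₁ (Q.col β) < C

def ContainsLargest (Q : Matrix (Fin d) (Fin d) ℝ) (A : Finset (Fin d)) : Prop :=
  ∃ α ∈ A, ∀ β, norm₁ (Q.col β) ≤ norm₁ (Q.col α)

/-- The projectivisation `JQ(y) = Qy / |Qy|`. -/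
noncomputable def proj (Q : Matrix (Fin d) (Fin d) ℝ) (y : EuclideanSpace ℝ (Fin d)) :
    EuclideanSpace ℝ (Fin d) :=
  WithLp.toLp 2 ((norm₁ (Q.mulVec y.ofLp))⁻¹ • Q.mulVec y.ofLp)

/-- The set `JQ(W)` of a stage with combinatorics `π` and matrix `Q`. -/
noncomputable def stageSet (π : IntervalExchange d) (Q : Matrix (Fin d) (Fin d) ℝ) :
    Set (EuclideanSpace ℝ (Fin d)) :=
  proj Q '' π.configSpace

/-- Normalised `(d-2)`-dimensional volume on the configuration space of `π`. -/
noncomputable def vol (π : IntervalExchange d) : Measure (EuclideanSpace ℝ (Fin d)) :=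
  cond (Measure.hausdorffMeasure ((d : ℝ) - 2)) π.configSpace

end IntervalExchange

namespace IntervalExchange
variable {d : ℕ}

/-! ### Rows, counts and the switch condition -/

/-! A stage with matrix $Q$ is measured by its truncated cone: all $\lambda\ge 0$ satisfying the
switch condition with $\sum_\alpha|Q(\alpha)|\lambda_\alpha\le 1$. Its Haar measure is a fixed
multiple of $\ell(JQ(W))$ (`BasePoint.measure_stageCone`), and a split cuts the cone along the
hyperplane $\lambda_w=\lambda_l$. Two estimates by translation along short solutions suffice: a slab
$\lambda_\alpha\le 1/(N|Q(\alpha)|)$ has proportion $O(1/N)$ (`measure_small_coord_le`), and a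
half-space $\lambda_l\le\lambda_w$ has proportion bounded below (`measure_coneBody_le_half`). Their
constants are uniform when $|Q(\alpha)|$, respectively $|Q(l)|$, is comparable to the largest
column.

Suppose first that a band outside $A_0$ is critical (`exists_family_of_critical`). Then two bands of
$A_0$ cannot compete. If a band of $A_0$ beats an outside band $l$, the new column $Q(l)+Q(w)$ is
comparable to the largest one and $l$ can be added to $A_0$. If an outside band wins, it stays
critical and the situation persists; one stops if an outside loser overtakes all columns of $A_0$.
Until then no band of $A_0$ has won, so the widths in $A_0$ are unchanged while their columns may
grow. A column that has grown by a factor $N$ forces its band to be narrow, so this happens only in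
one of at most $d$ thin slabs. For large $N$ these have proportion at most one half. The process
terminates because each split increases the sum of the column norms by at least $1$.

If both critical bands lie in $A_0$, a bounded number of splits inside $A_0$ makes an outside band
critical (`exists_near_uniform`). Each such split has proportion bounded below and changes the
distribution constant boundedly (`exists_family_of_near`).

It remains to see that every band is critical somewhere in the sink
(`IsNonclassical.exists_isLast`). Otherwise let $q$ be the set of bands that do become critical, and
count the ends of a band in the maximal right parts of the rows labelled by $q$. These counts never
increase, so they are constant by strong connectivity, and this forces every band of $q$ to have
both ends there. Hence no band connects the left and right parts. Orientation reversing bands cannot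
occur in both parts, since reversing critical bands win until, on each side in turn, a critical band
is the only reversing one. So one part has only orientation preserving bands, and counting cusps mod
$2$ along boundary curves contradicts completeness (`Block.not_isComplete_of_right`,
`Block.not_isComplete_of_left`). -/

theorem count_row_add (π : IntervalExchange d) (s : Bool) (α : Fin d) :
    (π.row s).count α + (π.row (!s)).count α = 2 := by
  have h := π.count_two α
  rw [List.count_append] at h
  cases s <;> simp only [row, Bool.not_true, Bool.not_false] <;> omega

/-- Labels of the orientation reversing bands on a given side. -/
def rev (π : IntervalExchange d) (s : Bool) : Finset (Fin d) :=
  Finset.univ.filter fun α => (π.row s).count α = 2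

theorem mem_rev {π : IntervalExchange d} {s : Bool} {α : Fin d} :
    α ∈ π.rev s ↔ (π.row s).count α = 2 := by simp [rev]

theorem mem_row_not_iff {π : IntervalExchange d} {s : Bool} {α : Fin d} :
    α ∈ π.row (!s) ↔ α ∉ π.rev s := by
  rw [mem_rev, ← List.count_pos_iff]
  have := π.count_row_add s α
  omega

theorem notMem_rev_not {π : IntervalExchange d} {s : Bool} {α : Fin d} (h : α ∈ π.rev s) :
    α ∉ π.rev (!s) := by
  rw [mem_rev] at h ⊢
  have := π.count_row_add s α
  omega

theorem switchCondition_iff_rev (π : IntervalExchange d) (s : Bool) (x : Fin d → ℝ) :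
    π.SwitchCondition x ↔ ∑ α ∈ π.rev s, x α = ∑ α ∈ π.rev (!s), x α := by
  cases s
  · exact eq_comm
  · exact Iff.rfl

theorem sum_map_eq_sum_count (L : List (Fin d)) (x : Fin d → ℝ) :
    (L.map x).sum = ∑ α, (L.count α : ℝ) * x α := by
  rw [Finset.sum_list_map_count]
  simp only [nsmul_eq_mul]
  refine Finset.sum_subset (Finset.subset_univ _) fun α _ h => ?_
  rw [List.mem_toFinset] at h
  simp [List.count_eq_zero_of_not_mem h]

/-- The switch condition says that both rows have the same length. An orientation preserving band
contributes equally to both rows and cancels; a reversing one counts twice in its own row, which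
produces the factor 2 below. -/
theorem switchCondition_iff_row (π : IntervalExchange d) (s : Bool) (x : Fin d → ℝ) :
    π.SwitchCondition x ↔ ((π.row s).map x).sum = ((π.row (!s)).map x).sum := by
  rw [switchCondition_iff_rev π s, sum_map_eq_sum_count, sum_map_eq_sum_count,
    rev, rev, Finset.sum_filter, Finset.sum_filter, ← sub_eq_zero,
    ← sub_eq_zero (a := ∑ α, _ * _), ← Finset.sum_sub_distrib, ← Finset.sum_sub_distrib]
  have : ∑ α, (((π.row s).count α : ℝ) * x α - ((π.row (!s)).count α : ℝ) * x α) =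
      2 * ∑ α, ((if (π.row s).count α = 2 then x α else 0) -
        (if (π.row (!s)).count α = 2 then x α else 0)) := by
    rw [Finset.mul_sum]
    refine Finset.sum_congr rfl fun α _ => ?_
    have h := π.count_row_add s α
    obtain h1 | h1 | h1 : (π.row s).count α = 0 ∨ (π.row s).count α = 1 ∨
      (π.row s).count α = 2 := by omega
    · have h2 : (π.row (!s)).count α = 2 := by omega
      simp [h1, h2]
    · have h2 : (π.row (!s)).count α = 1 := by omega
      simp [h1, h2]
    · have h2 : (π.row (!s)).count α = 0 := by omega
      simp [h1, h2]
  rw [this]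
  constructor
  · intro h; rw [h, mul_zero]
  · intro h; linarith

theorem sum_count (L : List (Fin d)) : ∑ α, L.count α = L.length := by
  simpa using Multiset.sum_count_eq_card (s := Finset.univ) (m := (L : Multiset (Fin d)))
    (fun _ _ => Finset.mem_univ _)

/-- The rows have $2d$ entries together. Finiteness is what makes the constants depend on $d$ only.
-/
instance : Finite (IntervalExchange d) := by
  have hl : ∀ π : IntervalExchange d, π.top.length + π.bot.length = 2 * d := fun π => by
    rw [← sum_count, ← sum_count, ← Finset.sum_add_distrib]
    simp_rw [← List.count_append, π.count_two]
    simp [mul_comm]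
  have hf := List.finite_length_le (Fin d) (2 * d)
  have := hf.to_subtype
  let f : IntervalExchange d → {L : List (Fin d) | L.length ≤ 2 * d} ×
      {L : List (Fin d) | L.length ≤ 2 * d} := fun π =>
    (⟨π.top, by have := hl π; simp only [Set.mem_ofPred_eq]; omega⟩,
      ⟨π.bot, by have := hl π; simp only [Set.mem_ofPred_eq]; omega⟩)
  refine Finite.of_injective f fun π π' h => ?_
  simp only [f, Prod.mk.injEq, Subtype.mk.injEq] at h
  exact IntervalExchange.ext h.1 h.2

/-! ### Moves -/

theorem Moves.rows {π π' : IntervalExchange d} {w l : Fin d} (h : Moves π w l π') :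
    ∃ s, (∃ A B C, π.row s = A ++ [w] ∧ π.row (!s) = B ++ [w] ++ C ++ [l] ∧
        π'.row s = A ++ [w] ∧ π'.row (!s) = B ++ [w, l] ++ C) ∨
      ∃ A B C, π.row s = A ++ [w] ++ B ++ [w] ∧ π.row (!s) = C ++ [l] ∧
        π'.row s = A ++ [l, w] ++ B ++ [w] ∧ π'.row (!s) = C := by
  cases h with
  | topPreserving _ _ A B C h h' => exact ⟨true, .inl ⟨A, B, C, rfl, rfl, rfl, rfl⟩⟩
  | topReversing _ _ A B C h h' => exact ⟨true, .inr ⟨A, B, C, rfl, rfl, rfl, rfl⟩⟩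
  | botPreserving _ _ A B C h h' => exact ⟨false, .inl ⟨A, B, C, rfl, rfl, rfl, rfl⟩⟩
  | botReversing _ _ A B C h h' => exact ⟨false, .inr ⟨A, B, C, rfl, rfl, rfl, rfl⟩⟩

/-- `π.IsLast s a`: the band `a` is in the critical position on side `s`. -/
def IsLast (π : IntervalExchange d) (s : Bool) (a : Fin d) : Prop := ∃ L, π.row s = L ++ [a]

theorem IsLast.mem {π : IntervalExchange d} {s : Bool} {a : Fin d} (h : π.IsLast s a) :
    a ∈ π.row s := by
  obtain ⟨L, hL⟩ := h
  simp [hL]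

theorem IsLast.unique {π : IntervalExchange d} {s : Bool} {a b : Fin d} (h : π.IsLast s a)
    (h' : π.IsLast s b) : a = b := by
  obtain ⟨L, hL⟩ := h
  obtain ⟨L', hL'⟩ := h'
  rw [hL] at hL'
  simpa using (List.append_inj' hL' rfl).2

theorem Moves.isLast {π π' : IntervalExchange d} {w l : Fin d} (h : Moves π w l π') :
    ∃ s, π.IsLast s w ∧ π.IsLast (!s) l ∧ π'.IsLast s w := by
  obtain ⟨s, ⟨A, B, C, h1, h2, h3, h4⟩ | ⟨A, B, C, h1, h2, h3, h4⟩⟩ := h.rows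
  · exact ⟨s, ⟨_, h1⟩, ⟨_, h2⟩, ⟨_, h3⟩⟩
  · exact ⟨s, ⟨_, h1⟩, ⟨_, h2⟩, ⟨_, h3⟩⟩

theorem exists_moves {π : IntervalExchange d} {s : Bool} {w l : Fin d} (hw : π.IsLast s w)
    (hl : π.IsLast (!s) l) (hne : w ≠ l) : ∃ π', Moves π w l π' := by
  obtain ⟨A, hA⟩ := hw
  obtain ⟨B, hB⟩ := hl
  have hc := π.count_row_add s w
  rw [hA, hB] at hc
  simp only [List.count_append, List.count_singleton_self, List.count_singleton, beq_iff_eq,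
    hne.symm, if_false, add_zero] at hc
  have key : 0 < A.count w ∨ 0 < B.count w := by omega
  have mk : ∀ {π₁ : IntervalExchange d} {P R P' R' : List (Fin d)}, π₁.top = P → π₁.bot = R →
      (∀ α, (P' ++ R').count α = (P ++ R).count α) →
      (∀ h h', Moves ⟨P, R, h⟩ w l ⟨P', R', h'⟩) → ∃ π', Moves π₁ w l π' := by
    rintro ⟨_, _, h⟩ P R P' R' rfl rfl h1 h2
    exact ⟨⟨P', R', fun α => by rw [h1, h]⟩, h2 _ _⟩
  rcases key with h1 | h1
  · obtain ⟨A1, A2, rfl⟩ := List.append_of_mem (List.count_pos_iff.1 h1)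
    rw [← List.singleton_append, ← List.append_assoc] at hA
    cases s
    · exact mk hB hA (fun α => by
        simp only [List.count_append, List.count_cons, List.count_nil]; omega)
        (Moves.botReversing w l A1 A2 B)
    · exact mk hA hB (fun α => by
        simp only [List.count_append, List.count_cons, List.count_nil]; omega)
        (Moves.topReversing w l A1 A2 B)
  · obtain ⟨B1, B2, rfl⟩ := List.append_of_mem (List.count_pos_iff.1 h1)
    rw [← List.singleton_append, ← List.append_assoc] at hB
    cases s
    · exact mk hB hA (fun α => by
        simp only [List.count_append, List.count_cons, List.count_nil]; omega)
        (Moves.botPreserving w l A B1 B2)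
    · exact mk hA hB (fun α => by
        simp only [List.count_append, List.count_cons, List.count_nil]; omega)
        (Moves.topPreserving w l A B1 B2)

theorem splitMatrix_mulVec (w l : Fin d) (x : Fin d → ℝ) :
    (splitMatrix w l).mulVec x = x + Pi.single w (x l) := by
  rw [splitMatrix, Matrix.add_mulVec, Matrix.one_mulVec, Matrix.single_mulVec]
  simp [Pi.single]

theorem splitMatrix_mulVec_self {w l : Fin d} (x : Fin d → ℝ) :
    (splitMatrix w l).mulVec x w = x w + x l := by
  simp [splitMatrix_mulVec]

theorem splitMatrix_mulVec_of_ne {w l α : Fin d} (h : α ≠ w) (x : Fin d → ℝ) :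
    (splitMatrix w l).mulVec x α = x α := by
  simp [splitMatrix_mulVec, h]

theorem sum_map_splitMatrix (w l : Fin d) (x : Fin d → ℝ) (L : List (Fin d)) :
    (L.map ((splitMatrix w l).mulVec x)).sum = (L.map x).sum + L.count w * x l := by
  induction L with
  | nil => simp
  | cons a L ih =>
    rw [List.map_cons, List.sum_cons, ih, List.map_cons, List.sum_cons]
    by_cases h : a = w
    · subst h
      rw [splitMatrix_mulVec_self, List.count_cons_self]
      push_cast; ring
    · rw [splitMatrix_mulVec_of_ne h, List.count_cons_of_ne h]
      ring

/-- A move cuts a piece of length `x l` off the right end of the interval, so both rows become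
shorter by the same amount. -/
theorem Moves.switchCondition_iff {π π' : IntervalExchange d} {w l : Fin d}
    (h : Moves π w l π') (x : Fin d → ℝ) :
    π.SwitchCondition ((splitMatrix w l).mulVec x) ↔ π'.SwitchCondition x := by
  obtain ⟨s, hs⟩ := h.rows
  have hc := π.count_row_add s w
  rw [switchCondition_iff_row π s, switchCondition_iff_row π' s, sum_map_splitMatrix,
    sum_map_splitMatrix]
  rcases hs with ⟨A, B, C, h1, h2, h3, h4⟩ | ⟨A, B, C, h1, h2, h3, h4⟩
  · have e1 : (π.row s).count w = 1 := by
      have : 0 < (π.row s).count w := by simp [h1]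
      have : 0 < (π.row (!s)).count w := by simp [h2]
      omega
    have e2 : (π.row (!s)).count w = 1 := by omega
    rw [e1, e2, h1, h2, h3, h4]
    simp only [List.map_append, List.sum_append, List.map_cons, List.map_nil, List.sum_cons,
      List.sum_nil]
    constructor <;> intro h <;> push_cast at * <;> linarith
  · have e1 : (π.row s).count w = 2 := by
      have : 2 ≤ (π.row s).count w := by
        simp only [h1, List.count_append, List.count_singleton_self]; omega
      omega
    have e2 : (π.row (!s)).count w = 0 := by omega
    rw [e1, e2, h1, h2, h3, h4]
    simp only [List.map_append, List.sum_append, List.map_cons, List.map_nil, List.sum_cons,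
      List.sum_nil]
    constructor <;> intro h <;> push_cast at * <;> linarith

/-- If the band in one critical position cannot be narrower than the one in the other critical
position, then it is the only orientation reversing band on its side. -/
theorem rev_eq_singleton_of_forall_le {π : IntervalExchange d} {s : Bool} {a b : Fin d}
    (ha : a ∈ π.row s) (hb : b ∈ π.row (!s)) (hab : a ≠ b) (hrec : π.IsRecurrent)
    (h : ∀ x : Fin d → ℝ, (∀ α, 0 < x α) → π.SwitchCondition x → x b ≤ x a) :
    π.rev s = {a} ∧ b ∈ π.rev (!s) := by
  obtain ⟨x, hx, hsw⟩ := hrec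
  simp_rw [switchCondition_iff_rev π s] at h hsw
  -- The width of an orientation preserving band is free: shrinking `a` or enlarging `b` would
  -- violate the assumed inequality, so both are reversing.
  have upd : ∀ c t, c ∉ π.rev s → c ∉ π.rev (!s) → 0 < t →
      Function.update x c t b ≤ Function.update x c t a := fun c t h1 h2 ht => by
    refine h _ (fun α => ?_) ?_
    · by_cases hα : α = c
      · subst hα; simpa
      · simpa [hα] using hx α
    · rw [Finset.sum_update_of_notMem h1, Finset.sum_update_of_notMem h2, hsw]
  have hans : a ∉ π.rev (!s) := by
    rw [← mem_row_not_iff, Bool.not_not]; exact ha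
  have hbns : b ∉ π.rev s := mem_row_not_iff.1 hb
  have has : a ∈ π.rev s := by
    by_contra hn
    have := upd a (x b / 2) hn hans (half_pos (hx b))
    rw [Function.update_self, Function.update_of_ne hab.symm] at this
    linarith [hx b]
  have hbs : b ∈ π.rev (!s) := by
    by_contra hn
    have := upd b (x a + 1) hbns hn (by linarith [hx a])
    rw [Function.update_self, Function.update_of_ne hab] at this
    linarith
  refine ⟨?_, hbs⟩
  by_contra hne
  obtain ⟨c, hc, hca⟩ : ∃ c ∈ π.rev s, c ≠ a := by
    by_contra hcon
    push Not at hcon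
    exact hne (Finset.eq_singleton_iff_unique_mem.2 ⟨has, hcon⟩)
  have hcn := notMem_rev_not hc
  have hcb : b ≠ c := fun e => hcn (e ▸ hbs)
  -- Width is transferred from `a` to a second reversing band `c` on the same side until `a` has
  -- width `ε < x b`.
  set ε := min (x a) (x b) / 2 with hε
  have hm : 0 < min (x a) (x b) := lt_min (hx a) (hx b)
  have hma := min_le_left (x a) (x b)
  have hmb := min_le_right (x a) (x b)
  set t := x a - ε with ht
  have := h (x + Pi.single c t - Pi.single a t) (fun α => ?_) ?_
  · simp only [Pi.add_apply, Pi.sub_apply, Pi.single_apply, hcb, hab.symm, hca.symm,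
      if_true, if_false] at this
    linarith
  · simp only [Pi.add_apply, Pi.sub_apply, Pi.single_apply]
    have := hx α
    split_ifs with h1 h2 h2
    · exact absurd (h1.symm.trans h2) hca
    · linarith
    · subst h2; linarith
    · linarith
  · simp only [Pi.add_apply, Pi.sub_apply, Finset.sum_add_distrib, Finset.sum_sub_distrib,
      Finset.sum_pi_single', hc, hcn, has, hans, if_true, if_false, hsw]
    ring

/-! ### Splits -/

theorem Split.ne {π π' : IntervalExchange d} {w l : Fin d} (h : Split π w l π') : w ≠ l := by
  obtain ⟨-, x, -, -, hx⟩ := h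
  rintro rfl
  exact lt_irrefl _ hx

theorem Split.isRecurrent {π π' : IntervalExchange d} {w l : Fin d} (h : Split π w l π') :
    π.IsRecurrent := by
  obtain ⟨-, x, hx, hs, -⟩ := h
  exact ⟨x, hx, hs⟩

/-- Admissible widths for the split with `x l < x w` become positive widths for the new type once `x
l` is subtracted from the winner. -/
theorem Split.isRecurrent_right {π π' : IntervalExchange d} {w l : Fin d}
    (h : Split π w l π') : π'.IsRecurrent := by
  have hne := h.ne
  obtain ⟨hm, x, hx, hs, hlt⟩ := h
  refine ⟨x - Pi.single w (x l), fun α => ?_, ?_⟩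
  · by_cases hα : α = w
    · subst hα; simpa
    · simpa [hα] using hx α
  · rw [← hm.switchCondition_iff, splitMatrix_mulVec]
    simpa [hne.symm] using hs

theorem SplitPath.isRecurrent {n : ℕ} {π π' : IntervalExchange d}
    {Q : Matrix (Fin d) (Fin d) ℝ} (h : SplitPath n π π' Q) (hπ : π.IsRecurrent) :
    π'.IsRecurrent := by
  cases h with
  | nil => exact hπ
  | snoc _ h => exact h.isRecurrent_right

theorem SplitPath.trans {m n : ℕ} {π π' π'' : IntervalExchange d}
    {Q R : Matrix (Fin d) (Fin d) ℝ} (h : SplitPath m π π' Q) (h' : SplitPath n π' π'' R) :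
    SplitPath (m + n) π π'' (Q * R) := by
  induction h' with
  | nil => simpa using h
  | snoc _ hs ih => simpa [← mul_assoc, ← add_assoc] using SplitPath.snoc (ih h) hs

theorem Split.splitPath {π π' : IntervalExchange d} {w l : Fin d} (h : Split π w l π') :
    SplitPath 1 π π' (splitMatrix w l) := by
  simpa using (SplitPath.nil π).snoc h

/-- One split, labels remembered. -/
def Step (π π' : IntervalExchange d) : Prop := ∃ w l, Split π w l π'

theorem SplitPath.reach {n : ℕ} {π π' : IntervalExchange d}
    {Q : Matrix (Fin d) (Fin d) ℝ} (h : SplitPath n π π' Q) :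
    Relation.ReflTransGen Step π π' := by
  induction h with
  | nil => exact .refl
  | snoc _ hs ih => exact ih.tail ⟨_, _, hs⟩

/-! ### Relabelling -/

@[simp] theorem relabel_one (π : IntervalExchange d) : π.relabel 1 = π := by
  ext1 <;> simp [relabel]

@[simp] theorem relabel_relabel (σ τ : Equiv.Perm (Fin d)) (π : IntervalExchange d) :
    (π.relabel σ).relabel τ = π.relabel (τ * σ) := by
  ext1 <;> simp [relabel]

theorem row_relabel (σ : Equiv.Perm (Fin d)) (π : IntervalExchange d) (s : Bool) :
    (π.relabel σ).row s = (π.row s).map σ := by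
  cases s <;> rfl

theorem Moves.relabel {π π' : IntervalExchange d} {w l : Fin d} (h : Moves π w l π')
    (σ : Equiv.Perm (Fin d)) : Moves (π.relabel σ) (σ w) (σ l) (π'.relabel σ) := by
  have key : ∀ {π₁ π₂ π₃ π₄ : IntervalExchange d}, π₁ = π₃ → π₂ = π₄ →
      Moves π₁ (σ w) (σ l) π₂ → Moves π₃ (σ w) (σ l) π₄ := by
    rintro _ _ _ _ rfl rfl h; exact h
  have hπ := (π.relabel σ).count_two
  have hπ' := (π'.relabel σ).count_two
  cases h with
  | topPreserving _ _ A B C h h' =>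
    refine key ?_ ?_ (Moves.topPreserving (σ w) (σ l) (A.map σ) (B.map σ) (C.map σ)
      (by simpa [IntervalExchange.relabel] using hπ)
      (by simpa [IntervalExchange.relabel] using hπ')) <;>
    ext1 <;> simp [IntervalExchange.relabel]
  | topReversing _ _ A B C h h' =>
    refine key ?_ ?_ (Moves.topReversing (σ w) (σ l) (A.map σ) (B.map σ) (C.map σ)
      (by simpa [IntervalExchange.relabel] using hπ)
      (by simpa [IntervalExchange.relabel] using hπ')) <;>
    ext1 <;> simp [IntervalExchange.relabel]
  | botPreserving _ _ A B C h h' =>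
    refine key ?_ ?_ (Moves.botPreserving (σ w) (σ l) (A.map σ) (B.map σ) (C.map σ)
      (by simpa [IntervalExchange.relabel] using hπ)
      (by simpa [IntervalExchange.relabel] using hπ')) <;>
    ext1 <;> simp [IntervalExchange.relabel]
  | botReversing _ _ A B C h h' =>
    refine key ?_ ?_ (Moves.botReversing (σ w) (σ l) (A.map σ) (B.map σ) (C.map σ)
      (by simpa [IntervalExchange.relabel] using hπ)
      (by simpa [IntervalExchange.relabel] using hπ')) <;>
    ext1 <;> simp [IntervalExchange.relabel]

theorem Split.relabel {π π' : IntervalExchange d} {w l : Fin d} (h : Split π w l π')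
    (σ : Equiv.Perm (Fin d)) : Split (π.relabel σ) (σ w) (σ l) (π'.relabel σ) := by
  obtain ⟨hm, x, hx, hs, hlt⟩ := h
  refine ⟨hm.relabel σ, x ∘ σ.symm, fun α => hx _, ?_, by simpa using hlt⟩
  rw [switchCondition_iff_row _ true] at hs ⊢
  rw [row_relabel, row_relabel, List.map_map, List.map_map]
  simpa [Function.comp_assoc] using hs

theorem Step.relabel {π π' : IntervalExchange d} (h : Step π π') (σ : Equiv.Perm (Fin d)) :
    Step (π.relabel σ) (π'.relabel σ) := by
  obtain ⟨w, l, h⟩ := h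
  exact ⟨_, _, h.relabel σ⟩

theorem reach_relabel {π π' : IntervalExchange d} (h : Relation.ReflTransGen Step π π')
    (σ : Equiv.Perm (Fin d)) :
    Relation.ReflTransGen Step (π.relabel σ) (π'.relabel σ) :=
  h.lift (fun π => π.relabel σ) fun _ _ h => h.relabel σ

theorem Step.reducedArrow {π π' : IntervalExchange d} (h : Step π π') : ReducedArrow π π' := by
  obtain ⟨w, l, h⟩ := h
  exact ⟨1, 1, w, l, by simpa using h⟩

theorem exists_step_of_reducedArrow {π π' : IntervalExchange d} (h : ReducedArrow π π') :
    ∃ τ, Step π (π'.relabel τ) := by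
  obtain ⟨σ, τ, w, l, h⟩ := h
  exact ⟨σ⁻¹ * τ, _, _, by simpa using h.relabel σ⁻¹⟩

theorem exists_reach_of_transGen {π π' : IntervalExchange d}
    (h : Relation.TransGen ReducedArrow π π') :
    ∃ τ, Relation.TransGen Step π (π'.relabel τ) := by
  induction h with
  | single h =>
    obtain ⟨τ, h⟩ := exists_step_of_reducedArrow h
    exact ⟨τ, .single h⟩
  | tail _ h ih =>
    obtain ⟨τ, ih⟩ := ih
    obtain ⟨σ, h⟩ := exists_step_of_reducedArrow h
    exact ⟨τ * σ, ih.tail (by simpa using h.relabel τ)⟩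

theorem InSink.exists_transGen {π₀ π : IntervalExchange d} (h : π₀.InSink)
    (hr : Relation.ReflTransGen Step π₀ π) :
    ∃ τ, Relation.TransGen Step π (π₀.relabel τ) :=
  exists_reach_of_transGen (h π (Relation.ReflTransGen.mono (fun _ _ h => h.reducedArrow) _ _ hr))

/-- The labelled types that can be reached from a type in a sink are strongly connected. -/
theorem InSink.reach_symm {π₀ π : IntervalExchange d} (h : π₀.InSink)
    (hr : Relation.ReflTransGen Step π₀ π) : Relation.ReflTransGen Step π π₀ := by
  obtain ⟨τ, hτ⟩ := h.exists_transGen hr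
  have h1 : Relation.ReflTransGen Step π₀ (π₀.relabel τ) := hr.trans hτ.to_reflTransGen
  -- Returning to the unlabelled type permutes the labels by `τ`. Repeating the relabelled loop
  -- until the order of `τ` is reached restores the labels.
  have h2 : ∀ k, Relation.ReflTransGen Step (π₀.relabel τ) (π₀.relabel (τ ^ (k + 1))) := by
    intro k
    induction k with
    | zero => simpa using Relation.ReflTransGen.refl
    | succ k ih =>
      refine ih.trans ?_
      simpa [← pow_succ] using reach_relabel h1 (τ ^ (k + 1))
  have h3 := h2 (orderOf τ - 1)
  rw [Nat.sub_add_cancel (orderOf_pos τ), pow_orderOf_eq_one, relabel_one] at h3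
  exact hτ.to_reflTransGen.trans h3

theorem InSink.exists_split {π₀ π : IntervalExchange d} (h : π₀.InSink)
    (hr : Relation.ReflTransGen Step π₀ π) : ∃ w l π', Split π w l π' := by
  obtain ⟨τ, hτ⟩ := h.exists_transGen hr
  obtain ⟨_, ⟨w, l, h⟩, _⟩ := Relation.TransGen.head'_iff.1 hτ
  exact ⟨w, l, _, h⟩

end IntervalExchange

namespace IntervalExchange
variable {d : ℕ}

/-! ### Parity of the number of cusps -/

/-- The boundary curve through a side of a band, as a set of sides of bands. -/
def boundaryClass (π : IntervalExchange d) (x : π.BandEnd × Bool) : Set (π.BandEnd × Bool) :=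
  {y | Relation.EqvGen π.Adjacent x y}

theorem mem_boundaryClass_iff {π : IntervalExchange d} {x y z : π.BandEnd × Bool}
    (h : π.Adjacent y z) : y ∈ π.boundaryClass x ↔ z ∈ π.boundaryClass x :=
  ⟨fun hy => .trans _ _ _ hy (.rel _ _ h), fun hz => .trans _ _ _ hz (.symm _ _ (.rel _ _ h))⟩

theorem self_mem_boundaryClass {π : IntervalExchange d} (x : π.BandEnd × Bool) :
    x ∈ π.boundaryClass x := .refl x

theorem List.get_inj_of_count_eq_one {L : List (Fin d)} {i j : Fin L.length} {α : Fin d}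
    (h : L.count α = 1) (hi : L.get i = α) (hj : L.get j = α) : i = j := by
  by_contra hne
  have hdup : L.Duplicate α := by
    rw [List.duplicate_iff_exists_distinct_get]
    rcases lt_or_gt_of_ne hne with h1 | h1
    · exact ⟨i, j, h1, hi.symm, hj.symm⟩
    · exact ⟨j, i, h1, hj.symm, hi.symm⟩
  have := List.duplicate_iff_two_le_count.1 hdup
  omega

theorem count_row_eq_one {π : IntervalExchange d} {α : Fin d} (h : π.top.count α = 1) (s : Bool) :
    (π.row s).count α = 1 := by
  have := π.count_row_add true α
  cases s
  · change π.bot.count α = 1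
    change π.top.count α + π.bot.count α = 2 at this
    omega
  · exact h

theorem exists_opposite_end {π : IntervalExchange d} (e : π.BandEnd)
    (h : π.top.count (π.label e) = 1) : ∃ e' : π.BandEnd, e'.1 = !e.1 ∧ π.label e' = π.label e := by
  have : π.label e ∈ π.row (!e.1) := by
    rw [← List.count_pos_iff, count_row_eq_one h]; exact one_pos
  obtain ⟨i, hi⟩ := List.get_of_mem this
  exact ⟨⟨!e.1, i⟩, rfl, hi⟩

theorem bandEnd_eq {π : IntervalExchange d} {e e' : π.BandEnd} (h : π.top.count (π.label e) = 1)
    (h1 : e'.1 = e.1) (h2 : π.label e' = π.label e) : e' = e := by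
  obtain ⟨s, i⟩ := e
  obtain ⟨s', i'⟩ := e'
  simp only at h1
  subst h1
  exact congrArg _ (List.get_inj_of_count_eq_one (count_row_eq_one h s') h2 rfl)

open Classical in
-- An orientation preserving band is glued by a translation, so its two ends have their sides of the
-- same kind `b` on the same curve. Opposite ends therefore cancel in pairs mod 2.
theorem sum_preserving_ends {π : IntervalExchange d} {p : Fin d → Prop}
    (hp : ∀ α, p α → π.top.count α = 1) {K : Set (π.BandEnd × Bool)}
    (hK : ∀ x y, π.Adjacent x y → (x ∈ K ↔ y ∈ K)) (b : Bool) :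
    ∑ e : π.BandEnd, (if p (π.label e) ∧ (e, b) ∈ K then (1 : ZMod 2) else 0) = 0 := by
  rw [← Finset.sum_filter]
  have hmem : ∀ e, e ∈ Finset.univ.filter (fun e : π.BandEnd => p (π.label e) ∧ (e, b) ∈ K) →
      π.top.count (π.label e) = 1 := fun e he => hp _ (Finset.mem_filter.1 he).2.1
  choose g hg1 hg2 using fun e he => exists_opposite_end e (hmem e he)
  have hgm : ∀ e he, g e he ∈
      Finset.univ.filter (fun e : π.BandEnd => p (π.label e) ∧ (e, b) ∈ K) := fun e he => by
    have h := (Finset.mem_filter.1 he).2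
    refine Finset.mem_filter.2 ⟨Finset.mem_univ _, by rw [hg2]; exact h.1, ?_⟩
    refine (hK _ _ (.preserving _ _ b (hg2 e he).symm ?_)).1 h.2
    rw [hg1]
    cases e.1 <;> simp
  refine Finset.sum_involution g (fun _ _ => by decide) (fun e he _ h => ?_) hgm fun e he => ?_
  · have := hg1 e he
    rw [h] at this
    revert this
    cases e.1 <;> simp
  · refine bandEnd_eq (hmem e he) ?_ ?_
    · rw [hg1, hg1, Bool.not_not]
    · rw [hg2, hg2]

open Classical in
/-- Indicator of the sides of bands, numbered along a row, with label in `p` that lie in `K`. -/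
noncomputable def sideInd (π : IntervalExchange d) (p : Fin d → Prop)
    (K : Set (π.BandEnd × Bool)) (b s : Bool) (i : ℕ) : ZMod 2 :=
  if ∃ h : i < (π.row s).length, p (π.label ⟨s, i, h⟩) ∧ (⟨s, i, h⟩, b) ∈ K then 1 else 0

theorem sideInd_congr {π : IntervalExchange d} {p : Fin d → Prop}
    {K : Set (π.BandEnd × Bool)} {b b' s s' : Bool} {i i' : ℕ} (h : i < (π.row s).length)
    (h' : i' < (π.row s').length) (hp : p (π.label ⟨s, i, h⟩) ↔ p (π.label ⟨s', i', h'⟩))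
    (hK : ((⟨s, i, h⟩, b) : π.BandEnd × Bool) ∈ K ↔ ((⟨s', i', h'⟩, b') : π.BandEnd × Bool) ∈ K) :
    π.sideInd p K b s i = π.sideInd p K b' s' i' := by
  unfold sideInd
  congr 1
  rw [eq_iff_iff, exists_prop_of_true h, exists_prop_of_true h', hp, hK]

theorem sum_sideInd {π : IntervalExchange d} {p : Fin d → Prop}
    (hp : ∀ α, p α → π.top.count α = 1) {K : Set (π.BandEnd × Bool)}
    (hK : ∀ x y, π.Adjacent x y → (x ∈ K ↔ y ∈ K)) (b : Bool) :
    ∑ i ∈ Finset.range (π.row true).length, π.sideInd p K b true i +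
      ∑ i ∈ Finset.range (π.row false).length, π.sideInd p K b false i = 0 := by
  classical
  rw [← sum_preserving_ends hp hK b, Fintype.sum_sigma, Fintype.sum_bool,
    ← Fin.sum_univ_eq_sum_range, ← Fin.sum_univ_eq_sum_range]
  congr 1 <;>
  · refine Finset.sum_congr rfl fun i _ => ?_
    unfold sideInd
    congr 1
    rw [eq_iff_iff, exists_prop_of_true i.2]

theorem sideInd_last {π : IntervalExchange d} {p : Fin d → Prop} {K : Set (π.BandEnd × Bool)}
    (hK : ∀ x y, π.Adjacent x y → (x ∈ K ↔ y ∈ K)) {m n : ℕ} (hm : (π.row true).length = m + 1)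
    (hn : (π.row false).length = n + 1)
    (hp : p (π.label ⟨true, m, by omega⟩) ↔ p (π.label ⟨false, n, by omega⟩)) :
    π.sideInd p K true true m = π.sideInd p K true false n :=
  sideInd_congr (by omega) (by omega) hp
    (hK _ _ (.right _ _ (by simp) (by simp [hm]) (by simp [hn])))

/-- A boundary curve that meets only orientation preserving bands has an even number of cusps. -/
theorem even_ncard_cuspsAlong {π : IntervalExchange d} {p : Fin d → Prop}
    (hp : ∀ α, p α → π.top.count α = 1) (htop : π.top ≠ []) (hbot : π.bot ≠ [])
    {x : π.BandEnd × Bool} (hx : ∀ y ∈ π.boundaryClass x, p (π.label y.1)) :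
    Even (π.cuspsAlong x).ncard := by
  classical
  set K := π.boundaryClass x with hKdef
  have hK : ∀ x y, π.Adjacent x y → (x ∈ K ↔ y ∈ K) := fun _ _ h => mem_boundaryClass_iff h
  obtain ⟨m, hm⟩ := Nat.exists_eq_add_one_of_ne_zero (mt List.length_eq_zero_iff.1 htop)
  obtain ⟨n, hn⟩ := Nat.exists_eq_add_one_of_ne_zero (mt List.length_eq_zero_iff.1 hbot)
  change (π.row true).length = _ at hm
  change (π.row false).length = _ at hn
  -- Every right side of an end carries a cusp, except at the last end of each row. These two
  -- exceptions are joined around the right end of the interval, so they cancel mod 2.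
  have hlast : π.sideInd p K true true m = π.sideInd p K true false n := by
    have key := hK _ _ (Adjacent.right (π := π) ⟨true, m, by omega⟩ ⟨false, n, by omega⟩
      (by simp) (by simp [hm]) (by simp [hn]))
    unfold sideInd
    congr 1
    rw [eq_iff_iff, exists_prop_of_true (by omega), exists_prop_of_true (by omega)]
    exact ⟨fun h => ⟨hx _ (key.1 h.2), key.1 h.2⟩, fun h => ⟨hx _ (key.2 h.2), key.2 h.2⟩⟩
  have hsum := sum_sideInd hp hK true
  rw [hm, hn, Finset.sum_range_succ, Finset.sum_range_succ, hlast] at hsum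
  have hcard : ((π.cuspsAlong x).ncard : ZMod 2) =
      ∑ i ∈ Finset.range m, π.sideInd p K true true i +
        ∑ i ∈ Finset.range n, π.sideInd p K true false i := by
    have : π.cuspsAlong x = ((Finset.univ.filter fun e : π.BandEnd =>
        (e.2 : ℕ) + 1 < (π.row e.1).length ∧ (e, true) ∈ K : Finset π.BandEnd) :
          Set π.BandEnd) := by
      ext e; simp [cuspsAlong, hKdef, boundaryClass]
    rw [this, Set.ncard_coe_finset, Finset.card_filter, Fintype.sum_sigma, Fintype.sum_bool]
    push_cast
    have aux : ∀ (s : Bool) (k : ℕ), (π.row s).length = k + 1 →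
        ∑ i : Fin (π.row s).length, (if ((i : ℕ) + 1 < (π.row s).length ∧
          ((⟨s, i⟩, true) : π.BandEnd × Bool) ∈ K) then (1 : ZMod 2) else 0) =
        ∑ i ∈ Finset.range k, π.sideInd p K true s i := by
      intro s k hk
      have : ∑ i ∈ Finset.range k, π.sideInd p K true s i =
          ∑ i ∈ Finset.range (π.row s).length,
            (if i + 1 < (π.row s).length then π.sideInd p K true s i else 0) := by
        rw [hk, Finset.sum_range_succ]
        simp only [lt_irrefl, if_false, add_zero]
        refine Finset.sum_congr rfl fun i hi => ?_
        rw [if_pos (by have := Finset.mem_range.1 hi; omega)]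
      rw [this, ← Fin.sum_univ_eq_sum_range
        (fun i => if i + 1 < (π.row s).length then π.sideInd p K true s i else 0)]
      refine Finset.sum_congr rfl fun i _ => ?_
      rw [ite_and]
      congr 1
      unfold sideInd
      congr 1
      rw [eq_iff_iff, exists_prop_of_true i.2]
      exact ⟨fun h => ⟨hx _ h, h⟩, fun h => h.2⟩
    rw [← aux true m hm, ← aux false n hn]
  have h2 : ∀ a b c : ZMod 2, a + c + (b + c) = 0 → a + b = 0 := by decide
  rw [← ZMod.natCast_eq_zero_iff_even, hcard]
  exact h2 _ _ _ hsum

theorem IsComplete.not_even {π : IntervalExchange d} (h : π.IsComplete)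
    (x : π.BandEnd × Bool) : ¬ Even (π.cuspsAlong x).ncard := by
  rcases h x with h | h <;> rw [h] <;> decide

theorem sum_telescope {M : Type*} [AddCommGroup M] (t f : ℕ → M) (m : ℕ)
    (h : ∀ j < m, t j = f (j + 1)) :
    ∑ j ∈ Finset.range (m + 1), t j - ∑ j ∈ Finset.range (m + 1), f j = t m - f 0 := by
  rw [Finset.sum_range_succ, Finset.sum_range_succ', Finset.sum_congr rfl
    fun j hj => h j (Finset.mem_range.1 hj)]
  abel

/-- Both rows of `π` are cut into a left and a right part, and no band connects the parts. -/
structure Block (π : IntervalExchange d) (q : Fin d → Prop) (X U : Bool → List (Fin d)) :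
    Prop where
  row_eq : ∀ s, π.row s = X s ++ U s
  left_ne : ∀ s, X s ≠ []
  right_ne : ∀ s, U s ≠ []
  left_not : ∀ s, ∀ α ∈ X s, ¬ q α
  right_mem : ∀ s, ∀ α ∈ U s, q α

/-! ### Boundary curves of a type that falls into two blocks -/

namespace Block

variable {π : IntervalExchange d} {q : Fin d → Prop} {X U : Bool → List (Fin d)}

theorem length_eq (B : Block π q X U) (s : Bool) :
    (π.row s).length = (X s).length + (U s).length := by
  rw [B.row_eq, List.length_append]

theorem left_pos (B : Block π q X U) (s : Bool) : 0 < (X s).length :=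
  List.length_pos_iff.2 (B.left_ne s)

theorem right_pos (B : Block π q X U) (s : Bool) : 0 < (U s).length :=
  List.length_pos_iff.2 (B.right_ne s)

theorem label_iff (B : Block π q X U) (e : π.BandEnd) :
    q (π.label e) ↔ (X e.1).length ≤ e.2 := by
  obtain ⟨s, i, hi⟩ := e
  have hl : π.label ⟨s, i, hi⟩ = (X s ++ U s)[i]'(by rw [← B.row_eq]; exact hi) := by
    simp only [label, List.get_eq_getElem]
    congr 1
    exact B.row_eq s
  rw [hl]
  simp only
  constructor
  · intro h
    by_contra hlt
    rw [not_le] at hlt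
    rw [List.getElem_append_left hlt] at h
    exact B.left_not s _ (List.getElem_mem _) h
  · intro h
    rw [List.getElem_append_right h]
    exact B.right_mem s _ (List.getElem_mem _)

/-- The last end of the left part. -/
def cut (B : Block π q X U) (s : Bool) : π.BandEnd :=
  ⟨s, (X s).length - 1, by have := B.left_pos s; rw [B.length_eq]; omega⟩

/-- The first end of the right part. -/
def cut' (B : Block π q X U) (s : Bool) : π.BandEnd :=
  ⟨s, (X s).length, by have := B.right_pos s; rw [B.length_eq]; omega⟩

theorem adjacent_cut (B : Block π q X U) (s : Bool) :
    π.Adjacent (B.cut s, true) (B.cut' s, false) :=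
  .cusp _ _ rfl (by have := B.left_pos s; simp only [cut, cut']; omega)

/-- A boundary curve can pass from one block to the other only through a cusp at a cut: bands stay
in their block, and around either end of the interval both rows lie in the same block. -/
theorem label_iff_of_adjacent (B : Block π q X U) {K : Set (π.BandEnd × Bool)}
    (hcut : ∀ s, (B.cut s, true) ∉ K) {x y : π.BandEnd × Bool}
    (h : π.Adjacent x y) (hx : x ∈ K) : q (π.label x.1) ↔ q (π.label y.1) := by
  cases h with
  | preserving e e' b h _ => simp only [h]
  | reversing e e' b h _ _ => simp only [h]
  | cusp e e' h1 h2 =>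
    obtain ⟨s, i, hi⟩ := e
    obtain ⟨s', i', hi'⟩ := e'
    simp only at h1 h2
    subst h1 h2
    rw [B.label_iff, B.label_iff]
    simp only
    refine ⟨fun h => by omega, fun h => ?_⟩
    by_contra hlt
    have : i = (X s).length - 1 := by omega
    subst this
    exact hcut s hx
  | left e e' h1 h2 h3 =>
    rw [B.label_iff, B.label_iff]
    have := B.left_pos e.1
    have := B.left_pos e'.1
    simp only [h2, h3]
    omega
  | right e e' h1 h2 h3 =>
    rw [B.label_iff, B.label_iff]
    have := B.right_pos e.1
    have := B.right_pos e'.1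
    have := B.length_eq e.1
    have := B.length_eq e'.1
    constructor <;> intro _ <;> simp only <;> omega

theorem label_iff_of_mem (B : Block π q X U) {x y : π.BandEnd × Bool}
    (hcut : ∀ s, (B.cut s, true) ∉ π.boundaryClass x) (h : y ∈ π.boundaryClass x) :
    q (π.label x.1) ↔ q (π.label y.1) := by
  have : ∀ a b, Relation.EqvGen π.Adjacent a b → a ∈ π.boundaryClass x →
      (q (π.label a.1) ↔ q (π.label b.1)) := by
    intro a b hab
    induction hab with
    | rel a b h => exact fun ha => B.label_iff_of_adjacent hcut h ha
    | refl a => exact fun _ => Iff.rfl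
    | symm a b hab ih => exact fun hb => (ih (.trans _ _ _ hb (.symm _ _ hab))).symm
    | trans a b c hab hbc ih1 ih2 =>
      exact fun ha => (ih1 ha).trans (ih2 (.trans _ _ _ ha hab))
  exact this _ _ h (self_mem_boundaryClass x)

theorem top_ne (B : Block π q X U) : π.top ≠ [] := by
  have := B.row_eq true
  have h1 := B.left_ne true
  intro h
  rw [row, h] at this
  simp_all

theorem bot_ne (B : Block π q X U) : π.bot ≠ [] := by
  have := B.row_eq false
  have h1 := B.left_ne false
  intro h
  rw [row, h] at this
  simp_all

/-- If the right part contains only orientation preserving bands, then the cusps between the parts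
lie on the same boundary curve. -/
theorem cut_mem_iff_of_right (B : Block π q X U) (hq : ∀ α, q α → π.top.count α = 1)
    {K : Set (π.BandEnd × Bool)} (hK : ∀ x y, π.Adjacent x y → (x ∈ K ↔ y ∈ K)) :
    (B.cut true, true) ∈ K ↔ (B.cut false, true) ∈ K := by
  have hpre : ∀ b s, ∑ i ∈ Finset.range (π.row s).length, π.sideInd q K b s i =
      ∑ j ∈ Finset.range ((U s).length - 1 + 1), π.sideInd q K b s ((X s).length + j) := by
    intro b s
    rw [Nat.sub_add_cancel (B.right_pos s), B.length_eq, Finset.sum_range_add,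
      Finset.sum_eq_zero, zero_add]
    intro i hi
    refine if_neg ?_
    rintro ⟨h, h1, -⟩
    rw [B.label_iff] at h1
    exact absurd (Finset.mem_range.1 hi) (not_lt.2 h1)
  -- Across a cusp the right side of one end continues as the left side of the next, so within the
  -- block right sides minus left sides telescope to the last right side minus the first left side.
  have htel : ∀ s, ∑ i ∈ Finset.range (π.row s).length, π.sideInd q K true s i -
      ∑ i ∈ Finset.range (π.row s).length, π.sideInd q K false s i =
      π.sideInd q K true s ((X s).length + ((U s).length - 1)) -
        π.sideInd q K false s ((X s).length) := by
    intro s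
    rw [hpre, hpre]
    refine sum_telescope (fun j => π.sideInd q K true s ((X s).length + j))
      (fun j => π.sideInd q K false s ((X s).length + j)) _ fun j hj => ?_
    refine sideInd_congr (by rw [B.length_eq]; omega) (by rw [B.length_eq]; omega) ?_ ?_
    · rw [B.label_iff, B.label_iff]; simp only; omega
    · exact hK _ _ (.cusp _ _ rfl rfl)
  have hlast : π.sideInd q K true true ((X true).length + ((U true).length - 1)) =
      π.sideInd q K true false ((X false).length + ((U false).length - 1)) := by
    have h1 := B.right_pos true
    have h2 := B.right_pos false
    refine sideInd_last hK (by rw [B.length_eq]; omega) (by rw [B.length_eq]; omega) ?_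
    rw [B.label_iff, B.label_iff]; simp only; omega
  have e1 := sum_sideInd hq hK true
  have e2 := sum_sideInd hq hK false
  have e3 := htel true
  have e4 := htel false
  rw [hlast] at e3
  -- Right sides and left sides each have even total, and the last right sides of the two rows
  -- agree. Hence the first left sides agree too, and these sit at the cuts.
  have h0 : π.sideInd q K false true ((X true).length) =
      π.sideInd q K false false ((X false).length) := by
    generalize π.sideInd q K false true ((X true).length) = a at *
    generalize π.sideInd q K false false ((X false).length) = b at *
    have : ∀ a b c x y z w : ZMod 2, x + y = 0 → z + w = 0 → x - z = c - a → y - w = c - b →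
      a = b := by decide
    exact this _ _ _ _ _ _ _ e1 e2 e3 e4
  have hind : ∀ s, (B.cut s, true) ∈ K ↔ π.sideInd q K false s (X s).length = 1 := by
    intro s
    rw [hK _ _ (B.adjacent_cut s), sideInd]
    have hlt : (X s).length < (π.row s).length := (B.cut' s).2.2
    have hqs : q (π.label ⟨s, (X s).length, hlt⟩) := (B.label_iff _).2 le_rfl
    constructor
    · intro h; exact if_pos ⟨hlt, hqs, h⟩
    · intro h
      by_contra hn
      rw [if_neg (fun h3 => hn h3.2.2)] at h
      exact absurd h (by decide)
  rw [hind, hind, h0]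

/-- The same telescoping in the left block: now the first left sides agree, around the left end of
the interval, and it is the last right sides that sit at the cuts. -/
theorem cut_mem_iff_of_left (B : Block π q X U) (hq : ∀ α, ¬ q α → π.top.count α = 1)
    {K : Set (π.BandEnd × Bool)} (hK : ∀ x y, π.Adjacent x y → (x ∈ K ↔ y ∈ K)) :
    (B.cut true, true) ∈ K ↔ (B.cut false, true) ∈ K := by
  set p : Fin d → Prop := fun α => ¬ q α with hp
  have hpl : ∀ e : π.BandEnd, p (π.label e) ↔ (e.2 : ℕ) < (X e.1).length := fun e => by
    change ¬ q _ ↔ _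
    rw [← not_le, B.label_iff]
  have hpre : ∀ b s, ∑ i ∈ Finset.range (π.row s).length, π.sideInd p K b s i =
      ∑ j ∈ Finset.range ((X s).length - 1 + 1), π.sideInd p K b s j := by
    intro b s
    rw [Nat.sub_add_cancel (B.left_pos s), B.length_eq, Finset.sum_range_add,
      Finset.sum_eq_zero (s := Finset.range (U s).length), add_zero]
    intro i hi
    refine if_neg ?_
    rintro ⟨h, h1, -⟩
    rw [hpl] at h1
    simp only at h1
    omega
  have htel : ∀ s, ∑ i ∈ Finset.range (π.row s).length, π.sideInd p K true s i -
      ∑ i ∈ Finset.range (π.row s).length, π.sideInd p K false s i =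
      π.sideInd p K true s ((X s).length - 1) - π.sideInd p K false s 0 := by
    intro s
    rw [hpre, hpre]
    refine sum_telescope _ _ _ fun j hj => ?_
    refine sideInd_congr (by rw [B.length_eq]; omega) (by rw [B.length_eq]; omega) ?_ ?_
    · rw [hpl, hpl]; simp only; omega
    · exact hK _ _ (.cusp _ _ rfl rfl)
  have hfirst : π.sideInd p K false true 0 = π.sideInd p K false false 0 := by
    have h1 := B.left_pos true
    have h2 := B.left_pos false
    refine sideInd_congr (by rw [B.length_eq]; omega) (by rw [B.length_eq]; omega) ?_ ?_
    · rw [hpl, hpl]; simp only; omega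
    · exact hK _ _ (.left _ _ (by simp) rfl rfl)
  have e1 := sum_sideInd hq hK true
  have e2 := sum_sideInd hq hK false
  have e3 := htel true
  have e4 := htel false
  rw [hfirst] at e3
  have h0 : π.sideInd p K true true ((X true).length - 1) =
      π.sideInd p K true false ((X false).length - 1) := by
    generalize π.sideInd p K true true ((X true).length - 1) = a at *
    generalize π.sideInd p K true false ((X false).length - 1) = b at *
    have : ∀ a b c x y z w : ZMod 2, x + y = 0 → z + w = 0 → x - z = a - c → y - w = b - c →
      a = b := by decide
    exact this _ _ _ _ _ _ _ e1 e2 e3 e4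
  have hind : ∀ s, (B.cut s, true) ∈ K ↔ π.sideInd p K true s ((X s).length - 1) = 1 := by
    intro s
    rw [sideInd]
    have hX := B.left_pos s
    have hlt : (X s).length - 1 < (π.row s).length := (B.cut s).2.2
    have hqs : p (π.label ⟨s, (X s).length - 1, hlt⟩) := (hpl _).2 (by simp only; omega)
    constructor
    · intro h; exact if_pos ⟨hlt, hqs, h⟩
    · intro h
      by_contra hn
      rw [if_neg (fun h3 => hn h3.2.2)] at h
      exact absurd h (by decide)
  rw [hind, hind, h0]

/-- A curve that meets the orientation preserving block but misses the cuts stays in that block and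
has an even number of cusps, which completeness excludes. Hence the single curve through the cuts
takes up every side in the block. -/
theorem mem_of_even (B : Block π q X U) (hc : π.IsComplete)
    (hcut : ∀ {K : Set (π.BandEnd × Bool)}, (∀ x y, π.Adjacent x y → (x ∈ K ↔ y ∈ K)) →
      ((B.cut true, true) ∈ K ↔ (B.cut false, true) ∈ K)) {p : Fin d → Prop}
    (hp : ∀ α, p α → π.top.count α = 1)
    (hpq : ∀ α β, (q α ↔ q β) → (p α → p β)) (y : π.BandEnd × Bool) (hy : p (π.label y.1)) :
    y ∈ π.boundaryClass (B.cut true, true) := by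
  by_contra hn
  have h1 : (B.cut true, true) ∉ π.boundaryClass y := fun h => hn (.symm _ _ h)
  have h2 : (B.cut false, true) ∉ π.boundaryClass y := fun h =>
    h1 ((hcut fun _ _ h => mem_boundaryClass_iff h).2 h)
  refine hc.not_even y (even_ncard_cuspsAlong hp B.top_ne B.bot_ne fun z hz => ?_)
  exact hpq _ _ (B.label_iff_of_mem (Bool.rec h2 h1) hz) hy

theorem four_le_ncard {C : Set π.BandEnd} (f : Bool → ℕ) (hf : ∀ s, f s + 1 < (π.row s).length)
    (h0 : ∀ s, (⟨s, f s, (Nat.lt_succ_self _).trans (hf s)⟩ : π.BandEnd) ∈ C)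
    (h1 : ∀ s, (⟨s, f s + 1, hf s⟩ : π.BandEnd) ∈ C) : 4 ≤ C.ncard := by
  classical
  let g : Bool × Bool → π.BandEnd := fun x =>
    ⟨x.1, f x.1 + x.2.toNat, by have := hf x.1; cases x.2 <;> simp <;> omega⟩
  have hg : Function.Injective g := by
    rintro ⟨s, b⟩ ⟨s', b'⟩ h
    have h2 : s = s' := congrArg Sigma.fst h
    subst h2
    have h3 : f s + b.toNat = f s + b'.toNat :=
      congrArg (fun e : π.BandEnd => (e.2 : ℕ)) h
    revert h3
    cases b <;> cases b' <;> simp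
  have hsub : ((Finset.univ.map ⟨g, hg⟩ : Finset π.BandEnd) : Set π.BandEnd) ⊆ C := by
    intro e he
    simp only [Finset.coe_map, Function.Embedding.coeFn_mk, Finset.coe_univ, Set.image_univ,
      Set.mem_range, Prod.exists] at he
    obtain ⟨s, b, rfl⟩ := he
    cases b
    · exact h0 s
    · exact h1 s
  have := Set.ncard_le_ncard hsub (Set.toFinite C)
  rwa [Set.ncard_coe_finset, Finset.card_map, Finset.card_univ] at this

theorem perm_right (B : Block π q X U) (hq : ∀ α, q α → π.top.count α = 1) :
    (U true).Perm (U false) := by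
  rw [List.perm_iff_count]
  intro α
  by_cases hα : q α
  · have key : ∀ s, (U s).count α = 1 := fun s => by
      have := count_row_eq_one (hq α hα) s
      rwa [B.row_eq, List.count_append,
        List.count_eq_zero_of_not_mem (fun h => B.left_not s α h hα), zero_add] at this
    rw [key, key]
  · rw [List.count_eq_zero_of_not_mem (fun h => hα (B.right_mem _ α h)),
      List.count_eq_zero_of_not_mem (fun h => hα (B.right_mem _ α h))]

theorem perm_left (B : Block π q X U) (hq : ∀ α, ¬ q α → π.top.count α = 1) :
    (X true).Perm (X false) := by
  rw [List.perm_iff_count]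
  intro α
  by_cases hα : q α
  · rw [List.count_eq_zero_of_not_mem (fun h => B.left_not _ α h hα),
      List.count_eq_zero_of_not_mem (fun h => B.left_not _ α h hα)]
  · have key : ∀ s, (X s).count α = 1 := fun s => by
      have := count_row_eq_one (hq α hα) s
      rwa [B.row_eq, List.count_append,
        List.count_eq_zero_of_not_mem (fun h => hα (B.right_mem s α h)), add_zero] at this
    rw [key, key]

/-- The right part of a complete type contains an orientation reversing band. -/
theorem not_isComplete_of_right (B : Block π q X U) (hq : ∀ α, q α → π.top.count α = 1)
    (hlast : ∀ α, π.IsLast true α → ¬ π.IsLast false α) : ¬ π.IsComplete := by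
  intro hc
  have hmem := B.mem_of_even hc (B.cut_mem_iff_of_right hq) hq (fun _ _ h => h.1)
  have hperm := B.perm_right hq
  have hlen := hperm.length_eq
  -- If the block is one band, this band is last in both rows. Otherwise the one curve carries, in
  -- each row, the cusp at the cut and the next cusp to its right: four in all.
  by_cases h1 : (U true).length = 1
  · obtain ⟨α, hα⟩ := List.length_eq_one_iff.1 h1
    have hα' : U false = [α] := List.perm_singleton.1 (hα ▸ hperm).symm
    exact hlast α ⟨X true, by rw [B.row_eq, hα]⟩ ⟨X false, by rw [B.row_eq, hα']⟩
  · have h2 : ∀ s, 2 ≤ (U s).length := by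
      have := B.right_pos true
      intro s; cases s <;> omega
    have hX := B.left_pos
    have hcut : (B.cut false, true) ∈ π.boundaryClass (B.cut true, true) :=
      (B.cut_mem_iff_of_right hq fun _ _ h => mem_boundaryClass_iff h).1
        (self_mem_boundaryClass _)
    have h4 : 4 ≤ (π.cuspsAlong (B.cut true, true)).ncard := by
      refine four_le_ncard (fun s => (X s).length - 1) (fun s => ?_) (fun s => ⟨?_, ?_⟩)
        fun s => ⟨?_, hmem _ ((B.label_iff _).2 ?_)⟩
      · rw [B.length_eq]; have := h2 s; have := hX s; omega
      · simp only; rw [B.length_eq]; have := h2 s; have := hX s; omega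
      · cases s
        · exact hcut
        · exact self_mem_boundaryClass _
      · simp only; rw [B.length_eq]; have := h2 s; have := hX s; omega
      · simp only; omega
    rcases hc (B.cut true, true) with h | h <;> omega

/-- The left part of a complete type contains an orientation reversing band. -/
theorem not_isComplete_of_left (B : Block π q X U) (hq : ∀ α, ¬ q α → π.top.count α = 1) :
    ¬ π.IsComplete := by
  intro hc
  have hmem := B.mem_of_even hc (B.cut_mem_iff_of_left hq) hq (fun _ _ h => (not_congr h).1)
  have hperm := B.perm_left hq
  have hlen := hperm.length_eq
  -- If the block is one band, its left sides close up around the left end of the interval to a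
  -- curve `Z` without cusps. Otherwise the last two cusps of the block in each row, the second
  -- being at the cut, give four.
  by_cases h1 : (X true).length = 1
  · have h1' : ∀ s, (X s).length = 1 := by intro s; cases s <;> omega
    obtain ⟨z, hz⟩ := List.length_eq_one_iff.1 h1
    set Z : Set (π.BandEnd × Bool) := {y | (y.1.2 : ℕ) = 0 ∧ y.2 = false} with hZ
    have hzero : ∀ e e' : π.BandEnd, π.label e = π.label e' → (e.2 : ℕ) = 0 →
        (e'.2 : ℕ) = 0 := by
      intro e e' h he
      have h2 : ¬ q (π.label e) := by rw [B.label_iff, h1', he]; omega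
      rw [h, B.label_iff, h1'] at h2
      omega
    have hadj : ∀ x y, π.Adjacent x y → (x ∈ Z ↔ y ∈ Z) := by
      intro x y h
      cases h with
      | preserving e e' b h _ =>
        exact and_congr_left' ⟨hzero _ _ h, hzero _ _ h.symm⟩
      | reversing e e' b h hne hs =>
        have : ∀ e e' : π.BandEnd, π.label e = π.label e' → e ≠ e' → e.1 = e'.1 →
            (e.2 : ℕ) ≠ 0 := by
          intro e e' h hne hs he
          have he' := hzero _ _ h he
          obtain ⟨s, i⟩ := e
          obtain ⟨s', i'⟩ := e'
          simp only at hs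
          subst hs
          exact hne (congrArg _ (Fin.ext (he.trans he'.symm)))
        exact ⟨fun hx => absurd hx.1 (this _ _ h hne hs),
          fun hx => absurd hx.1 (this _ _ h.symm hne.symm hs.symm)⟩
      | cusp e e' h1 h2 =>
        refine ⟨fun hx => absurd hx.2 (by simp), fun hx => ?_⟩
        have := hx.1
        simp only at this
        omega
      | left e e' h1 h2 h3 => exact ⟨fun _ => ⟨h3, rfl⟩, fun _ => ⟨h2, rfl⟩⟩
      | right e e' h1 h2 h3 =>
        exact ⟨fun hx => absurd hx.2 (by simp), fun hx => absurd hx.2 (by simp)⟩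
    have hgen : ∀ x y, Relation.EqvGen π.Adjacent x y → (x ∈ Z ↔ y ∈ Z) := by
      intro x y h
      induction h with
      | rel _ _ h => exact hadj _ _ h
      | refl => exact Iff.rfl
      | symm _ _ _ ih => exact ih.symm
      | trans _ _ _ _ _ ih1 ih2 => exact ih1.trans ih2
    have hpos : 0 < (π.row true).length := by rw [B.length_eq, h1']; omega
    refine hc.not_even (⟨true, 0, hpos⟩, false) ?_
    have : π.cuspsAlong (⟨true, 0, hpos⟩, false) = ∅ := by
      ext e
      simp only [Set.mem_empty_iff_false, iff_false]
      rintro ⟨-, h⟩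
      exact absurd ((hgen _ _ h).1 ⟨rfl, rfl⟩).2 (by simp)
    rw [this, Set.ncard_empty]
    exact Even.zero
  · have h2 : ∀ s, 2 ≤ (X s).length := by
      have := B.left_pos true
      intro s; cases s <;> omega
    have hU := B.right_pos
    have h4 : 4 ≤ (π.cuspsAlong (B.cut true, true)).ncard := by
      refine four_le_ncard (fun s => (X s).length - 2) (fun s => ?_)
        (fun s => ⟨?_, hmem _ ((not_congr (B.label_iff _)).2 ?_)⟩)
        fun s => ⟨?_, hmem _ ((not_congr (B.label_iff _)).2 ?_)⟩
      all_goals have := h2 s; have := hU s; have := B.length_eq s; (try simp only); omega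
    rcases hc (B.cut true, true) with h | h <;> omega

end Block

/-- A complete type has an orientation reversing band. -/
theorem IsComplete.exists_mem_rev {π : IntervalExchange d} (hc : π.IsComplete) (hd : 0 < d) :
    ∃ s α, α ∈ π.rev s := by
  by_contra hcon
  push Not at hcon
  have hp : ∀ α, π.top.count α = 1 := fun α => by
    have h1 : ¬ π.top.count α = 2 := mt (mem_rev (s := true)).2 (hcon true α)
    have h2 : ¬ π.bot.count α = 2 := mt (mem_rev (s := false)).2 (hcon false α)
    have : π.top.count α + π.bot.count α = 2 := π.count_row_add true α
    omega
  have hmem : ∀ s, (⟨0, hd⟩ : Fin d) ∈ π.row s := fun s => by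
    rw [← List.count_pos_iff, count_row_eq_one (hp _)]; exact one_pos
  have hne : ∀ s, π.row s ≠ [] := fun s => List.ne_nil_of_mem (hmem s)
  exact hc.not_even (⟨true, 0, List.length_pos_iff.2 (hne true)⟩, true)
    (even_ncard_cuspsAlong (p := fun _ => True) (fun α _ => hp α) (hne true) (hne false)
      fun _ _ => trivial)

/-- Without reversing bands all boundary curves would have evenly many cusps. A reversing band on
one side needs one on the other by the switch condition with positive widths. -/
theorem IsNonclassical.rev_nonempty {π : IntervalExchange d} (h : π.IsNonclassical)
    (hd : 0 < d) (s : Bool) : (π.rev s).Nonempty := by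
  obtain ⟨⟨x, hx, hs⟩, hc⟩ := h
  obtain ⟨t, α, hα⟩ := hc.exists_mem_rev hd
  have hpos : 0 < ∑ α ∈ π.rev t, x α := Finset.sum_pos (fun _ _ => hx _) ⟨α, hα⟩
  rcases Bool.eq_or_eq_not s t with rfl | rfl
  · exact ⟨α, hα⟩
  · rw [(switchCondition_iff_rev π t x).1 hs] at hpos
    by_contra hne
    rw [Finset.not_nonempty_iff_eq_empty] at hne
    rw [hne, Finset.sum_empty] at hpos
    exact lt_irrefl _ hpos

end IntervalExchange

namespace IntervalExchange
variable {d : ℕ}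

/-! ### Every band becomes critical -/

theorem rtakeWhile_append_of_forall {p : Fin d → Bool} {X Y : List (Fin d)}
    (h : ∀ y ∈ Y, p y) : (X ++ Y).rtakeWhile p = X.rtakeWhile p ++ Y := by
  rw [List.rtakeWhile, List.rtakeWhile, List.reverse_append,
    List.takeWhile_append_of_pos (by simpa using h), List.reverse_append, List.reverse_reverse]

theorem rtakeWhile_append_of_exists {p : Fin d → Bool} {X Y : List (Fin d)}
    (h : ∃ y ∈ Y, ¬ p y) : (X ++ Y).rtakeWhile p = Y.rtakeWhile p := by
  induction Y using List.reverseRecOn with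
  | nil => simp at h
  | append_singleton Y a ih =>
    rw [← List.append_assoc]
    by_cases ha : p a
    · rw [List.rtakeWhile_concat_pos _ _ _ ha, List.rtakeWhile_concat_pos _ _ _ ha, ih]
      obtain ⟨y, hy, hpy⟩ := h
      rcases List.mem_append.1 hy with hy | hy
      · exact ⟨y, hy, hpy⟩
      · rw [List.mem_singleton.1 hy] at hpy; exact absurd ha hpy
    · rw [List.rtakeWhile_concat_neg _ _ _ ha, List.rtakeWhile_concat_neg _ _ _ ha]

/-- The number of ends of a band in the maximal right parts of the rows with labels in `p`. -/
def rightCount (π : IntervalExchange d) (p : Fin d → Bool) (α : Fin d) : ℕ :=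
  ((π.row true).rtakeWhile p).count α + ((π.row false).rtakeWhile p).count α

theorem rightCount_eq (π : IntervalExchange d) (p : Fin d → Bool) (α : Fin d) (s : Bool) :
    π.rightCount p α =
      ((π.row s).rtakeWhile p).count α + ((π.row (!s)).rtakeWhile p).count α := by
  cases s
  · exact add_comm _ _
  · rfl

theorem rightCount_le_two (π : IntervalExchange d) (p : Fin d → Bool) (α : Fin d) :
    π.rightCount p α ≤ 2 := by
  rw [← π.count_row_add true α]
  exact add_le_add ((List.rtakeWhile_suffix p _).sublist.count_le α)
    ((List.rtakeWhile_suffix p _).sublist.count_le α)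

theorem IsLast.rightCount_pos {π : IntervalExchange d} {p : Fin d → Bool} {α : Fin d} {s : Bool}
    (h : π.IsLast s α) (hp : p α) : 0 < π.rightCount p α := by
  obtain ⟨L, hL⟩ := h
  rw [rightCount_eq π p α s, hL, List.rtakeWhile_concat_pos _ _ _ hp, List.count_append,
    List.count_singleton_self]
  omega

/-- Only the critical end of the loser moves, and it lands beside the other end of the winner. It is
still counted only if that other end also lies in a right part; then both ends of the winner are
counted. -/
theorem Moves.rightCount {π π' : IntervalExchange d} {w l : Fin d} (h : Moves π w l π')
    {p : Fin d → Bool} (hw : p w) (hl : p l) :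
    (∀ α, π'.rightCount p α ≤ π.rightCount p α) ∧
      (π'.rightCount p l = π.rightCount p l → π.rightCount p w = 2) := by
  obtain ⟨s, hs⟩ := h.rows
  suffices h : (∀ α, π'.rightCount p α ≤ π.rightCount p α) ∧
      (π'.rightCount p l = π.rightCount p l → 2 ≤ π.rightCount p w) from
    ⟨h.1, fun h' => le_antisymm (rightCount_le_two _ _ _) (h.2 h')⟩
  simp only [rightCount_eq _ p _ s]
  rcases hs with ⟨A, B, C, h1, h2, h3, h4⟩ | ⟨A, B, C, h1, h2, h3, h4⟩
  · rw [h1, h2, h3, h4, List.rtakeWhile_concat_pos _ _ _ hw]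
    by_cases hC : ∀ y ∈ C, p y
    · have e1 : (B ++ [w] ++ C ++ [l]).rtakeWhile p = B.rtakeWhile p ++ ([w] ++ C ++ [l]) := by
        rw [← rtakeWhile_append_of_forall, List.append_assoc, List.append_assoc,
          List.append_assoc]
        simpa [hw, hl, or_imp, forall_and] using hC
      have e2 : (B ++ [w, l] ++ C).rtakeWhile p = B.rtakeWhile p ++ ([w, l] ++ C) := by
        rw [← rtakeWhile_append_of_forall, List.append_assoc]
        simpa [hw, hl] using hC
      rw [e1, e2]
      simp only [List.count_append, List.count_cons, List.count_nil]
      refine ⟨fun α => by omega, fun _ => ?_⟩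
      simp only [beq_self_eq_true, if_true]
      omega
    · push Not at hC
      rw [List.rtakeWhile_concat_pos _ _ _ hl, rtakeWhile_append_of_exists (by simpa using hC),
        rtakeWhile_append_of_exists (by simpa using hC)]
      simp only [List.count_append, List.count_singleton_self]
      exact ⟨fun α => by omega, fun h => by omega⟩
  · rw [h1, h2, h3, h4, List.rtakeWhile_concat_pos _ _ _ hl, List.rtakeWhile_concat_pos _ _ _ hw,
      List.rtakeWhile_concat_pos _ _ _ hw]
    by_cases hB : ∀ y ∈ B, p y
    · have e1 : (A ++ [w] ++ B).rtakeWhile p = A.rtakeWhile p ++ ([w] ++ B) := by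
        rw [← rtakeWhile_append_of_forall, List.append_assoc]
        simpa [hw] using hB
      have e2 : (A ++ [l, w] ++ B).rtakeWhile p = A.rtakeWhile p ++ ([l, w] ++ B) := by
        rw [← rtakeWhile_append_of_forall, List.append_assoc]
        simpa [hw, hl] using hB
      rw [e1, e2]
      simp only [List.count_append, List.count_cons, List.count_nil]
      refine ⟨fun α => by omega, fun _ => ?_⟩
      simp only [beq_self_eq_true, if_true]
      omega
    · push Not at hB
      rw [rtakeWhile_append_of_exists (by simpa using hB),
        rtakeWhile_append_of_exists (by simpa using hB)]
      simp only [List.count_append, List.count_singleton_self]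
      exact ⟨fun α => by omega, fun h => by omega⟩

theorem Moves.count_of_ne {π π' : IntervalExchange d} {w l α : Fin d} (h : Moves π w l π')
    (hα : α ≠ l) (t : Bool) : (π'.row t).count α = (π.row t).count α := by
  obtain ⟨s, hs⟩ := h.rows
  have key : (π'.row s).count α = (π.row s).count α := by
    rcases hs with ⟨A, B, C, h1, h2, h3, h4⟩ | ⟨A, B, C, h1, h2, h3, h4⟩
    · rw [h1, h3]
    · rw [h1, h3]
      simp [List.count_cons, hα.symm]
  rcases Bool.eq_or_eq_not t s with rfl | rfl
  · exact key
  · have h1 := π.count_row_add s α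
    have h2 := π'.count_row_add s α
    omega

theorem Moves.mem_rev_iff {π π' : IntervalExchange d} {w l α : Fin d} (h : Moves π w l π')
    (hα : α ≠ l) (t : Bool) : α ∈ π'.rev t ↔ α ∈ π.rev t := by
  rw [mem_rev, mem_rev, h.count_of_ne hα]

/-- What happens when the winner is orientation reversing. -/
theorem Moves.of_mem_rev {π π' : IntervalExchange d} {w l : Fin d} {s : Bool}
    (h : Moves π w l π') (hw : w ∈ π.rev s) :
    (π.row (!s)).length = (π'.row (!s)).length + 1 ∧
      (π.row (!s)).count l = (π'.row (!s)).count l + 1 ∧ π'.IsLast s w := by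
  obtain ⟨t, ⟨A, B, C, h1, h2, h3, h4⟩ | ⟨A, B, C, h1, h2, h3, h4⟩⟩ := h.rows
  · exfalso
    rw [mem_rev] at hw
    have := π.count_row_add s w
    have e1 : 0 < (π.row t).count w := by simp [h1]
    have e2 : 0 < (π.row (!t)).count w := by simp [h2]
    rcases Bool.eq_or_eq_not s t with rfl | rfl
    · omega
    · rw [Bool.not_not] at this
      omega
  · have hst : t = s := by
      have hm : w ∈ π.row t := by simp [h1]
      rcases Bool.eq_or_eq_not t s with h | rfl
      · exact h
      · exact absurd hw (mem_row_not_iff.1 hm)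
    subst hst
    rw [h2, h4]
    exact ⟨by simp, by simp, ⟨_, h3⟩⟩

/-! ### Critical bands in a sink -/

theorem InSink.exists_last {π₀ : IntervalExchange d} (hsink : π₀.InSink)
    {π : IntervalExchange d} (hr : Relation.ReflTransGen Step π₀ π)
    (s : Bool) : ∃ a b, π.IsLast s a ∧ π.IsLast (!s) b ∧ a ≠ b ∧ π.IsRecurrent := by
  obtain ⟨w, l, π', h⟩ := hsink.exists_split hr
  obtain ⟨t, h1, h2, -⟩ := h.1.isLast
  rcases Bool.eq_or_eq_not s t with rfl | rfl
  · exact ⟨w, l, h1, h2, h.ne, h.isRecurrent⟩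
  · exact ⟨l, w, h2, by simpa using h1, h.ne.symm, h.isRecurrent⟩

/-- An orientation reversing critical band wins until it meets a band that is the only orientation
reversing one on the other side. -/
theorem InSink.exists_rev_eq_singleton {π₀ : IntervalExchange d} (hsink : π₀.InSink)
    {s : Bool} {a : Fin d} {π : IntervalExchange d}
    (hr : Relation.ReflTransGen Step π₀ π) (ha : π.IsLast s a) (hrev : a ∈ π.rev s) :
    ∃ π' b, Relation.ReflTransGen Step π₀ π' ∧ π'.IsLast (!s) b ∧ π'.rev (!s) = {b} := by
  induction hn : (π.row (!s)).length using Nat.strong_induction_on generalizing π with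
  | _ n ih =>
    obtain ⟨a', b, ha', hb, hne, hrec⟩ := hsink.exists_last hr s
    obtain rfl := ha'.unique ha
    -- A reversing winner pulls the loser's end over to its own side. The opposite row gets shorter
    -- each time, so the winning must stop.
    by_cases hx : ∃ x : Fin d → ℝ, (∀ α, 0 < x α) ∧ π.SwitchCondition x ∧ x b < x a'
    · obtain ⟨π', hm⟩ := exists_moves ha hb hne
      obtain ⟨h1, -, h3⟩ := hm.of_mem_rev hrev
      exact ih _ (by omega) (hr.tail ⟨_, _, hm, hx⟩) h3 ((hm.mem_rev_iff hne s).2 hrev) rfl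
    · push Not at hx
      have := rev_eq_singleton_of_forall_le hb.mem
        (by rw [Bool.not_not]; exact ha.mem) hne.symm hrec hx
      exact ⟨π, b, hr, hb, this.1⟩

/-- Only a loser changes its type, and losers are critical, so a band that is never critical stays
reversing or not as it was. -/
theorem mem_rev_iff_of_reach {π₀ : IntervalExchange d} {p : Fin d → Prop}
    (hp : ∀ π, Relation.ReflTransGen Step π₀ π → ∀ s α, π.IsLast s α → p α) {z : Fin d}
    (hz : ¬ p z) {π : IntervalExchange d} (hr : Relation.ReflTransGen Step π₀ π) (s : Bool) :
    z ∈ π.rev s ↔ z ∈ π₀.rev s := by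
  induction hr with
  | refl => rfl
  | tail hr h ih =>
    obtain ⟨w, l, h⟩ := h
    obtain ⟨t, -, hl, -⟩ := h.1.isLast
    rw [h.1.mem_rev_iff (by rintro rfl; exact hz (hp _ hr _ _ hl)), ih]

/-- An orientation reversing band that becomes critical does so first as an orientation reversing
band. -/
theorem exists_isLast_mem_rev {a : Fin d} {t s : Bool} {π₀ π π₁ : IntervalExchange d}
    (hr : Relation.ReflTransGen Step π₀ π) (hr₁ : Relation.ReflTransGen Step π π₁)
    (ha : a ∈ π.rev t) (hlast : π₁.IsLast s a) :
    ∃ π₂ u, Relation.ReflTransGen Step π₀ π₂ ∧ π₂.IsLast u a ∧ a ∈ π₂.rev u := by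
  have aux : ∀ {ρ : IntervalExchange d} {u}, a ∈ ρ.rev t → ρ.IsLast u a → a ∈ ρ.rev u := by
    intro ρ u h1 h2
    rcases Bool.eq_or_eq_not u t with rfl | rfl
    · exact h1
    · exact absurd h1 (mem_row_not_iff.1 h2.mem)
  induction hr₁ using Relation.ReflTransGen.head_induction_on with
  | refl => exact ⟨_, _, hr, hlast, aux ha hlast⟩
  | head h h' ih =>
    have hr' := hr.tail h
    obtain ⟨w, l, h⟩ := h
    obtain ⟨u, -, hl, -⟩ := h.1.isLast
    by_cases hal : a = l
    · subst hal
      exact ⟨_, _, hr, hl, aux ha hl⟩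
    · exact ih hr' ((h.1.mem_rev_iff hal t).2 ha)

theorem rightCount_le_of_reach {π₀ : IntervalExchange d} {p : Fin d → Bool}
    (hp : ∀ π, Relation.ReflTransGen Step π₀ π → ∀ s α, π.IsLast s α → p α) {π π' : IntervalExchange d}
    (hr : Relation.ReflTransGen Step π₀ π) (hr' : Relation.ReflTransGen Step π π') (α : Fin d) :
    π'.rightCount p α ≤ π.rightCount p α := by
  induction hr' with
  | refl => rfl
  | tail h1 h ih =>
    obtain ⟨w, l, h⟩ := h
    obtain ⟨t, hw, hl, -⟩ := h.1.isLast
    exact ((h.1.rightCount (hp _ (hr.trans h1) _ _ hw) (hp _ (hr.trans h1) _ _ hl)).1 α).trans ih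

/-- A quantity that never increases along splits is constant on a strongly connected set of types.
-/
theorem InSink.rightCount_eq {π₀ : IntervalExchange d} (hsink : π₀.InSink)
    {p : Fin d → Bool}
    (hp : ∀ π, Relation.ReflTransGen Step π₀ π → ∀ s α, π.IsLast s α → p α) {π : IntervalExchange d}
    (hr : Relation.ReflTransGen Step π₀ π) (α : Fin d) :
    π.rightCount p α = π₀.rightCount p α :=
  le_antisymm (rightCount_le_of_reach hp .refl hr α)
    (rightCount_le_of_reach hp hr (hsink.reach_symm hr) α)

theorem InSink.rightCount_winner {π₀ : IntervalExchange d} (hsink : π₀.InSink)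
    {p : Fin d → Bool}
    (hp : ∀ π, Relation.ReflTransGen Step π₀ π → ∀ s α, π.IsLast s α → p α)
    {π π' : IntervalExchange d} {w l : Fin d}
    (hr : Relation.ReflTransGen Step π₀ π) (h : Split π w l π') : π₀.rightCount p w = 2 := by
  obtain ⟨t, hw, hl, -⟩ := h.1.isLast
  rw [← hsink.rightCount_eq hp hr]
  refine (h.1.rightCount (hp _ hr _ _ hw) (hp _ hr _ _ hl)).2 ?_
  rw [hsink.rightCount_eq hp hr, hsink.rightCount_eq hp (hr.tail ⟨_, _, h⟩)]

/-- A band with a single end in the right parts never wins; it would have to be orientation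
reversing whenever it is critical. -/
theorem InSink.rightCount_ne_one {π₀ : IntervalExchange d} (hsink : π₀.InSink)
    {p : Fin d → Bool}
    (hp : ∀ π, Relation.ReflTransGen Step π₀ π → ∀ s α, π.IsLast s α → p α) {c : Fin d}
    (hc : ∃ π s, Relation.ReflTransGen Step π₀ π ∧ π.IsLast s c) : π₀.rightCount p c ≠ 1 := by
  intro h1
  -- Winners have count 2, so `c` always loses and no admissible widths let it win. Then the winner
  -- is the only reversing band on its side and `c` is reversing; the split carries one end of `c`
  -- across and makes it orientation preserving.
  have key : ∀ π s, Relation.ReflTransGen Step π₀ π → π.IsLast s c → c ∈ π.rev s ∧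
      ∃ π', Step π π' ∧ (π'.row s).count c = 1 := by
    intro π s hr hs
    obtain ⟨w, l, π', h⟩ := hsink.exists_split hr
    obtain ⟨t, hw, hl, -⟩ := h.1.isLast
    have hcw : c ≠ w := by
      rintro rfl
      have := hsink.rightCount_winner hp hr h
      omega
    have hst : s = !t := by
      rcases Bool.eq_or_eq_not s t with rfl | h
      · exact absurd (hs.unique hw) hcw
      · exact h
    subst hst
    obtain rfl := hs.unique hl
    have hle : ∀ x : Fin d → ℝ, (∀ α, 0 < x α) → π.SwitchCondition x → x c ≤ x w := by
      intro x hx hsw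
      by_contra hlt
      obtain ⟨π'', hm⟩ := exists_moves hl (by rw [Bool.not_not]; exact hw) hcw
      have := hsink.rightCount_winner hp hr (l := w) ⟨hm, x, hx, hsw, not_le.1 hlt⟩
      omega
    obtain ⟨e1, e2⟩ := rev_eq_singleton_of_forall_le hw.mem hl.mem hcw.symm h.isRecurrent hle
    refine ⟨e2, π', ⟨_, _, h⟩, ?_⟩
    have := (h.1.of_mem_rev (s := t) (by rw [e1]; exact Finset.mem_singleton_self _)).2.1
    rw [mem_rev] at e2
    omega
  -- Once orientation preserving, `c` cannot be critical again and so never changes back, although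
  -- strong connectivity leads back to a type where it is reversing.
  have stay : ∀ π π', Relation.ReflTransGen Step π₀ π → Relation.ReflTransGen Step π π' →
      ∀ s, (π.row s).count c = 1 → (π'.row s).count c = 1 := by
    intro π π' hr hr' s hs
    induction hr' with
    | refl => exact hs
    | tail h' h ih =>
      obtain ⟨w, l, h⟩ := h
      obtain ⟨t, -, hl, -⟩ := h.1.isLast
      by_cases hcl : c = l
      · subst hcl
        have h2 := (key _ _ (hr.trans h') hl).1
        rename_i b _
        have h3 := b.count_row_add s c
        rw [mem_rev] at h2
        rcases Bool.eq_or_eq_not s (!t) with rfl | rfl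
        · omega
        · rw [Bool.not_not] at ih h3
          omega
      · rw [h.1.count_of_ne hcl, ih]
  obtain ⟨π, s, hr, hs⟩ := hc
  obtain ⟨h2, π', h3, h4⟩ := key π s hr hs
  have := stay π' π (hr.tail h3) ((hsink.reach_symm (hr.tail h3)).trans hr) s h4
  rw [mem_rev] at h2
  omega

/-- For a non-classical type in a sink, every band is critical somewhere in the sink. -/
theorem IsNonclassical.exists_isLast {π₀ : IntervalExchange d} (h : π₀.IsNonclassical)
    (hsink : π₀.InSink) (z : Fin d) :
    ∃ π s, Relation.ReflTransGen Step π₀ π ∧ π.IsLast s z := by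
  classical
  by_contra hz
  let q : Fin d → Prop := fun α => ∃ π s, Relation.ReflTransGen Step π₀ π ∧ π.IsLast s α
  let p : Fin d → Bool := fun α => decide (q α)
  have hpq : ∀ α, p α ↔ q α := fun α => decide_eq_true_iff
  have hq : ∀ π, Relation.ReflTransGen Step π₀ π → ∀ s α, π.IsLast s α → q α :=
    fun π hr s α hs => ⟨π, s, hr, hs⟩
  have hp : ∀ π, Relation.ReflTransGen Step π₀ π → ∀ s α, π.IsLast s α → p α :=
    fun π hr s α hs => (hpq α).2 (hq π hr s α hs)
  change ¬ q z at hz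
  have hM : ∀ α, q α → π₀.rightCount p α = 2 := by
    intro α hα
    obtain ⟨π, s, hr, hs⟩ := hα
    have h1 := hs.rightCount_pos (hp π hr s α hs)
    rw [hsink.rightCount_eq hp hr] at h1
    have h2 := rightCount_le_two π₀ p α
    have h3 := hsink.rightCount_ne_one hp ⟨π, s, hr, hs⟩
    omega
  -- Suppose `a` in `q` and `y` outside `q` are both reversing. Starting from `a`, critical bands of
  -- `q` become, first on one side and then on the other, the only reversing band there. But `y`
  -- never leaves its side.
  have hcases : (∀ α, q α → π₀.top.count α = 1) ∨ ∀ α, ¬ q α → π₀.top.count α = 1 := by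
    by_contra hcon
    push Not at hcon
    obtain ⟨⟨a, ha, ha1⟩, y, hy, hy1⟩ := hcon
    have hrev : ∀ α, π₀.top.count α ≠ 1 → ∃ t, α ∈ π₀.rev t := by
      intro α hα
      have : π₀.top.count α + π₀.bot.count α = 2 := π₀.count_row_add true α
      rcases Nat.lt_or_ge (π₀.top.count α) 1 with h1 | h1
      · exact ⟨false, (mem_rev (s := false)).2 (by change π₀.bot.count α = 2; omega)⟩
      · exact ⟨true, (mem_rev (s := true)).2 (by change π₀.top.count α = 2; omega)⟩
    obtain ⟨t, ht⟩ := hrev a ha1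
    obtain ⟨u, hu⟩ := hrev y hy1
    obtain ⟨π₁, s₁, hr₁, hs₁⟩ := ha
    obtain ⟨π₂, s, hr₂, hs, hrevs⟩ := exists_isLast_mem_rev .refl hr₁ ht hs₁
    obtain ⟨π₃, b, hr₃, hb, hb1⟩ := hsink.exists_rev_eq_singleton hr₂ hs hrevs
    have hyb : ∀ π, Relation.ReflTransGen Step π₀ π → y ∈ π.rev u := fun π hr =>
      (mem_rev_iff_of_reach hq hy hr u).2 hu
    have hus : u = s := by
      rcases Bool.eq_or_eq_not u s with h | rfl
      · exact h
      · have := hyb π₃ hr₃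
        rw [hb1, Finset.mem_singleton] at this
        exact absurd (this ▸ hq _ hr₃ _ _ hb) hy
    obtain ⟨π₄, c, hr₄, hc, hc1⟩ := hsink.exists_rev_eq_singleton hr₃ hb
      (by rw [hb1]; exact Finset.mem_singleton_self _)
    have := hyb π₄ hr₄
    rw [Bool.not_not, ← hus] at hc1
    rw [hc1, Finset.mem_singleton] at this
    exact hy (this ▸ hq _ hr₄ _ _ hc)
  have hd : 0 < d := z.pos
  have hbot : ∀ s, π₀.row s = (π₀.row s).rdropWhile p ++ (π₀.row s).rtakeWhile p := fun s =>
    (List.rdropWhile_append_rtakeWhile).symm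
  have hcount : ∀ s α, (π₀.row s).count α =
      ((π₀.row s).rdropWhile p).count α + ((π₀.row s).rtakeWhile p).count α := fun s α => by
    conv_lhs => rw [hbot s, List.count_append]
  -- A band of `q` has both its ends in the right parts, so none is left over for the left parts.
  have hB : Block π₀ q (fun s => (π₀.row s).rdropWhile p) (fun s => (π₀.row s).rtakeWhile p) := by
    refine ⟨hbot, fun s hs => ?_, fun s hs => ?_, fun s α hα hqα => ?_,
      fun s α hα => (hpq α).1 (List.mem_rtakeWhile_imp hα)⟩
    · rw [List.rdropWhile_eq_nil_iff] at hs
      rcases hcases with h1 | h1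
      · obtain ⟨α, hα⟩ := h.rev_nonempty hd s
        have hm : α ∈ π₀.row s := by
          rw [← Bool.not_not s, mem_row_not_iff]
          exact notMem_rev_not hα
        have := count_row_eq_one (h1 α ((hpq α).1 (hs α hm))) s
        rw [mem_rev] at hα
        omega
      · have hm : z ∈ π₀.row s := by
          rw [← List.count_pos_iff, count_row_eq_one (h1 z hz)]; exact one_pos
        exact hz ((hpq z).1 (hs z hm))
    · obtain ⟨a, -, ⟨L, hL⟩, -⟩ := hsink.exists_last .refl s
      have hpa := hp _ .refl s a ⟨L, hL⟩
      rw [hL, List.rtakeWhile_concat_pos _ _ _ hpa] at hs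
      simp at hs
    · have h1 := hM α hqα
      have h2 := π₀.count_row_add s α
      rw [rightCount_eq π₀ p α s] at h1
      rw [hcount s, hcount (!s)] at h2
      have h3 := List.count_pos_iff.2 hα
      omega
  rcases hcases with h1 | h1
  · refine hB.not_isComplete_of_right h1 (fun α ht hf => ?_) h.2
    obtain ⟨a, b, ha, hb, hne, -⟩ := hsink.exists_last .refl true
    exact hne ((ha.unique ht).trans (hf.unique hb))
  · exact hB.not_isComplete_of_left h1 h.2

end IntervalExchange

namespace IntervalExchange
variable {d : ℕ}

/-! ### Truncated cones and their volumes -/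

section Cone

variable {G : Type*} [NormedAddCommGroup G] [NormedSpace ℝ G]

/-- The part of the cone of points with non-negative coordinates on which a weighted sum of the
coordinates is at most `1`. -/
def coneBody (L : G →ₗ[ℝ] (Fin d → ℝ)) (q : Fin d → ℝ) : Set G :=
  {g | (∀ α, 0 ≤ L g α) ∧ ∑ α, q α * L g α ≤ 1}

theorem coord_le_of_mem_coneBody {L : G →ₗ[ℝ] (Fin d → ℝ)} {q : Fin d → ℝ} (hq : ∀ α, 0 < q α)
    {g : G} (hg : g ∈ coneBody L q) (α : Fin d) : L g α ≤ 1 / q α := by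
  rw [le_div_iff₀ (hq α), mul_comm]
  exact (Finset.single_le_sum (f := fun α => q α * L g α)
    (fun β _ => mul_nonneg (hq β).le (hg.1 β)) (Finset.mem_univ α)).trans hg.2

/-- The coordinates of the sum of a point of the truncated cone and a multiple of a vector. -/
theorem add_mem_smul_coneBody {L : G →ₗ[ℝ] (Fin d → ℝ)} {q : Fin d → ℝ} {g v : G} {t c : ℝ}
    (hg : g ∈ coneBody L q) (hv : ∀ α, 0 ≤ L v α) (ht : 0 ≤ t)
    (hc : t * ∑ α, q α * L v α ≤ c) (hc0 : 0 ≤ c) :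
    (1 + c)⁻¹ • (g + t • v) ∈ coneBody L q := by
  have hc1 : 0 < 1 + c := by linarith
  constructor
  · intro α
    simp only [map_smul, map_add, Pi.smul_apply, Pi.add_apply, smul_eq_mul]
    exact mul_nonneg (inv_pos.2 hc1).le (add_nonneg (hg.1 α) (mul_nonneg ht (hv α)))
  · have : ∑ α, q α * L ((1 + c)⁻¹ • (g + t • v)) α =
        (1 + c)⁻¹ * (∑ α, q α * L g α + t * ∑ α, q α * L v α) := by
      rw [Finset.mul_sum, ← Finset.sum_add_distrib, Finset.mul_sum]
      refine Finset.sum_congr rfl fun α _ => ?_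
      simp only [map_smul, map_add, Pi.smul_apply, Pi.add_apply, smul_eq_mul]
      ring
    rw [this, inv_mul_le_iff₀ hc1]
    linarith [hg.2]

variable [FiniteDimensional ℝ G]

theorem continuous_coord (L : G →ₗ[ℝ] (Fin d → ℝ)) (α : Fin d) : Continuous fun g => L g α :=
  (continuous_apply α).comp L.continuous_of_finiteDimensional

theorem isClosed_coneBody (L : G →ₗ[ℝ] (Fin d → ℝ)) (q : Fin d → ℝ) :
    IsClosed (coneBody L q) := by
  have h1 : IsClosed {g : G | ∀ α, 0 ≤ L g α} := by
    simp only [Set.ofPred_forall]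
    exact isClosed_iInter fun α => isClosed_le continuous_const (continuous_coord L α)
  have h2 : IsClosed {g : G | ∑ α, q α * L g α ≤ 1} :=
    isClosed_le (continuous_finsetSum _ fun α _ => continuous_const.mul (continuous_coord L α))
      continuous_const
  exact h1.inter h2

theorem isBounded_coneBody {L : G →ₗ[ℝ] (Fin d → ℝ)} (hL : Function.Injective L)
    {q : Fin d → ℝ} (hq : ∀ α, 0 < q α) : Bornology.IsBounded (coneBody L q) := by
  obtain ⟨K, -, hK⟩ := L.exists_antilipschitzWith (LinearMap.ker_eq_bot.2 hL)
  refine (hK.isBounded_preimage (isCompact_Icc (a := (0 : Fin d → ℝ))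
    (b := fun α => 1 / q α)).isBounded).subset fun g hg => ?_
  exact ⟨fun α => hg.1 α, fun α => coord_le_of_mem_coneBody hq hg α⟩

variable [MeasurableSpace G] (μ : Measure G) [μ.IsAddHaarMeasure]

theorem measure_coneBody_lt_top {L : G →ₗ[ℝ] (Fin d → ℝ)} (hL : Function.Injective L)
    {q : Fin d → ℝ} (hq : ∀ α, 0 < q α) : μ (coneBody L q) < ∞ :=
  (isBounded_coneBody hL hq).measure_lt_top

variable [BorelSpace G]

theorem measure_preimage_inv_smul {r : ℝ} (hr : 0 < r) (s : Set G) :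
    μ ((fun g => r⁻¹ • g) ⁻¹' s) = ENNReal.ofReal (r ^ Module.finrank ℝ G) * μ s := by
  rw [Set.preimage_smul_inv₀ hr.ne', Measure.addHaar_smul, abs_of_nonneg (by positivity)]

/-- The points of a truncated cone with one small coordinate have small volume. -/
theorem measure_small_coord_le {L : G →ₗ[ℝ] (Fin d → ℝ)} {q : Fin d → ℝ} (hq : ∀ α, 0 < q α)
    {α : Fin d} {v : G} (hv : ∀ β, 0 ≤ L v β) (hvα : L v α = 1) {c : ℝ}
    (hc : ∑ β, q β * L v β ≤ c * q α) {N : ℕ} (hN : 0 < N) :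
    N * μ (coneBody L q ∩ {g | L g α ≤ 1 / (N * q α)}) ≤
      ENNReal.ofReal ((1 + 2 * c) ^ Module.finrank ℝ G) * μ (coneBody L q) := by
  have hN' : (0 : ℝ) < N := Nat.cast_pos.2 hN
  set δ := 1 / (N * q α) with hδ
  have hδ0 : 0 < δ := by have := hq α; positivity
  have hc0 : 0 ≤ c := by
    have : 0 ≤ c * q α := (Finset.sum_nonneg fun β _ => mul_nonneg (hq β).le (hv β)).trans hc
    exact nonneg_of_mul_nonneg_left this (hq α)
  set B := coneBody L q ∩ {g | L g α ≤ δ} with hB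
  have hBm : MeasurableSet B := ((isClosed_coneBody L q).inter
    (isClosed_le (continuous_coord L α) continuous_const)).measurableSet
  let T : ℕ → Set G := fun j => (fun g => g + (-((2 * j * δ) • v))) ⁻¹' B
  have hTm : ∀ j, MeasurableSet (T j) := fun j => hBm.preimage (measurable_add_const _)
  have hTμ : ∀ j, μ (T j) = μ B := fun j => measure_preimage_add_right μ _ _
  have hcoord : ∀ j g, g ∈ T j → 2 * j * δ ≤ L g α ∧ L g α ≤ 2 * j * δ + δ := by
    intro j g hg
    have h1 := hg.1.1 α
    have h2 : L (g + -((2 * j * δ) • v)) α ≤ δ := hg.2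
    simp only [map_add, map_neg, map_smul, Pi.add_apply, Pi.neg_apply, Pi.smul_apply, smul_eq_mul,
      hvα, mul_one] at h1 h2
    constructor <;> linarith
  have hdisj : Set.PairwiseDisjoint (↑(Finset.range N)) T := by
    have key : ∀ i j : ℕ, i < j → Disjoint (T i) (T j) := by
      intro i j hij
      rw [Set.disjoint_left]
      intro g hi hj
      have h1 := (hcoord i g hi).2
      have h2 := (hcoord j g hj).1
      have h3 : (i : ℝ) + 1 ≤ j := by exact_mod_cast hij
      nlinarith
    intro i _ j _ hij
    rcases lt_or_gt_of_ne hij with h | h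
    · exact key i j h
    · exact (key j i h).symm
  calc (N : ℝ≥0∞) * μ B = ∑ j ∈ Finset.range N, μ (T j) := by simp [hTμ]
    _ = μ (⋃ j ∈ Finset.range N, T j) := (measure_biUnion_finset hdisj fun j _ => hTm j).symm
    _ ≤ μ ((fun g => (1 + 2 * c)⁻¹ • g) ⁻¹' coneBody L q) := by
      refine measure_mono (Set.iUnion₂_subset fun j hj g hg => ?_)
      have := add_mem_smul_coneBody (t := 2 * j * δ) (c := 2 * c) hg.1 hv (by positivity) ?_
        (by positivity)
      · simpa using this
      · have hj' : (j : ℝ) ≤ N := by exact_mod_cast (Finset.mem_range.1 hj).le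
        have hqα := hq α
        have e1 : 2 * c = 2 * N * δ * (c * q α) := by rw [hδ]; field_simp
        rw [e1]
        refine mul_le_mul ?_ hc (Finset.sum_nonneg fun β _ => mul_nonneg (hq β).le (hv β))
          (by positivity)
        gcongr
    _ = _ := measure_preimage_inv_smul μ (by positivity) _

/-- The points of a truncated cone with one coordinate larger than another one have volume bounded
from below. -/
theorem measure_coneBody_le_half {L : G →ₗ[ℝ] (Fin d → ℝ)} {q : Fin d → ℝ} (hq : ∀ α, 0 < q α)
    {w l : Fin d} {v : G} (hv : ∀ β, 0 ≤ L v β) (hvwl : L v l + 1 ≤ L v w) {c : ℝ}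
    (hc : ∑ β, q β * L v β ≤ c * q l) :
    μ (coneBody L q) ≤ ENNReal.ofReal ((1 + c) ^ Module.finrank ℝ G) *
      μ (coneBody L q ∩ {g | L g l ≤ L g w}) := by
  have hc0 : 0 ≤ c := by
    have : 0 ≤ c * q l := (Finset.sum_nonneg fun β _ => mul_nonneg (hq β).le (hv β)).trans hc
    exact nonneg_of_mul_nonneg_left this (hq l)
  have hql := hq l
  set H := coneBody L q ∩ {g | L g l ≤ L g w} with hH
  -- On the cone the coordinate `l` is at most `1 / q l`. Translation by `(1 / q l) • v` therefore
  -- raises coordinate `w` above coordinate `l`, while staying in the cone dilated by `1 + c`.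
  rw [← measure_preimage_inv_smul μ (by positivity : 0 < 1 + c), ← measure_preimage_add_right μ
    ((1 / q l) • v) ((fun g => (1 + c)⁻¹ • g) ⁻¹' H)]
  refine measure_mono fun g hg => ⟨?_, ?_⟩
  · refine add_mem_smul_coneBody hg hv (by positivity) ?_ hc0
    rw [one_div, inv_mul_le_iff₀ hql, mul_comm]
    exact hc
  · change L ((1 + c)⁻¹ • (g + (1 / q l) • v)) l ≤ L ((1 + c)⁻¹ • (g + (1 / q l) • v)) w
    simp only [map_smul, map_add, Pi.smul_apply, Pi.add_apply, smul_eq_mul]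
    refine mul_le_mul_of_nonneg_left ?_ (inv_pos.2 (by positivity)).le
    have h1 := coord_le_of_mem_coneBody hq hg l
    have h2 := hg.1 w
    have h3 : 1 / q l * (L v l + 1) ≤ 1 / q l * L v w :=
      mul_le_mul_of_nonneg_left hvwl (by positivity)
    linarith

theorem measure_coord_eq {L : G →ₗ[ℝ] (Fin d → ℝ)} {w l : Fin d}
    (h : ∃ g, L g w ≠ L g l) : μ {g | L g w = L g l} = 0 := by
  obtain ⟨g, hg⟩ := h
  let f : G →ₗ[ℝ] ℝ := ((LinearMap.proj w : (Fin d → ℝ) →ₗ[ℝ] ℝ) - LinearMap.proj l) ∘ₗ L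
  have hf : ∀ g, f g = L g w - L g l := fun g => rfl
  have : {g | L g w = L g l} = (LinearMap.ker f : Set G) := by
    ext g
    simp [hf, sub_eq_zero]
  rw [this]
  refine Measure.addHaar_submodule μ _ fun htop => hg ?_
  have : g ∈ LinearMap.ker f := htop ▸ Submodule.mem_top
  rwa [LinearMap.mem_ker, hf, sub_eq_zero] at this

end Cone

/-! ### Matrices of splitting sequences -/

/-- The norms of the columns. -/
def colNorm (Q : Matrix (Fin d) (Fin d) ℝ) (α : Fin d) : ℝ := norm₁ (Q.col α)

theorem colNorm_eq {Q : Matrix (Fin d) (Fin d) ℝ} (hQ : ∀ i j, 0 ≤ Q i j) (α : Fin d) :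
    colNorm Q α = ∑ i, Q i α := by
  simp only [colNorm, norm₁, Matrix.col_apply]
  exact Finset.sum_congr rfl fun i _ => abs_of_nonneg (hQ i α)

/-- The weights $|Q(\alpha)|$ measure the total initial width $|Qy|$ when the widths `y` are
non-negative. This is why the truncated cones use `colNorm Q`. -/
theorem sum_colNorm_mul {Q : Matrix (Fin d) (Fin d) ℝ} (hQ : ∀ i j, 0 ≤ Q i j) (y : Fin d → ℝ) :
    ∑ α, colNorm Q α * y α = ∑ i, Q.mulVec y i := by
  simp_rw [colNorm_eq hQ, Matrix.mulVec, dotProduct, Finset.sum_mul]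
  exact Finset.sum_comm

theorem mul_splitMatrix_apply (Q : Matrix (Fin d) (Fin d) ℝ) (w l i α : Fin d) :
    (Q * splitMatrix w l) i α = Q i α + if α = l then Q i w else 0 := by
  rw [splitMatrix, mul_add, mul_one, Matrix.add_apply]
  congr 1
  split_ifs with h
  · subst h; simp
  · rw [Matrix.mul_single_apply_of_ne]
    exact h

theorem SplitPath.nonneg {n : ℕ} {π π' : IntervalExchange d} {Q : Matrix (Fin d) (Fin d) ℝ}
    (h : SplitPath n π π' Q) : ∀ i j, 0 ≤ Q i j := by
  induction h with
  | nil => intro i j; rw [Matrix.one_apply]; split_ifs <;> norm_num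
  | snoc _ _ ih =>
    intro i j
    rw [mul_splitMatrix_apply]
    have := ih i j
    split_ifs
    · exact add_nonneg this (ih _ _)
    · simpa

theorem SplitPath.one_le_diag {n : ℕ} {π π' : IntervalExchange d}
    {Q : Matrix (Fin d) (Fin d) ℝ} (h : SplitPath n π π' Q) : ∀ i, 1 ≤ Q i i := by
  induction h with
  | nil => intro i; rw [Matrix.one_apply_eq]
  | snoc hp _ ih =>
    intro i
    rw [mul_splitMatrix_apply]
    have := ih i
    split_ifs
    · exact le_add_of_le_of_nonneg this (hp.nonneg _ _)
    · simpa

theorem SplitPath.isUnit_det {n : ℕ} {π π' : IntervalExchange d}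
    {Q : Matrix (Fin d) (Fin d) ℝ} (h : SplitPath n π π' Q) : IsUnit Q.det := by
  induction h with
  | nil => simp
  | snoc _ h ih =>
    rw [Matrix.det_mul]
    refine ih.mul ?_
    have : (splitMatrix _ _ : Matrix (Fin d) (Fin d) ℝ).det = 1 :=
      Matrix.det_transvection_of_ne _ _ h.ne 1
    rw [this]
    exact isUnit_one

theorem SplitPath.switchCondition_iff {n : ℕ} {π π' : IntervalExchange d}
    {Q : Matrix (Fin d) (Fin d) ℝ} (h : SplitPath n π π' Q) (y : Fin d → ℝ) :
    π.SwitchCondition (Q.mulVec y) ↔ π'.SwitchCondition y := by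
  induction h generalizing y with
  | nil => rw [Matrix.one_mulVec]
  | snoc _ h ih => rw [← Matrix.mulVec_mulVec, ih, h.1.switchCondition_iff]

theorem SplitPath.one_le_colNorm {n : ℕ} {π π' : IntervalExchange d}
    {Q : Matrix (Fin d) (Fin d) ℝ} (h : SplitPath n π π' Q) (α : Fin d) : 1 ≤ colNorm Q α := by
  rw [colNorm_eq h.nonneg]
  exact (h.one_le_diag α).trans
    (Finset.single_le_sum (f := fun i => Q i α) (fun i _ => h.nonneg i α) (Finset.mem_univ α))

theorem colNorm_mul_splitMatrix {Q : Matrix (Fin d) (Fin d) ℝ} (hQ : ∀ i j, 0 ≤ Q i j)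
    (w l α : Fin d) :
    colNorm (Q * splitMatrix w l) α = colNorm Q α + if α = l then colNorm Q w else 0 := by
  rw [colNorm_eq hQ, colNorm_eq, colNorm_eq hQ]
  · simp_rw [mul_splitMatrix_apply, Finset.sum_add_distrib]
    congr 1
    split_ifs <;> simp
  · intro i j
    rw [mul_splitMatrix_apply]
    have := hQ i j
    have := hQ i w
    split_ifs <;> linarith

theorem SplitPath.mulVec_nonneg {n : ℕ} {π π' : IntervalExchange d}
    {Q : Matrix (Fin d) (Fin d) ℝ} (h : SplitPath n π π' Q) {y : Fin d → ℝ} (hy : ∀ α, 0 ≤ y α)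
    (i : Fin d) : 0 ≤ Q.mulVec y i := by
  rw [Matrix.mulVec, dotProduct]
  exact Finset.sum_nonneg fun j _ => mul_nonneg (h.nonneg i j) (hy j)

theorem SplitPath.mulVec_pos {n : ℕ} {π π' : IntervalExchange d}
    {Q : Matrix (Fin d) (Fin d) ℝ} (h : SplitPath n π π' Q) {y : Fin d → ℝ} (hy : ∀ α, 0 < y α)
    (i : Fin d) : 0 < Q.mulVec y i := by
  rw [Matrix.mulVec, dotProduct]
  exact Finset.sum_pos' (fun j _ => mul_nonneg (h.nonneg i j) (hy j).le)
    ⟨i, Finset.mem_univ i, mul_pos (one_pos.trans_le (h.one_le_diag i)) (hy i)⟩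

theorem norm₁_of_nonneg {y : Fin d → ℝ} (hy : ∀ i, 0 ≤ y i) : norm₁ y = ∑ i, y i :=
  Finset.sum_congr rfl fun i _ => abs_of_nonneg (hy i)

theorem inv_mulVec_mulVec {Q : Matrix (Fin d) (Fin d) ℝ} (h : IsUnit Q.det) (y : Fin d → ℝ) :
    Q⁻¹.mulVec (Q.mulVec y) = y := by
  rw [Matrix.mulVec_mulVec, Matrix.nonsing_inv_mul _ h, Matrix.one_mulVec]

theorem mulVec_inv_mulVec {Q : Matrix (Fin d) (Fin d) ℝ} (h : IsUnit Q.det) (y : Fin d → ℝ) :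
    Q.mulVec (Q⁻¹.mulVec y) = y := by
  rw [Matrix.mulVec_mulVec, Matrix.mul_nonsing_inv _ h, Matrix.one_mulVec]

theorem SwitchCondition.smul {π : IntervalExchange d} {y : Fin d → ℝ} (h : π.SwitchCondition y)
    (c : ℝ) : π.SwitchCondition (c • y) := by
  simp only [SwitchCondition, Pi.smul_apply, ← Finset.smul_sum] at h ⊢
  rw [h]

theorem IsRecurrent.exists_sum_eq_one {π : IntervalExchange d} (h : π.IsRecurrent) (hd : 0 < d) :
    ∃ x : Fin d → ℝ, (∀ α, 0 < x α) ∧ π.SwitchCondition x ∧ ∑ α, x α = 1 := by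
  obtain ⟨x, hx, hs⟩ := h
  have hpos : 0 < ∑ α, x α := Finset.sum_pos (fun _ _ => hx _) ⟨⟨0, hd⟩, Finset.mem_univ _⟩
  refine ⟨(∑ α, x α)⁻¹ • x, fun α => mul_pos (inv_pos.2 hpos) (hx α), hs.smul _, ?_⟩
  simp only [Pi.smul_apply, smul_eq_mul, ← Finset.mul_sum]
  exact inv_mul_cancel₀ hpos.ne'

/-- The image of the configuration space, described by inequalities. -/
theorem mem_stageSet_iff {n : ℕ} {π π' : IntervalExchange d}
    {Q : Matrix (Fin d) (Fin d) ℝ} (h : SplitPath n π π' Q) (x : EuclideanSpace ℝ (Fin d)) :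
    x ∈ π'.stageSet Q ↔ π.SwitchCondition x.ofLp ∧ ∑ i, x i = 1 ∧
      ∀ α, 0 ≤ Q⁻¹.mulVec x.ofLp α := by
  have hdet := h.isUnit_det
  constructor
  · rintro ⟨y, ⟨hy0, hy1, hys⟩, rfl⟩
    have hnn := h.mulVec_nonneg hy0
    have hpos : 0 < norm₁ (Q.mulVec y.ofLp) := by
      rw [norm₁_of_nonneg hnn, ← sum_colNorm_mul h.nonneg]
      refine one_pos.trans_le (hy1.symm.le.trans (Finset.sum_le_sum fun α _ => ?_))
      exact le_mul_of_one_le_left (hy0 α) (h.one_le_colNorm α)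
    refine ⟨((h.switchCondition_iff _).2 hys).smul _, ?_, fun α => ?_⟩
    · simp only [proj, Pi.smul_apply, smul_eq_mul, ← Finset.mul_sum]
      rw [← norm₁_of_nonneg hnn]
      exact inv_mul_cancel₀ hpos.ne'
    · simp only [proj, Matrix.mulVec_smul, inv_mulVec_mulVec hdet, Pi.smul_apply, smul_eq_mul]
      exact mul_nonneg (inv_pos.2 hpos).le (hy0 α)
  · rintro ⟨hs, h1, h0⟩
    set y := Q⁻¹.mulVec x.ofLp with hy
    have hQy : Q.mulVec y = x.ofLp := mulVec_inv_mulVec hdet _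
    have hpos : 0 < ∑ α, y α := by
      refine lt_of_le_of_ne (Finset.sum_nonneg fun α _ => h0 α) fun he => ?_
      have hz : y = 0 := by
        funext α
        exact (Finset.sum_eq_zero_iff_of_nonneg fun α _ => h0 α).1 he.symm α (Finset.mem_univ α)
      rw [hz, Matrix.mulVec_zero] at hQy
      rw [← hQy] at h1
      simp at h1
    have hx1 : norm₁ x.ofLp = 1 := by
      rw [← hQy, norm₁_of_nonneg (h.mulVec_nonneg h0), hQy, h1]
    refine ⟨WithLp.toLp 2 ((∑ α, y α)⁻¹ • y), ⟨fun α => ?_, ?_, ?_⟩, ?_⟩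
    · exact mul_nonneg (inv_pos.2 hpos).le (h0 α)
    · simp only [Pi.smul_apply, smul_eq_mul, ← Finset.mul_sum]
      exact inv_mul_cancel₀ hpos.ne'
    · refine SwitchCondition.smul ?_ _
      rw [← h.switchCondition_iff, hQy]; exact hs
    · ext i
      have hn : norm₁ (Q.mulVec ((∑ α, y α)⁻¹ • y)) = (∑ α, y α)⁻¹ := by
        rw [Matrix.mulVec_smul, hQy]
        simp only [norm₁, Pi.smul_apply, smul_eq_mul, abs_mul, ← Finset.mul_sum]
        rw [abs_of_pos (inv_pos.2 hpos)]
        change _ * norm₁ x.ofLp = _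
        rw [hx1, mul_one]
      simp only [proj, hn, inv_inv]
      rw [Matrix.mulVec_smul, hQy, smul_smul, mul_inv_cancel₀ hpos.ne', one_smul]

end IntervalExchange

namespace IntervalExchange
variable {d : ℕ}

/-! ### Volumes of stages as volumes of truncated cones -/

/-- The total width, and the defect in the switch condition. -/
noncomputable def widthForms (π : IntervalExchange d) :
    EuclideanSpace ℝ (Fin d) →ₗ[ℝ] ℝ × ℝ where
  toFun x := (∑ α, x α, ∑ α ∈ π.revTop, x α - ∑ α ∈ π.revBot, x α)
  map_add' x y := by
    ext <;> simp only [PiLp.add_apply, Finset.sum_add_distrib, Prod.fst_add, Prod.snd_add]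
    ring
  map_smul' c x := by
    ext <;> simp only [PiLp.smul_apply, ← Finset.mul_sum, smul_eq_mul, Prod.smul_fst,
      Prod.smul_snd, RingHom.id_apply, mul_sub]

/-- The directions along the configuration space. -/
noncomputable abbrev directions (π : IntervalExchange d) : Submodule ℝ (EuclideanSpace ℝ (Fin d)) :=
  LinearMap.ker π.widthForms

/-- Reversing bands on both sides make the total width and the switch defect independent, so the
configuration space has codimension two. -/
theorem finrank_directions {π : IntervalExchange d} (h : ∀ s, (π.rev s).Nonempty) :
    ((Module.finrank ℝ π.directions : ℕ) : ℝ) = (d : ℝ) - 2 := by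
  obtain ⟨a, ha⟩ := h true
  obtain ⟨b, hb⟩ := h false
  have ha' : a ∉ π.revBot := notMem_rev_not (s := true) ha
  have hb' : b ∉ π.revTop := notMem_rev_not (s := false) hb
  change a ∈ π.revTop at ha
  change b ∈ π.revBot at hb
  have hsurj : LinearMap.range π.widthForms = ⊤ := by
    rw [LinearMap.range_eq_top]
    rintro ⟨x, y⟩
    refine ⟨WithLp.toLp 2 (Pi.single a ((x + y) / 2) + Pi.single b ((x - y) / 2)), ?_⟩
    simp only [widthForms, LinearMap.coe_mk, AddHom.coe_mk, Pi.add_apply, Finset.sum_add_distrib,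
      Finset.sum_pi_single', ha, ha', hb, hb', Finset.mem_univ, if_true, if_false]
    ext <;> simp only <;> ring
  have := LinearMap.finrank_range_add_finrank_ker π.widthForms
  rw [hsurj, finrank_top, Module.finrank_prod, Module.finrank_self, finrank_euclideanSpace,
    Fintype.card_fin] at this
  have h2 := congrArg (Nat.cast : ℕ → ℝ) this
  push_cast at h2
  linarith

/-- A coordinate system on the space of widths that satisfy the switch condition: the total width,
and the displacement of the normalised widths from a base point, times the total width. -/
noncomputable def modelMap (π : IntervalExchange d) (p : EuclideanSpace ℝ (Fin d)) :
    ℝ × π.directions →ₗ[ℝ] EuclideanSpace ℝ (Fin d) :=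
  (LinearMap.toSpanSingleton ℝ _ p).coprod π.directions.subtype

theorem modelMap_apply (π : IntervalExchange d) (p : EuclideanSpace ℝ (Fin d))
    (g : ℝ × π.directions) : π.modelMap p g = g.1 • p + (g.2 : EuclideanSpace ℝ (Fin d)) := rfl

/-- The widths at a stage with matrix `Q`, in terms of the coordinates on the initial widths. -/
noncomputable def stageCoord (π : IntervalExchange d) (p : EuclideanSpace ℝ (Fin d))
    (Q : Matrix (Fin d) (Fin d) ℝ) : ℝ × π.directions →ₗ[ℝ] (Fin d → ℝ) :=
  Q⁻¹.mulVecLin ∘ₗ (WithLp.linearEquiv 2 ℝ (Fin d → ℝ)).toLinearMap ∘ₗ π.modelMap p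

theorem stageCoord_apply (π : IntervalExchange d) (p : EuclideanSpace ℝ (Fin d))
    (Q : Matrix (Fin d) (Fin d) ℝ) (g : ℝ × π.directions) :
    π.stageCoord p Q g = Q⁻¹.mulVec (π.modelMap p g).ofLp := rfl

/-- Lebesgue measure in these coordinates. -/
noncomputable def modelMeasure (π : IntervalExchange d) : Measure (ℝ × π.directions) :=
  (volume : Measure ℝ).prod (Measure.hausdorffMeasure (Module.finrank ℝ π.directions))

instance (π : IntervalExchange d) : π.modelMeasure.IsAddHaarMeasure := by
  unfold modelMeasure
  infer_instance

/-- The truncated cone of a stage. -/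
noncomputable def stageCone (π : IntervalExchange d) (p : EuclideanSpace ℝ (Fin d))
    (Q : Matrix (Fin d) (Fin d) ℝ) : Set (ℝ × π.directions) :=
  coneBody (π.stageCoord p Q) (colNorm Q)

/-- `p` is a base point for `π`. -/
structure BasePoint (π : IntervalExchange d) (p : EuclideanSpace ℝ (Fin d)) : Prop where
  sum_eq : ∑ i, p i = 1
  switch : π.SwitchCondition p.ofLp

theorem switchCondition_iff_widthForms (π : IntervalExchange d) (x : EuclideanSpace ℝ (Fin d)) :
    π.SwitchCondition x.ofLp ↔ (π.widthForms x).2 = 0 := by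
  rw [widthForms, LinearMap.coe_mk, AddHom.coe_mk, sub_eq_zero]
  rfl

theorem BasePoint.widthForms_modelMap {π₀ : IntervalExchange d} {p : EuclideanSpace ℝ (Fin d)}
    (hp : BasePoint π₀ p) (g : ℝ × π₀.directions) :
    π₀.widthForms (π₀.modelMap p g) = (g.1, 0) := by
  have h1 : π₀.widthForms p = (1, 0) := by
    refine Prod.ext hp.sum_eq ?_
    exact (switchCondition_iff_widthForms _ _).1 hp.switch
  rw [modelMap_apply, map_add, map_smul, h1, LinearMap.mem_ker.1 g.2.2]
  simp

theorem BasePoint.switch_modelMap {π₀ : IntervalExchange d} {p : EuclideanSpace ℝ (Fin d)}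
    (hp : BasePoint π₀ p) (g : ℝ × π₀.directions) :
    π₀.SwitchCondition (π₀.modelMap p g).ofLp := by
  rw [switchCondition_iff_widthForms, hp.widthForms_modelMap]

theorem BasePoint.sum_modelMap {π₀ : IntervalExchange d} {p : EuclideanSpace ℝ (Fin d)}
    (hp : BasePoint π₀ p) (g : ℝ × π₀.directions) : ∑ i, π₀.modelMap p g i = g.1 :=
  congrArg Prod.fst (hp.widthForms_modelMap g)

theorem BasePoint.modelMap_injective {π₀ : IntervalExchange d} {p : EuclideanSpace ℝ (Fin d)}
    (hp : BasePoint π₀ p) : Function.Injective (π₀.modelMap p) := by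
  rw [injective_iff_map_eq_zero]
  intro g hg
  have h1 : g.1 = 0 := by rw [← hp.sum_modelMap, hg]; simp
  rw [modelMap_apply, h1, zero_smul, zero_add] at hg
  exact Prod.ext h1 (Subtype.ext hg)

theorem BasePoint.exists_modelMap_eq {π₀ : IntervalExchange d} {p : EuclideanSpace ℝ (Fin d)}
    (hp : BasePoint π₀ p) {x : EuclideanSpace ℝ (Fin d)}
    (hx : π₀.SwitchCondition x.ofLp) : ∃ g, π₀.modelMap p g = x := by
  set t := ∑ i, x i with ht
  refine ⟨(t, ⟨x - t • p, ?_⟩), by rw [modelMap_apply]; simp⟩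
  rw [LinearMap.mem_ker, map_sub, map_smul]
  ext
  · change t - t * ∑ i, p i = 0
    rw [hp.sum_eq]; ring
  · rw [Prod.snd_sub, Prod.smul_snd, (switchCondition_iff_widthForms _ _).1 hx,
      (switchCondition_iff_widthForms _ _).1 hp.switch]
    simp

theorem BasePoint.stageCoord_injective {π₀ : IntervalExchange d} {p : EuclideanSpace ℝ (Fin d)}
    (hp : BasePoint π₀ p) {n : ℕ} {π : IntervalExchange d}
    {Q : Matrix (Fin d) (Fin d) ℝ} (h : SplitPath n π₀ π Q) : Function.Injective (π₀.stageCoord p Q) := by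
  intro g g' hg
  rw [stageCoord_apply, stageCoord_apply] at hg
  have := congrArg Q.mulVec hg
  rw [mulVec_inv_mulVec h.isUnit_det, mulVec_inv_mulVec h.isUnit_det] at this
  exact hp.modelMap_injective (WithLp.ofLp_injective 2 this)

theorem BasePoint.switch_stageCoord {π₀ : IntervalExchange d} {p : EuclideanSpace ℝ (Fin d)}
    (hp : BasePoint π₀ p) {n : ℕ} {π : IntervalExchange d}
    {Q : Matrix (Fin d) (Fin d) ℝ} (h : SplitPath n π₀ π Q) (g : ℝ × π₀.directions) :
    π.SwitchCondition (π₀.stageCoord p Q g) := by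
  rw [← h.switchCondition_iff, stageCoord_apply, mulVec_inv_mulVec h.isUnit_det]
  exact hp.switch_modelMap g

theorem BasePoint.exists_stageCoord_eq {π₀ : IntervalExchange d} {p : EuclideanSpace ℝ (Fin d)}
    (hp : BasePoint π₀ p) {n : ℕ} {π : IntervalExchange d}
    {Q : Matrix (Fin d) (Fin d) ℝ} (h : SplitPath n π₀ π Q) {y : Fin d → ℝ} (hy : π.SwitchCondition y) :
    ∃ g, π₀.stageCoord p Q g = y := by
  obtain ⟨g, hg⟩ := hp.exists_modelMap_eq (x := WithLp.toLp 2 (Q.mulVec y))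
    ((h.switchCondition_iff y).2 hy)
  exact ⟨g, by rw [stageCoord_apply, hg]; exact inv_mulVec_mulVec h.isUnit_det y⟩

/-- The truncation bounds the initial total width, which is the first model coordinate. It is thus
the same for all stages, and only the sign conditions vary. -/
theorem BasePoint.mem_stageCone_iff {π₀ : IntervalExchange d} {p : EuclideanSpace ℝ (Fin d)}
    (hp : BasePoint π₀ p) {n : ℕ} {π : IntervalExchange d}
    {Q : Matrix (Fin d) (Fin d) ℝ} (h : SplitPath n π₀ π Q) (g : ℝ × π₀.directions) :
    g ∈ π₀.stageCone p Q ↔ (∀ α, 0 ≤ π₀.stageCoord p Q g α) ∧ g.1 ≤ 1 := by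
  refine and_congr_right fun _ => ?_
  rw [sum_colNorm_mul h.nonneg, stageCoord_apply, mulVec_inv_mulVec h.isUnit_det, hp.sum_modelMap]

theorem BasePoint.fst_nonneg {π₀ : IntervalExchange d} {p : EuclideanSpace ℝ (Fin d)}
    (hp : BasePoint π₀ p) {n : ℕ} {π : IntervalExchange d}
    {Q : Matrix (Fin d) (Fin d) ℝ} (h : SplitPath n π₀ π Q) {g : ℝ × π₀.directions}
    (hg : ∀ α, 0 ≤ π₀.stageCoord p Q g α) : 0 ≤ g.1 := by
  rw [← hp.sum_modelMap, ← mulVec_inv_mulVec h.isUnit_det (π₀.modelMap p g).ofLp]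
  exact Finset.sum_nonneg fun i _ => h.mulVec_nonneg hg i

open scoped Pointwise in
/-- The volume of the truncated cone of a stage is proportional to the volume of the stage. -/
theorem BasePoint.measure_stageCone {π₀ : IntervalExchange d} {p : EuclideanSpace ℝ (Fin d)}
    (hp : BasePoint π₀ p) {n : ℕ} {π : IntervalExchange d}
    {Q : Matrix (Fin d) (Fin d) ℝ} (h : SplitPath n π₀ π Q) :
    π₀.modelMeasure (π₀.stageCone p Q) =
      (∫⁻ t in Set.Ioc (0 : ℝ) 1, ENNReal.ofReal |t ^ Module.finrank ℝ π₀.directions|) *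
        Measure.hausdorffMeasure (Module.finrank ℝ π₀.directions) (π.stageSet Q) := by
  set k := Module.finrank ℝ π₀.directions with hk
  set S : Set π₀.directions := {v | ∀ α, 0 ≤ π₀.stageCoord p Q (1, v) α} with hS
  have hSμ : Measure.hausdorffMeasure (k : ℝ) S =
      Measure.hausdorffMeasure (k : ℝ) (π.stageSet Q) := by
    have hiso : Isometry fun v : π₀.directions => p + (v : EuclideanSpace ℝ (Fin d)) :=
      (IsometryEquiv.addLeft p).isometry.comp isometry_subtype_coe
    have himg : (fun v : π₀.directions => p + (v : EuclideanSpace ℝ (Fin d))) '' S =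
        π.stageSet Q := by
      ext x
      rw [mem_stageSet_iff h]
      have key : ∀ v : π₀.directions, π₀.modelMap p (1, v) = p + v := fun v => by
        rw [modelMap_apply, one_smul]
      constructor
      · rintro ⟨v, hv, rfl⟩
        simp only [← key]
        exact ⟨hp.switch_modelMap _, hp.sum_modelMap _, hv⟩
      · rintro ⟨h1, h2, h3⟩
        obtain ⟨⟨t, v⟩, hg⟩ := hp.exists_modelMap_eq h1
        have ht : t = 1 := by rw [← h2, ← hg, hp.sum_modelMap]
        subst ht
        refine ⟨v, fun α => ?_, by rw [← hg, key]⟩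
        rw [stageCoord_apply, hg]
        exact h3 α
    rw [← himg, hiso.hausdorffMeasure_image (.inl (Nat.cast_nonneg k))]
  have hmeas : MeasurableSet (π₀.stageCone p Q) := (isClosed_coneBody _ _).measurableSet
  rw [modelMeasure, Measure.prod_apply hmeas, ← hSμ, ← lintegral_mul_const _ (by fun_prop),
    ← lintegral_indicator measurableSet_Ioc]
  refine lintegral_congr_ae ?_
  -- The slice at height $t\in(0,1]$ is $tS$, of volume $t^k$ times that of `S`, and `S` is
  -- isometric to the stage. The height $t=0$ is a null set, discarded so that one can divide by
  -- $t$.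
  have h0 : ∀ᵐ t : ℝ, t ≠ 0 := by
    rw [ae_iff]
    simp
  filter_upwards [h0] with t ht
  by_cases htI : t ∈ Set.Ioc (0 : ℝ) 1
  · rw [Set.indicator_of_mem htI]
    have : Prod.mk t ⁻¹' π₀.stageCone p Q = t • S := by
      ext v
      rw [Set.mem_preimage, hp.mem_stageCone_iff h, Set.mem_smul_set_iff_inv_smul_mem₀ ht,
        and_iff_left htI.2]
      have : ((t, v) : ℝ × π₀.directions) = t • (1, t⁻¹ • v) := by
        simp [smul_smul, mul_inv_cancel₀ ht]
      rw [this, map_smul]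
      refine forall_congr' fun α => ?_
      exact mul_nonneg_iff_of_pos_left htI.1
    rw [this, Measure.addHaar_smul]
  · rw [Set.indicator_of_notMem htI]
    have : Prod.mk t ⁻¹' π₀.stageCone p Q = ∅ := by
      ext v
      rw [Set.mem_preimage, hp.mem_stageCone_iff h]
      simp only [Set.mem_empty_iff_false, iff_false]
      rintro ⟨h1, h2⟩
      exact htI ⟨lt_of_le_of_ne (hp.fst_nonneg h h1) (Ne.symm ht), h2⟩
    rw [this, measure_empty]

theorem lintegral_pow_ne_zero (k : ℕ) :
    ∫⁻ t in Set.Ioc (0 : ℝ) 1, ENNReal.ofReal |t ^ k| ≠ 0 := by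
  intro h
  rw [lintegral_eq_zero_iff (by fun_prop), Filter.EventuallyEq,
    ae_restrict_iff' measurableSet_Ioc] at h
  have h2 : volume (Set.Ioc (0 : ℝ) 1) = 0 := by
    refine measure_mono_null (fun t ht => ?_) (ae_iff.1 h)
    simp only [Pi.zero_apply, ENNReal.ofReal_eq_zero, Set.mem_ofPred_eq]
    intro h3
    have := abs_pos.2 (pow_pos ht.1 k).ne'
    exact absurd (h3 ht) (not_le.2 this)
  simp at h2

theorem lintegral_pow_ne_top (k : ℕ) :
    ∫⁻ t in Set.Ioc (0 : ℝ) 1, ENNReal.ofReal |t ^ k| ≠ ∞ := by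
  refine ne_top_of_le_ne_top (b := volume (Set.Ioc (0 : ℝ) 1)) (by simp) ?_
  rw [← setLIntegral_one]
  refine setLIntegral_mono' measurableSet_Ioc fun t ht => ?_
  rw [ENNReal.ofReal_le_one, abs_of_pos (pow_pos ht.1 k)]
  exact pow_le_one₀ ht.1.le ht.2

theorem stageCoord_mul (π₀ : IntervalExchange d) (p : EuclideanSpace ℝ (Fin d))
    {Q R : Matrix (Fin d) (Fin d) ℝ} (hR : IsUnit R.det) (g : ℝ × π₀.directions) :
    π₀.stageCoord p Q g = R.mulVec (π₀.stageCoord p (Q * R) g) := by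
  rw [stageCoord_apply, stageCoord_apply, Matrix.mul_inv_rev, ← Matrix.mulVec_mulVec,
    mulVec_inv_mulVec hR]

theorem Split.isUnit_det {π π' : IntervalExchange d} {w l : Fin d} (h : Split π w l π') :
    IsUnit (splitMatrix w l : Matrix (Fin d) (Fin d) ℝ).det :=
  h.splitPath.isUnit_det

/-- The truncated cone after a split. -/
theorem BasePoint.stageCone_split {π₀ : IntervalExchange d} {p : EuclideanSpace ℝ (Fin d)}
    (hp : BasePoint π₀ p) {n : ℕ} {π π' : IntervalExchange d} {Q : Matrix (Fin d) (Fin d) ℝ}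
    (h : SplitPath n π₀ π Q) {w l : Fin d} (hs : Split π w l π') :
    π₀.stageCone p (Q * splitMatrix w l) =
      π₀.stageCone p Q ∩ {g | π₀.stageCoord p Q g l ≤ π₀.stageCoord p Q g w} := by
  ext g
  rw [Set.mem_inter_iff, hp.mem_stageCone_iff h, hp.mem_stageCone_iff (h.snoc hs),
    and_right_comm]
  refine and_congr_left fun _ => ?_
  rw [Set.mem_ofPred_eq, stageCoord_mul π₀ p (Q := Q) hs.isUnit_det]
  set y := π₀.stageCoord p (Q * splitMatrix w l) g
  rw [splitMatrix_mulVec_self, splitMatrix_mulVec_of_ne hs.ne.symm]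
  constructor
  · refine fun hy => ⟨fun α => ?_, by linarith [hy w]⟩
    by_cases hα : α = w
    · subst hα
      rw [splitMatrix_mulVec_self]
      exact add_nonneg (hy _) (hy _)
    · rw [splitMatrix_mulVec_of_ne hα]
      exact hy α
  · rintro ⟨h1, h2⟩ α
    by_cases hα : α = w
    · subst hα; linarith
    · have := h1 α
      rwa [splitMatrix_mulVec_of_ne hα] at this

/-- A point of the relative interior can be moved away from any other point of the set. -/
theorem exists_add_smul_mem_of_mem_intrinsicInterior {E : Type*} [NormedAddCommGroup E]
    [NormedSpace ℝ E] {s : Set E} {x y : E} (hx : x ∈ intrinsicInterior ℝ s) (hy : y ∈ s) :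
    ∃ ε : ℝ, 0 < ε ∧ x + ε • (x - y) ∈ s := by
  rw [mem_intrinsicInterior] at hx
  obtain ⟨x', hx', rfl⟩ := hx
  let y' : affineSpan ℝ s := ⟨y, subset_affineSpan ℝ s hy⟩
  let f : ℝ → affineSpan ℝ s := fun t =>
    ⟨AffineMap.lineMap (x' : E) y t, AffineMap.lineMap_mem _ x'.2 y'.2⟩
  have hf : Continuous f := Continuous.subtype_mk AffineMap.lineMap_continuous _
  have hf0 : f 0 = x' := Subtype.ext (AffineMap.lineMap_apply_zero _ _)
  have hnear : ∀ᶠ t in nhds (0 : ℝ), f t ∈ interior ((↑) ⁻¹' s : Set (affineSpan ℝ s)) :=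
    hf.continuousAt.eventually_mem (by rw [hf0]; exact isOpen_interior.mem_nhds hx')
  obtain ⟨δ, hδ, h⟩ := Metric.eventually_nhds_iff.1 hnear
  refine ⟨δ / 2, half_pos hδ, ?_⟩
  have := interior_subset (h (y := -(δ / 2)) (by
    rw [Real.dist_eq, sub_zero, abs_neg, abs_of_pos (half_pos hδ)]; linarith))
  have h2 : ((f (-(δ / 2)) : affineSpan ℝ s) : E) ∈ s := this
  have h3 : ((f (-(δ / 2)) : affineSpan ℝ s) : E) = x' + (δ / 2) • ((x' : E) - y) := by
    simp only [f, AffineMap.lineMap_apply, vsub_eq_sub, vadd_eq_add]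
    module
  rwa [h3] at h2

/-- In the relative interior of a stage that starts with a split, the winner of this split is
strictly wider than the loser. -/
theorem lt_of_mem_intrinsicInterior {π₀ : IntervalExchange d} (hd : 0 < d)
    {n m : ℕ} {π π' π'' : IntervalExchange d} {Q R : Matrix (Fin d) (Fin d) ℝ} {w l : Fin d}
    (h : SplitPath n π₀ π Q) (hs : Split π w l π') (hR : SplitPath m π' π'' R)
    {x : EuclideanSpace ℝ (Fin d)}
    (hx : x ∈ intrinsicInterior ℝ (π''.stageSet (Q * (splitMatrix w l * R)))) :
    Q⁻¹.mulVec x.ofLp l < Q⁻¹.mulVec x.ofLp w := by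
  have hpath := h.trans (hs.splitPath.trans hR)
  set P := Q * (splitMatrix w l * R) with hP
  have hQP : ∀ z : EuclideanSpace ℝ (Fin d),
      Q⁻¹.mulVec z.ofLp = (splitMatrix w l).mulVec (R.mulVec (P⁻¹.mulVec z.ofLp)) := fun z => by
    rw [hP, Matrix.mulVec_mulVec, Matrix.mul_inv_rev, ← Matrix.mulVec_mulVec _ _ Q⁻¹,
      mulVec_inv_mulVec (hs.splitPath.trans hR).isUnit_det]
  -- The gap between winner and loser is the width of the winner just after the split: a
  -- non-negative affine function on the stage. It is positive at one point, hence throughout the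
  -- relative interior.
  have hdiff : ∀ z : EuclideanSpace ℝ (Fin d), Q⁻¹.mulVec z.ofLp w - Q⁻¹.mulVec z.ofLp l =
      R.mulVec (P⁻¹.mulVec z.ofLp) w := fun z => by
    rw [hQP, splitMatrix_mulVec_self, splitMatrix_mulVec_of_ne hs.ne.symm]
    ring
  obtain ⟨y, hy, hsw, -⟩ :=
    (hR.isRecurrent hs.isRecurrent_right).exists_sum_eq_one hd
  obtain ⟨z, hz, hzpos⟩ : ∃ z ∈ π''.stageSet P, 0 < R.mulVec (P⁻¹.mulVec z.ofLp) w := by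
    have hpos : 0 < norm₁ (P.mulVec y) := by
      rw [norm₁_of_nonneg fun i => (hpath.mulVec_pos hy i).le]
      exact Finset.sum_pos (fun i _ => hpath.mulVec_pos hy i) ⟨⟨0, hd⟩, Finset.mem_univ _⟩
    have hPz : P⁻¹.mulVec ((norm₁ (P.mulVec y))⁻¹ • P.mulVec y) = (norm₁ (P.mulVec y))⁻¹ • y := by
      rw [Matrix.mulVec_smul, inv_mulVec_mulVec hpath.isUnit_det]
    refine ⟨WithLp.toLp 2 ((norm₁ (P.mulVec y))⁻¹ • P.mulVec y), ?_, ?_⟩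
    · rw [mem_stageSet_iff hpath]
      refine ⟨((hpath.switchCondition_iff y).2 hsw).smul _, ?_, fun α => ?_⟩
      · simp only [Pi.smul_apply, smul_eq_mul, ← Finset.mul_sum]
        rw [← norm₁_of_nonneg fun i => (hpath.mulVec_pos hy i).le]
        exact inv_mul_cancel₀ hpos.ne'
      · simp only [hPz]
        exact mul_nonneg (inv_pos.2 hpos).le (hy α).le
    · simp only [hPz]
      exact hR.mulVec_pos (fun α => mul_pos (inv_pos.2 hpos) (hy α)) w
  obtain ⟨ε, hε, hmem⟩ := exists_add_smul_mem_of_mem_intrinsicInterior hx hz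
  have h1 := hR.mulVec_nonneg ((mem_stageSet_iff hpath _).1 hmem).2.2 w
  have h2 := hdiff x
  have h3 : R.mulVec (P⁻¹.mulVec (x + ε • (x - z)).ofLp) w =
      R.mulVec (P⁻¹.mulVec x.ofLp) w + ε * (R.mulVec (P⁻¹.mulVec x.ofLp) w -
        R.mulVec (P⁻¹.mulVec z.ofLp) w) := by
    simp only [WithLp.ofLp_add, WithLp.ofLp_smul, WithLp.ofLp_sub, Matrix.mulVec_add,
      Matrix.mulVec_smul, Matrix.mulVec_sub, Pi.add_apply, Pi.smul_apply, Pi.sub_apply,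
      smul_eq_mul]
  rw [h3] at h1
  have h4 := mul_pos hε hzpos
  by_contra hle
  rw [not_lt] at hle
  have h5 : R.mulVec (P⁻¹.mulVec x.ofLp) w ≤ 0 := by linarith
  nlinarith

end IntervalExchange

namespace IntervalExchange
variable {d : ℕ}

/-! ### Families of stages -/

/-- The relative interiors of the stages `(n, π, R)` and `(n', π', R')` below a stage with matrix
`Q` are disjoint. -/
def DisjointBelow (Q : Matrix (Fin d) (Fin d) ℝ)
    (x y : ℕ × IntervalExchange d × Matrix (Fin d) (Fin d) ℝ) : Prop :=
  Disjoint (intrinsicInterior ℝ (x.2.1.stageSet (Q * x.2.2)))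
    (intrinsicInterior ℝ (y.2.1.stageSet (Q * y.2.2)))

theorem DisjointBelow.symm {Q : Matrix (Fin d) (Fin d) ℝ}
    {x y : ℕ × IntervalExchange d × Matrix (Fin d) (Fin d) ℝ} (h : DisjointBelow Q x y) :
    DisjointBelow Q y x :=
  Disjoint.symm h

/-- Finitely many stages, with a given property and disjoint interiors, that are obtained by
splitting a stage. -/
structure StageFamily (π : IntervalExchange d) (Q : Matrix (Fin d) (Fin d) ℝ)
    (P : Matrix (Fin d) (Fin d) ℝ → Prop)
    (F : List (ℕ × IntervalExchange d × Matrix (Fin d) (Fin d) ℝ)) : Prop where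
  path : ∀ x ∈ F, SplitPath x.1 π x.2.1 x.2.2
  good : ∀ x ∈ F, P (Q * x.2.2)
  disjoint : F.Pairwise (DisjointBelow Q)

/-- The total volume of the truncated cones of a family. -/
noncomputable def totalVol (π₀ : IntervalExchange d) (p : EuclideanSpace ℝ (Fin d))
    (Q : Matrix (Fin d) (Fin d) ℝ)
    (F : List (ℕ × IntervalExchange d × Matrix (Fin d) (Fin d) ℝ)) : ℝ≥0∞ :=
  (F.map fun x => π₀.modelMeasure (π₀.stageCone p (Q * x.2.2))).sum

theorem StageFamily.nil (π : IntervalExchange d) (Q : Matrix (Fin d) (Fin d) ℝ)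
    (P : Matrix (Fin d) (Fin d) ℝ → Prop) : StageFamily π Q P [] :=
  ⟨by simp, by simp, .nil⟩

/-- A family below a split, seen as a family below the original stage. -/
def liftFamily (w l : Fin d) (F : List (ℕ × IntervalExchange d × Matrix (Fin d) (Fin d) ℝ)) :
    List (ℕ × IntervalExchange d × Matrix (Fin d) (Fin d) ℝ) :=
  F.map fun x => (1 + x.1, x.2.1, splitMatrix w l * x.2.2)

theorem StageFamily.lift {π π' : IntervalExchange d} {Q : Matrix (Fin d) (Fin d) ℝ}
    {P : Matrix (Fin d) (Fin d) ℝ → Prop}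
    {F : List (ℕ × IntervalExchange d × Matrix (Fin d) (Fin d) ℝ)} {w l : Fin d}
    (hs : Split π w l π') (hF : StageFamily π' (Q * splitMatrix w l) P F) :
    StageFamily π Q P (liftFamily w l F) := by
  refine ⟨fun x hx => ?_, fun x hx => ?_, ?_⟩
  · obtain ⟨y, hy, rfl⟩ := List.mem_map.1 hx
    exact hs.splitPath.trans (hF.path y hy)
  · obtain ⟨y, hy, rfl⟩ := List.mem_map.1 hx
    simpa [mul_assoc] using hF.good y hy
  · rw [liftFamily, List.pairwise_map]
    refine hF.disjoint.imp fun h => ?_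
    simpa only [DisjointBelow, mul_assoc] using h

theorem totalVol_lift (π₀ : IntervalExchange d) (p : EuclideanSpace ℝ (Fin d))
    (Q : Matrix (Fin d) (Fin d) ℝ) (w l : Fin d)
    (F : List (ℕ × IntervalExchange d × Matrix (Fin d) (Fin d) ℝ)) :
    totalVol π₀ p Q (liftFamily w l F) = totalVol π₀ p (Q * splitMatrix w l) F := by
  simp only [totalVol, liftFamily, List.map_map, Function.comp_def, mul_assoc]

/-! ### Branching of families at a split -/

section Branch

variable {π₀ : IntervalExchange d} {p : EuclideanSpace ℝ (Fin d)}

/-- A family for one of the two outcomes of a split. -/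
theorem exists_family_half (hd : 0 < d) (hp : BasePoint π₀ p) {n : ℕ}
    {π : IntervalExchange d} {Q : Matrix (Fin d) (Fin d) ℝ} (h : SplitPath n π₀ π Q)
    {P : Matrix (Fin d) (Fin d) ℝ → Prop} {V : Set (ℝ × π₀.directions)}
    (hchild : ∀ w l π', Split π w l π' → ∃ F, StageFamily π' (Q * splitMatrix w l) P F ∧
      π₀.modelMeasure (π₀.stageCone p (Q * splitMatrix w l)) ≤
        totalVol π₀ p (Q * splitMatrix w l) F +
          π₀.modelMeasure (π₀.stageCone p (Q * splitMatrix w l) ∩ V))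
    (hrec : π.IsRecurrent) {s : Bool} {w l : Fin d} (hw : π.IsLast s w) (hl : π.IsLast (!s) l)
    (hne : w ≠ l) (hnull : π₀.modelMeasure
      {g | π₀.stageCoord p Q g w = π₀.stageCoord p Q g l} = 0) :
    ∃ F, StageFamily π Q P F ∧ (∀ x ∈ F, 0 < x.1) ∧
      (∀ x ∈ F, ∀ y ∈ intrinsicInterior ℝ (x.2.1.stageSet (Q * x.2.2)),
        Q⁻¹.mulVec y.ofLp l < Q⁻¹.mulVec y.ofLp w) ∧
      π₀.modelMeasure (π₀.stageCone p Q ∩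
          {g | π₀.stageCoord p Q g l ≤ π₀.stageCoord p Q g w}) ≤
        totalVol π₀ p Q F + π₀.modelMeasure (π₀.stageCone p Q ∩ V ∩
          {g | π₀.stageCoord p Q g l ≤ π₀.stageCoord p Q g w}) := by
  by_cases hx : ∃ x : Fin d → ℝ, (∀ α, 0 < x α) ∧ π.SwitchCondition x ∧ x l < x w
  · obtain ⟨π', hm⟩ := exists_moves hw hl hne
    have hs : Split π w l π' := ⟨hm, hx⟩
    obtain ⟨F, hF, hvol⟩ := hchild w l π' hs
    refine ⟨liftFamily w l F, hF.lift hs, fun x hx => ?_, fun x hx y hy => ?_, ?_⟩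
    · obtain ⟨y, hy, rfl⟩ := List.mem_map.1 hx
      simp only; omega
    · obtain ⟨z, hz, rfl⟩ := List.mem_map.1 hx
      exact lt_of_mem_intrinsicInterior hd h hs (hF.path z hz) hy
    · rw [totalVol_lift, ← hp.stageCone_split h hs, Set.inter_right_comm,
        ← hp.stageCone_split h hs]
      exact hvol
  -- If this outcome is not admissible, its half of the cone is null. A point with a strict
  -- inequality could be pushed inside by a multiple of positive widths `x`, chosen to use up only
  -- half of the gap at `l`.
  · refine ⟨[], StageFamily.nil _ _ _, by simp, by simp, ?_⟩
    refine le_trans (le_of_eq (measure_mono_null (fun g hg => ?_) hnull)) zero_le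
    obtain ⟨x, hx0, hxs⟩ := hrec
    by_contra hne'
    have hlt : π₀.stageCoord p Q g l < π₀.stageCoord p Q g w :=
      lt_of_le_of_ne hg.2 (Ne.symm hne')
    refine hx ⟨π₀.stageCoord p Q g + ((π₀.stageCoord p Q g w - π₀.stageCoord p Q g l) /
      (2 * x l)) • x, fun α => ?_, ?_, ?_⟩
    · have h1 := hg.1.1 α
      have h2 := hx0 α
      have h3 := hx0 l
      have h4 := sub_pos.2 hlt
      simp only [Pi.add_apply, Pi.smul_apply, smul_eq_mul]
      positivity
    · have h1 := hp.switch_stageCoord h g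
      have h2 := hxs.smul ((π₀.stageCoord p Q g w - π₀.stageCoord p Q g l) / (2 * x l))
      simp only [SwitchCondition, Pi.add_apply, Finset.sum_add_distrib] at h1 h2 ⊢
      rw [h1, h2]
    · have h2 := hx0 w
      have h3 := hx0 l
      have h4 := sub_pos.2 hlt
      simp only [Pi.add_apply, Pi.smul_apply, smul_eq_mul]
      have h5 : (π₀.stageCoord p Q g w - π₀.stageCoord p Q g l) / (2 * x l) * x l =
          (π₀.stageCoord p Q g w - π₀.stageCoord p Q g l) / 2 := by field_simp
      have h6 : 0 < (π₀.stageCoord p Q g w - π₀.stageCoord p Q g l) / (2 * x l) * x w := by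
        positivity
      linarith

/-- Families below the stages that result from a split give a family below a stage. -/
theorem exists_family_of_split (hd : 0 < d) (hsink : π₀.InSink) (hp : BasePoint π₀ p) {n : ℕ}
    {π : IntervalExchange d} {Q : Matrix (Fin d) (Fin d) ℝ} (h : SplitPath n π₀ π Q)
    {P : Matrix (Fin d) (Fin d) ℝ → Prop} {V : Set (ℝ × π₀.directions)}
    (hchild : ∀ w l π', Split π w l π' → ∃ F, StageFamily π' (Q * splitMatrix w l) P F ∧
      π₀.modelMeasure (π₀.stageCone p (Q * splitMatrix w l)) ≤
        totalVol π₀ p (Q * splitMatrix w l) F +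
          π₀.modelMeasure (π₀.stageCone p (Q * splitMatrix w l) ∩ V)) :
    ∃ F, StageFamily π Q P F ∧ (∀ x ∈ F, 0 < x.1) ∧
      π₀.modelMeasure (π₀.stageCone p Q) ≤
        totalVol π₀ p Q F + π₀.modelMeasure (π₀.stageCone p Q ∩ V) := by
  obtain ⟨w, l, π', hs⟩ := hsink.exists_split h.reach
  obtain ⟨s, hw, hl, -⟩ := hs.1.isLast
  have hne := hs.ne
  have hrec := hs.isRecurrent
  have hnull : π₀.modelMeasure {g | π₀.stageCoord p Q g w = π₀.stageCoord p Q g l} = 0 := by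
    refine measure_coord_eq _ ?_
    obtain ⟨-, x, -, hx, hlt⟩ := hs
    obtain ⟨g, hg⟩ := hp.exists_stageCoord_eq h hx
    exact ⟨g, by rw [hg]; exact hlt.ne'⟩
  have hnull' : π₀.modelMeasure {g | π₀.stageCoord p Q g l = π₀.stageCoord p Q g w} = 0 := by
    simpa only [eq_comm] using hnull
  obtain ⟨F₁, hF₁, hpos₁, hint₁, hvol₁⟩ :=
    exists_family_half hd hp h hchild hrec hw hl hne hnull
  obtain ⟨F₂, hF₂, hpos₂, hint₂, hvol₂⟩ :=
    exists_family_half hd hp h hchild hrec hl (by rw [Bool.not_not]; exact hw) hne.symm hnull'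
  refine ⟨F₁ ++ F₂, ⟨fun x hx => ?_, fun x hx => ?_, ?_⟩, fun x hx => ?_, ?_⟩
  · exact (List.mem_append.1 hx).elim (hF₁.path x) (hF₂.path x)
  · exact (List.mem_append.1 hx).elim (hF₁.good x) (hF₂.good x)
  · refine List.pairwise_append.2 ⟨hF₁.disjoint, hF₂.disjoint, fun x hx y hy => ?_⟩
    exact Set.disjoint_left.2 fun z hz hz' => lt_asymm (hint₁ x hx z hz) (hint₂ y hy z hz')
  · exact (List.mem_append.1 hx).elim (hpos₁ x) (hpos₂ x)
  · set μ := π₀.modelMeasure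
    set B := π₀.stageCone p Q
    set H₁ : Set (ℝ × π₀.directions) := {g | π₀.stageCoord p Q g l ≤ π₀.stageCoord p Q g w}
    set H₂ : Set (ℝ × π₀.directions) := {g | π₀.stageCoord p Q g w ≤ π₀.stageCoord p Q g l}
    have hH : MeasurableSet H₁ :=
      (isClosed_le (continuous_coord _ _) (continuous_coord _ _)).measurableSet
    have hcover : μ B ≤ μ (B ∩ H₁) + μ (B ∩ H₂) := by
      refine (measure_mono fun g hg => ?_).trans (measure_union_le _ _)
      rcases le_total (π₀.stageCoord p Q g l) (π₀.stageCoord p Q g w) with h | h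
      · exact .inl ⟨hg, h⟩
      · exact .inr ⟨hg, h⟩
    -- The two halves overlap only in a null hyperplane, so the exceptional set is not counted
    -- twice.
    have hsplit : μ (B ∩ V ∩ H₁) + μ (B ∩ V ∩ H₂) ≤ μ (B ∩ V) := by
      rw [← measure_inter_add_sdiff (B ∩ V) hH]
      refine add_le_add_right ?_ _
      calc μ (B ∩ V ∩ H₂) ≤ μ ((B ∩ V) \ H₁ ∪
            {g | π₀.stageCoord p Q g w = π₀.stageCoord p Q g l}) := by
            refine measure_mono fun g hg => ?_
            by_cases h1 : g ∈ H₁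
            · exact .inr (le_antisymm hg.2 h1)
            · exact .inl ⟨hg.1, h1⟩
        _ ≤ μ ((B ∩ V) \ H₁) + 0 := by rw [← hnull]; exact measure_union_le _ _
        _ = _ := add_zero _
    have htot : totalVol π₀ p Q (F₁ ++ F₂) = totalVol π₀ p Q F₁ + totalVol π₀ p Q F₂ := by
      simp [totalVol]
    calc μ B ≤ μ (B ∩ H₁) + μ (B ∩ H₂) := hcover
      _ ≤ (totalVol π₀ p Q F₁ + μ (B ∩ V ∩ H₁)) + (totalVol π₀ p Q F₂ + μ (B ∩ V ∩ H₂)) :=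
        add_le_add hvol₁ hvol₂
      _ = totalVol π₀ p Q (F₁ ++ F₂) + (μ (B ∩ V ∩ H₁) + μ (B ∩ V ∩ H₂)) := by
        rw [htot]; ring
      _ ≤ _ := by gcongr

end Branch

/-! ### Distributed sets of columns -/

theorem distributed_of_bounds {Q : Matrix (Fin d) (Fin d) ℝ} {A : Finset (Fin d)} {C a b : ℝ}
    (ha : 0 < a) (hC : b < C * a) (h : ∀ α ∈ A, a ≤ colNorm Q α ∧ colNorm Q α ≤ b) :
    Distributed C Q A := by
  have key : ∀ α ∈ A, ∀ β ∈ A, colNorm Q α / colNorm Q β < C := by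
    intro α hα β hβ
    have h1 := h α hα
    have h2 := h β hβ
    have hC0 : 0 < C := by
      have : 0 < C * a := lt_of_lt_of_le ha (h1.1.trans (h1.2.trans hC.le))
      exact pos_of_mul_pos_left this ha.le
    rw [div_lt_iff₀ (by linarith)]
    have := mul_le_mul_of_nonneg_left h2.1 hC0.le
    linarith
  intro α hα β hβ
  refine ⟨?_, key α hα β hβ⟩
  have h1 := h α hα
  have h2 := h β hβ
  have := key β hβ α hα
  have e : norm₁ (Q.col α) / norm₁ (Q.col β) = (colNorm Q β / colNorm Q α)⁻¹ := by
    rw [inv_div]; rfl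
  rw [e, one_div]
  exact inv_strictAnti₀ (div_pos (by linarith) (by linarith)) this

theorem Distributed.mono {Q : Matrix (Fin d) (Fin d) ℝ} {A : Finset (Fin d)} {C C' : ℝ}
    (h : Distributed C Q A) (hC : 0 < C) (hCC : C ≤ C') : Distributed C' Q A :=
  fun α hα β hβ => ⟨(one_div_le_one_div_of_le hC hCC).trans_lt (h α hα β hβ).1,
    (h α hα β hβ).2.trans_le hCC⟩

theorem containsLargest_of_forall_exists {Q : Matrix (Fin d) (Fin d) ℝ} {A : Finset (Fin d)}
    (hd : 0 < d) (h : ∀ β, ∃ α ∈ A, colNorm Q β ≤ colNorm Q α) : ContainsLargest Q A := by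
  obtain ⟨α₀, hα₀, -⟩ := h ⟨0, hd⟩
  obtain ⟨α, hα, hmax⟩ := A.exists_max_image (colNorm Q) ⟨α₀, hα₀⟩
  refine ⟨α, hα, fun β => ?_⟩
  obtain ⟨γ, hγ, hβ⟩ := h β
  exact hβ.trans (hmax γ hγ)

theorem Distributed.bounds {Q : Matrix (Fin d) (Fin d) ℝ} {A : Finset (Fin d)} {C : ℝ}
    (h : Distributed C Q A) (hC : 1 < C) (hL : ContainsLargest Q A) (hQ : ∀ α, 1 ≤ colNorm Q α) :
    ∃ M, 1 ≤ M ∧ (∀ β, colNorm Q β ≤ M) ∧ (∃ α ∈ A, colNorm Q α = M) ∧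
      ∀ α ∈ A, M / C ≤ colNorm Q α := by
  obtain ⟨α₀, hα₀, hmax⟩ := hL
  refine ⟨colNorm Q α₀, hQ _, hmax, ⟨α₀, hα₀, rfl⟩, fun α hα => ?_⟩
  have h1 := (h α hα α₀ hα₀).1
  change 1 / C < colNorm Q α / colNorm Q α₀ at h1
  rw [div_lt_div_iff₀ (by linarith) (by linarith [hQ α₀])] at h1
  rw [div_le_iff₀ (by linarith)]
  linarith

end IntervalExchange

namespace IntervalExchange
variable {d : ℕ}

/-! ### Enlarging a distributed set of columns -/

/-- Some larger set of columns is distributed and contains a largest column. -/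
def Enlarged (A₀ : Finset (Fin d)) (C : ℝ) (Q : Matrix (Fin d) (Fin d) ℝ) : Prop :=
  ∃ A, A₀ ⊂ A ∧ Distributed C Q A ∧ ContainsLargest Q A

theorem enlarged_insert {A₀ : Finset (Fin d)} {l : Fin d} {Q : Matrix (Fin d) (Fin d) ℝ}
    {C a b : ℝ} (hd : 0 < d) (hl : l ∉ A₀) (ha : 0 < a) (hC : b < C * a)
    (h : ∀ α ∈ insert l A₀, a ≤ colNorm Q α ∧ colNorm Q α ≤ b)
    (hL : ∀ β, ∃ α ∈ insert l A₀, colNorm Q β ≤ colNorm Q α) : Enlarged A₀ C Q :=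
  ⟨insert l A₀, Finset.ssubset_insert hl, distributed_of_bounds ha hC h,
    containsLargest_of_forall_exists hd hL⟩

/-- If a band in `A₀` that never won has a column that grew much, then it is narrow. -/
theorem exists_family_nil {π₀ : IntervalExchange d} {p : EuclideanSpace ℝ (Fin d)} {n : ℕ}
    {π : IntervalExchange d} {Q : Matrix (Fin d) (Fin d) ℝ} (h : SplitPath n π₀ π Q)
    {A₀ : Finset (Fin d)} {P : Matrix (Fin d) (Fin d) ℝ → Prop} {N m : ℕ} (hN : 1 ≤ N)
    {ρ : IntervalExchange d} {R : Matrix (Fin d) (Fin d) ℝ} (hR : SplitPath m π ρ R)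
    (hid : ∀ α ∈ A₀, ∀ y, R.mulVec y α = y α)
    (hbd : ¬ ∀ α ∈ A₀, colNorm (Q * R) α ≤ N * colNorm Q α) :
    ∃ F, StageFamily ρ (Q * R) P F ∧ (∀ x ∈ F, 0 < x.1) ∧
      π₀.modelMeasure (π₀.stageCone p (Q * R)) ≤ totalVol π₀ p (Q * R) F +
        π₀.modelMeasure (π₀.stageCone p (Q * R) ∩
          {g | ∃ α ∈ A₀, π₀.stageCoord p Q g α ≤ 1 / (N * colNorm Q α)}) := by
  push Not at hbd
  obtain ⟨α, hα, hlt⟩ := hbd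
  refine ⟨[], StageFamily.nil _ _ _, by simp, ?_⟩
  refine le_trans (measure_mono fun g hg => ?_) le_add_self
  refine ⟨hg, α, hα, ?_⟩
  rw [stageCoord_mul π₀ p (Q := Q) hR.isUnit_det, hid α hα]
  have h1 := (h.trans hR).one_le_colNorm
  have h2 := h.one_le_colNorm α
  have hN' : (1 : ℝ) ≤ N := by exact_mod_cast hN
  refine (coord_le_of_mem_coneBody (fun β => by linarith [h1 β]) hg α).trans ?_
  exact one_div_le_one_div_of_le (by positivity) hlt.le

/-- As long as a band outside `A₀` is critical, the bands in `A₀` do not meet each other. The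
families found by splitting until the set `A₀` can be enlarged cover everything except for points
at which some band in `A₀` is narrow. -/
theorem exists_family_of_critical {π₀ : IntervalExchange d} {p : EuclideanSpace ℝ (Fin d)}
    (hd : 0 < d) (hsink : π₀.InSink) (hp : BasePoint π₀ p) {n : ℕ} {π : IntervalExchange d}
    {Q : Matrix (Fin d) (Fin d) ℝ} (h : SplitPath n π₀ π Q) {A₀ : Finset (Fin d)} {C M : ℝ}
    (hC : 1 < C) (hM : 1 ≤ M) (hmax : ∀ β, colNorm Q β ≤ M) (hmin : ∀ α ∈ A₀, M / C ≤ colNorm Q α)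
    {N : ℕ} (hN : 1 ≤ N) (f : ℕ) :
    ∀ (m : ℕ) (ρ : IntervalExchange d) (R : Matrix (Fin d) (Fin d) ℝ), SplitPath m π ρ R →
      (∀ α ∈ A₀, ∀ y, R.mulVec y α = y α) →
      (∀ α ∈ A₀, colNorm Q α ≤ colNorm (Q * R) α) →
      (∀ β, ∃ α ∈ A₀, colNorm (Q * R) β ≤ colNorm (Q * R) α) →
      (∃ s a, ρ.IsLast s a ∧ a ∉ A₀) →
      d * (N * M) < f + ∑ α, colNorm (Q * R) α →
      ∃ F, StageFamily ρ (Q * R) (Enlarged A₀ (2 * N * C + 1)) F ∧ (∀ x ∈ F, 0 < x.1) ∧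
        π₀.modelMeasure (π₀.stageCone p (Q * R)) ≤ totalVol π₀ p (Q * R) F +
          π₀.modelMeasure (π₀.stageCone p (Q * R) ∩
            {g | ∃ α ∈ A₀, π₀.stageCoord p Q g α ≤ 1 / (N * colNorm Q α)}) := by
  have hN' : (1 : ℝ) ≤ N := by exact_mod_cast hN
  have hNM : (0 : ℝ) < N * M := by positivity
  induction f with
  | zero =>
    intro m ρ R hR hid hmono hlarge hcrit hf
    by_cases hbd : ∀ α ∈ A₀, colNorm (Q * R) α ≤ N * colNorm Q α
    · exfalso
      have : ∑ α, colNorm (Q * R) α ≤ ∑ _α : Fin d, N * M := by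
        refine Finset.sum_le_sum fun β _ => ?_
        obtain ⟨α, hα, hβ⟩ := hlarge β
        exact hβ.trans ((hbd α hα).trans (mul_le_mul_of_nonneg_left (hmax α) (by positivity)))
      rw [Finset.sum_const, Finset.card_univ, Fintype.card_fin, nsmul_eq_mul] at this
      push_cast at hf
      linarith
    · exact exists_family_nil h hN hR hid hbd
  | succ f ih =>
    intro m ρ R hR hid hmono hlarge hcrit hf
    by_cases hbd : ∀ α ∈ A₀, colNorm (Q * R) α ≤ N * colNorm Q α
    swap
    · exact exists_family_nil h hN hR hid hbd
    have hQR := h.trans hR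
    have hone := hQR.one_le_colNorm
    have hbd' : ∀ β, colNorm (Q * R) β ≤ N * M := fun β => by
      obtain ⟨α, hα, hβ⟩ := hlarge β
      exact hβ.trans ((hbd α hα).trans (mul_le_mul_of_nonneg_left (hmax α) (by positivity)))
    have hlow : ∀ α ∈ A₀, M / C ≤ colNorm (Q * R) α := fun α hα => (hmin α hα).trans (hmono α hα)
    have hMC : 0 < M / C := by positivity
    -- After one more split the relevant columns lie between `M / C` and `2 * N * M`; the `+ 1`
    -- makes the ratio bound strict.
    have hCC : 2 * (N * M) < (2 * N * C + 1) * (M / C) := by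
      have : (2 * N * C + 1) * (M / C) = 2 * (N * M) + M / C := by field_simp
      linarith
    refine exists_family_of_split hd hsink hp hQR fun w l ρ' hs => ?_
    have hcol : ∀ α, colNorm (Q * R * splitMatrix w l) α =
        colNorm (Q * R) α + if α = l then colNorm (Q * R) w else 0 :=
      colNorm_mul_splitMatrix hQR.nonneg w l
    have hcoll : colNorm (Q * R * splitMatrix w l) l = colNorm (Q * R) l + colNorm (Q * R) w := by
      rw [hcol, if_pos rfl]
    have hcoln : ∀ α, α ≠ l → colNorm (Q * R * splitMatrix w l) α = colNorm (Q * R) α :=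
      fun α hα => by rw [hcol, if_neg hα, add_zero]
    have hge : ∀ α, colNorm (Q * R) α ≤ colNorm (Q * R * splitMatrix w l) α := fun α => by
      rw [hcol]
      have := hone w
      split_ifs <;> linarith
    obtain ⟨t, hw, hl, hw'⟩ := hs.1.isLast
    have success : Enlarged A₀ (2 * N * C + 1) (Q * R * splitMatrix w l) →
        ∃ F, StageFamily ρ' (Q * R * splitMatrix w l) (Enlarged A₀ (2 * N * C + 1)) F ∧
          π₀.modelMeasure (π₀.stageCone p (Q * R * splitMatrix w l)) ≤
            totalVol π₀ p (Q * R * splitMatrix w l) F +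
              π₀.modelMeasure (π₀.stageCone p (Q * R * splitMatrix w l) ∩
                {g | ∃ α ∈ A₀, π₀.stageCoord p Q g α ≤ 1 / (N * colNorm Q α)}) := by
      intro hE
      -- The child itself is the family. The split leading to it is added by `liftFamily`, which
      -- makes the length positive.
      refine ⟨[(0, ρ', 1)], ⟨?_, ?_, List.pairwise_singleton _ _⟩, ?_⟩
      · simpa using SplitPath.nil ρ'
      · simpa using hE
      · simp [totalVol]
    have enlarge : l ∉ A₀ → M / C ≤ colNorm (Q * R * splitMatrix w l) l →
        (∀ β, ∃ α ∈ insert l A₀, colNorm (Q * R) β ≤ colNorm (Q * R * splitMatrix w l) α) →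
        Enlarged A₀ (2 * N * C + 1) (Q * R * splitMatrix w l) := by
      intro hlA hlM hL
      refine enlarged_insert hd hlA hMC hCC (fun α hα => ?_) fun β => ?_
      · have hb1 := hbd' α
        have hb2 := hbd' w
        rcases Finset.mem_insert.1 hα with rfl | hα
        · exact ⟨hlM, by rw [hcoll]; linarith⟩
        · exact ⟨(hlow α hα).trans (hge α), by
            rw [hcoln α (fun e => hlA (e ▸ hα))]; linarith⟩
      · by_cases hβ : β = l
        · exact ⟨l, Finset.mem_insert_self _ _, hβ ▸ le_rfl⟩
        · rw [hcoln β hβ]; exact hL β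
    by_cases hwA : w ∈ A₀
    · have hlA : l ∉ A₀ := by
        obtain ⟨s, a, ha, haA⟩ := hcrit
        rcases Bool.eq_or_eq_not s t with rfl | rfl
        · exact absurd (ha.unique hw ▸ hwA) haA
        · exact ha.unique hl ▸ haA
      refine success (enlarge hlA ?_ fun β => ?_)
      · rw [hcoll]
        have h1 := hlow w hwA
        have h2 := hone l
        linarith
      · obtain ⟨α, hα, hβ⟩ := hlarge β
        exact ⟨α, Finset.mem_insert_of_mem hα, hβ.trans (hge α)⟩
    -- With an outside winner, success means that an outside loser has overtaken all of `A₀`.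
    -- Otherwise a largest column remains in `A₀` and the induction goes on.
    by_cases hE : l ∉ A₀ ∧ ∀ α ∈ A₀, colNorm (Q * R) α ≤ colNorm (Q * R * splitMatrix w l) l
    · obtain ⟨hlA, hE⟩ := hE
      refine success (enlarge hlA ?_ fun β => ?_)
      · obtain ⟨α, hα, -⟩ := hlarge l
        exact (hlow α hα).trans (hE α hα)
      · obtain ⟨α, hα, hβ⟩ := hlarge β
        exact ⟨α, Finset.mem_insert_of_mem hα, hβ.trans (hge α)⟩
    · rw [mul_assoc] at hge hcol hcoll hcoln hE ⊢
      have hid' : ∀ α ∈ A₀, ∀ y, (R * splitMatrix w l).mulVec y α = y α := fun α hα y => by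
        have hαw : α ≠ w := by rintro rfl; exact hwA hα
        rw [← Matrix.mulVec_mulVec, hid α hα, splitMatrix_mulVec_of_ne hαw]
      have hlarge' : ∀ β, ∃ α ∈ A₀, colNorm (Q * (R * splitMatrix w l)) β ≤
          colNorm (Q * (R * splitMatrix w l)) α := fun β => by
        by_cases hβ : β = l
        · subst hβ
          by_cases hβA : β ∈ A₀
          · exact ⟨β, hβA, le_rfl⟩
          · push Not at hE
            obtain ⟨α, hα, hlt⟩ := hE hβA
            exact ⟨α, hα, hlt.le.trans (hge α)⟩
        · obtain ⟨α, hα, h1⟩ := hlarge β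
          exact ⟨α, hα, (hcoln β hβ).le.trans (h1.trans (hge α))⟩
      have hsum : ∑ α, colNorm (Q * (R * splitMatrix w l)) α =
          ∑ α, colNorm (Q * R) α + colNorm (Q * R) w := by
        simp_rw [hcol, Finset.sum_add_distrib]
        simp
      -- The winner `w` is still critical and outside `A₀`. Its column norm, at least 1, is added to
      -- the sum of the norms and pays for one unit of `f`.
      obtain ⟨F, hF, -, hvol⟩ := ih (m + 1) ρ' (R * splitMatrix w l) (hR.snoc hs) hid'
        (fun α hα => (hmono α hα).trans (hge α)) hlarge' ⟨t, w, hw', hwA⟩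
        (by rw [hsum]; push_cast at hf; linarith [hone w])
      exact ⟨F, hF, hvol⟩

/-- A vector of widths that gives width `1` to a band and is as short as possible. -/
theorem IsRecurrent.exists_direction {π : IntervalExchange d} (h : π.IsRecurrent) (α : Fin d) :
    ∃ y : Fin d → ℝ, (∀ β, 0 ≤ y β) ∧ y α = 1 ∧ π.SwitchCondition y ∧
      ∀ (q : Fin d → ℝ) (M : ℝ), 0 ≤ M → (∀ β, q β ≤ M) → ∑ β, q β * y β ≤ q α + M := by
  by_cases hα : ∃ s, α ∈ π.rev s
  · obtain ⟨s, hα⟩ := hα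
    obtain ⟨x, hx, hs⟩ := h
    obtain ⟨β, hβ⟩ : (π.rev (!s)).Nonempty := by
      by_contra hne
      rw [Finset.not_nonempty_iff_eq_empty] at hne
      rw [switchCondition_iff_rev π s, hne, Finset.sum_empty] at hs
      exact (Finset.sum_pos (fun _ _ => hx _) ⟨α, hα⟩).ne' hs
    have hα' := notMem_rev_not hα
    have hβ' := notMem_rev_not hβ
    rw [Bool.not_not] at hβ'
    have hne : α ≠ β := fun e => hα' (e ▸ hβ)
    -- A reversing band is balanced by one reversing band on the other side, at a cost of at most
    -- `M`; an orientation preserving band needs no balance.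
    refine ⟨Pi.single α 1 + Pi.single β 1, fun γ => ?_, by simp [hne], ?_, fun q M _ hM => ?_⟩
    · simp only [Pi.add_apply, Pi.single_apply]
      split_ifs <;> norm_num
    · rw [switchCondition_iff_rev π s]
      simp only [Pi.add_apply, Finset.sum_add_distrib, Finset.sum_pi_single', hα, hα', hβ, hβ',
        if_true, if_false]
      ring
    · simp only [Pi.add_apply, mul_add, Finset.sum_add_distrib, Pi.single_apply, mul_ite, mul_one,
        mul_zero, Finset.sum_ite_eq', Finset.mem_univ, if_true]
      linarith [hM β]
  · push Not at hα
    refine ⟨Pi.single α 1, fun γ => ?_, by simp, ?_, fun q M hM0 hM => ?_⟩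
    · simp only [Pi.single_apply]
      split_ifs <;> norm_num
    · rw [switchCondition_iff_rev π true]
      simp only [Finset.sum_pi_single', hα, if_false]
    · simp only [Pi.single_apply, mul_ite, mul_one, mul_zero, Finset.sum_ite_eq',
        Finset.mem_univ, if_true]
      linarith

theorem finrank_model {π : IntervalExchange d} (h : ∀ s, (π.rev s).Nonempty) :
    Module.finrank ℝ (ℝ × π.directions) ≤ d := by
  have h1 := finrank_directions h
  rw [Module.finrank_prod, Module.finrank_self]
  have : ((1 + Module.finrank ℝ π.directions : ℕ) : ℝ) ≤ d := by push_cast; linarith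
  exact_mod_cast this

/-- When a band outside `A₀` is critical, the set `A₀` can be enlarged with probability at least
one half. -/
theorem exists_family_half_of_critical {C : ℝ} (hC : 1 < C) (hd : 0 < d) :
    ∃ C₁ : ℝ, 1 < C₁ ∧ ∀ (π₀ : IntervalExchange d) (p : EuclideanSpace ℝ (Fin d)),
      π₀.IsNonclassical → π₀.InSink → BasePoint π₀ p →
      ∀ (n : ℕ) (π : IntervalExchange d) (Q : Matrix (Fin d) (Fin d) ℝ), SplitPath n π₀ π Q →
      ∀ A₀ : Finset (Fin d), Distributed C Q A₀ → ContainsLargest Q A₀ →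
        (∃ s a, π.IsLast s a ∧ a ∉ A₀) →
      ∃ F, StageFamily π Q (Enlarged A₀ C₁) F ∧ (∀ x ∈ F, 0 < x.1) ∧
        ENNReal.ofReal (1 / 2) * π₀.modelMeasure (π₀.stageCone p Q) ≤ totalVol π₀ p Q F := by
  -- Each slab has proportion at most $(1+2(1+C))^d/N$, by a direction of cost
  -- $q_\alpha+M\le(1+C)q_\alpha$. This choice makes it at most $1/(2d)$, and there are at most $d$
  -- slabs.
  obtain ⟨N, hN⟩ := exists_nat_ge (2 * d * (1 + 2 * (1 + C)) ^ d)
  have hd' : (1 : ℝ) ≤ d := by exact_mod_cast hd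
  have hpow : (1 : ℝ) ≤ (1 + 2 * (1 + C)) ^ d := one_le_pow₀ (by linarith)
  have hN1 : 1 ≤ N := by
    have : (1 : ℝ) ≤ N := by nlinarith
    exact_mod_cast this
  have hN' : (1 : ℝ) ≤ N := by exact_mod_cast hN1
  refine ⟨2 * N * C + 1, by nlinarith, fun π₀ p hnc hsink hp n π Q h A₀ hdist hlarge hcrit => ?_⟩
  have hone := h.one_le_colNorm
  obtain ⟨M, hM, hmax, ⟨α₀, hα₀, hα₀M⟩, hmin⟩ := hdist.bounds hC hlarge hone
  set V := {g | ∃ α ∈ A₀, π₀.stageCoord p Q g α ≤ 1 / (N * colNorm Q α)} with hV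
  obtain ⟨f, hf⟩ := exists_nat_gt (d * (N * M))
  obtain ⟨F, hF, hpos, hvol⟩ := exists_family_of_critical hd hsink hp h hC hM hmax hmin hN1 f 0 π 1
    (.nil π) (fun _ _ _ => by rw [Matrix.one_mulVec]) (fun _ _ => by rw [mul_one])
    (fun β => ⟨α₀, hα₀, by rw [mul_one, hα₀M]; exact hmax β⟩) hcrit
    (by
      have : 0 ≤ ∑ α, colNorm (Q * 1) α := Finset.sum_nonneg fun α _ => by
        rw [mul_one]; linarith [hone α]
      linarith)
  rw [mul_one] at hF hvol
  refine ⟨F, hF, hpos, ?_⟩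
  set μ := π₀.modelMeasure
  set B := π₀.stageCone p Q with hB
  have hfin : μ B ≠ ∞ :=
    (measure_coneBody_lt_top μ (hp.stageCoord_injective h) fun α => by linarith [hone α]).ne
  have hsmall : ∀ α ∈ A₀, ENNReal.ofReal (2 * d) *
      μ (B ∩ {g | π₀.stageCoord p Q g α ≤ 1 / (N * colNorm Q α)}) ≤ μ B := by
    intro α hα
    obtain ⟨y, hy0, hy1, hys, hyq⟩ := (h.isRecurrent hnc.1).exists_direction α
    obtain ⟨v, hv⟩ := hp.exists_stageCoord_eq h hys
    have hMα : M ≤ C * colNorm Q α := by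
      have := hmin α hα
      rwa [div_le_iff₀ (by linarith), mul_comm] at this
    have key := measure_small_coord_le μ (L := π₀.stageCoord p Q) (q := colNorm Q)
      (fun α => by linarith [hone α]) (α := α) (v := v) (by rw [hv]; exact hy0)
      (by rw [hv]; exact hy1) (c := 1 + C)
      (by rw [hv]; linarith [hyq (colNorm Q) M (by linarith) hmax]) hN1
    set x := μ (B ∩ {g | π₀.stageCoord p Q g α ≤ 1 / (N * colNorm Q α)}) with hx
    have hK : (1 + 2 * (1 + C)) ^ Module.finrank ℝ (ℝ × π₀.directions) ≤ (1 + 2 * (1 + C)) ^ d :=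
      pow_le_pow_right₀ (by linarith) (finrank_model (hnc.rev_nonempty hd))
    set K := (1 + 2 * (1 + C)) ^ d with hKdef
    have h1 : ENNReal.ofReal K * (ENNReal.ofReal (2 * d) * x) ≤ ENNReal.ofReal K * μ B := by
      calc ENNReal.ofReal K * (ENNReal.ofReal (2 * d) * x)
          = ENNReal.ofReal (2 * d * K) * x := by
            rw [← mul_assoc, ← ENNReal.ofReal_mul (by linarith), mul_comm K]
        _ ≤ ENNReal.ofReal N * x := by gcongr
        _ = N * x := by rw [ENNReal.ofReal_natCast]
        _ ≤ _ := key
        _ ≤ ENNReal.ofReal K * μ B := by gcongr; exact le_of_eq rfl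
    exact (ENNReal.mul_le_mul_iff_right (ENNReal.ofReal_pos.2 (by linarith)).ne'
      ENNReal.ofReal_ne_top).1 h1
  have hbad : ENNReal.ofReal 2 * μ (B ∩ V) ≤ μ B := by
    have hsub : B ∩ V ⊆ ⋃ α ∈ A₀, B ∩ {g | π₀.stageCoord p Q g α ≤ 1 / (N * colNorm Q α)} := by
      rintro g ⟨hg, α, hα, hgα⟩
      exact Set.mem_biUnion hα ⟨hg, hgα⟩
    have h1 : ENNReal.ofReal d * (ENNReal.ofReal 2 * μ (B ∩ V)) ≤ ENNReal.ofReal d * μ B := by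
      calc ENNReal.ofReal d * (ENNReal.ofReal 2 * μ (B ∩ V))
          = ENNReal.ofReal (2 * d) * μ (B ∩ V) := by
            rw [← mul_assoc, ← ENNReal.ofReal_mul (by linarith), mul_comm (d : ℝ)]
        _ ≤ ENNReal.ofReal (2 * d) * ∑ α ∈ A₀,
            μ (B ∩ {g | π₀.stageCoord p Q g α ≤ 1 / (N * colNorm Q α)}) := by
          gcongr
          exact (measure_mono hsub).trans (measure_biUnion_finset_le _ _)
        _ ≤ ∑ _α ∈ A₀, μ B := by
          rw [Finset.mul_sum]
          exact Finset.sum_le_sum hsmall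
        _ ≤ ENNReal.ofReal d * μ B := by
          rw [Finset.sum_const, nsmul_eq_mul, ENNReal.ofReal_natCast]
          gcongr
          simpa using A₀.card_le_univ
    exact (ENNReal.mul_le_mul_iff_right (ENNReal.ofReal_pos.2 (by linarith)).ne'
      ENNReal.ofReal_ne_top).1 h1
  have htwo : ENNReal.ofReal (1 / 2) * ENNReal.ofReal 2 = 1 := by
    rw [← ENNReal.ofReal_mul (by norm_num)]; norm_num
  have hbad' : μ (B ∩ V) ≤ ENNReal.ofReal (1 / 2) * μ B := by
    calc μ (B ∩ V) = ENNReal.ofReal (1 / 2) * (ENNReal.ofReal 2 * μ (B ∩ V)) := by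
          rw [← mul_assoc, htwo, one_mul]
      _ ≤ _ := by gcongr
  have hsplit : ENNReal.ofReal (1 / 2) * μ B + ENNReal.ofReal (1 / 2) * μ B = μ B := by
    rw [← add_mul, ← ENNReal.ofReal_add (by norm_num) (by norm_num)]; norm_num
  have hlt : ENNReal.ofReal (1 / 2) * μ B ≠ ∞ := ENNReal.mul_ne_top ENNReal.ofReal_ne_top hfin
  refine (ENNReal.add_le_add_iff_right hlt).1 ?_
  rw [hsplit]
  exact hvol.trans (add_le_add_right hbad' _)

end IntervalExchange

namespace IntervalExchange
variable {d : ℕ}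

/-! ### Reaching a stage at which a band outside of the set is critical -/

/-- After at most `k` splits in which only bands from `A` take part, a band outside `A` can become
critical. -/
inductive Near (A : Finset (Fin d)) : ℕ → IntervalExchange d → Prop
  | zero (k : ℕ) (π : IntervalExchange d) (s : Bool) (a : Fin d) :
      π.IsLast s a → a ∉ A → Near A k π
  | succ (k : ℕ) (π π' : IntervalExchange d) (w l : Fin d) :
      Split π w l π' → w ∈ A → l ∈ A → Near A k π' → Near A (k + 1) π

theorem Near.mono {A : Finset (Fin d)} {k : ℕ} {π : IntervalExchange d} (h : Near A k π) :
    ∀ {k' : ℕ}, k ≤ k' → Near A k' π := by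
  induction h with
  | zero k π s a ha haA => exact fun _ => .zero _ _ _ _ ha haA
  | succ k π π' w l hs hw hl _ ih =>
    intro k' hk
    obtain ⟨j, rfl⟩ := Nat.exists_eq_add_of_le hk
    rw [Nat.add_right_comm]
    exact .succ _ _ _ _ _ hs hw hl (ih (Nat.le_add_right _ _))

theorem IsNonclassical.exists_near {π₀ π : IntervalExchange d} (h : π₀.IsNonclassical)
    (hsink : π₀.InSink) (hr : Relation.ReflTransGen Step π₀ π) {A : Finset (Fin d)}
    (hA : A ⊂ Finset.univ) : ∃ k, Near A k π := by
  obtain ⟨z, -, hz⟩ := Finset.exists_of_ssubset hA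
  obtain ⟨π₁, s, hr₁, hs⟩ := h.exists_isLast hsink z
  have hr' := (hsink.reach_symm hr).trans hr₁
  clear hr hr₁
  induction hr' using Relation.ReflTransGen.head_induction_on with
  | refl => exact ⟨0, .zero _ _ _ _ hs hz⟩
  | head hab _ ih =>
    obtain ⟨k, hk⟩ := ih
    obtain ⟨w, l, hsp⟩ := hab
    obtain ⟨t, hw, hl, -⟩ := hsp.1.isLast
    by_cases hwA : w ∈ A
    · by_cases hlA : l ∈ A
      · exact ⟨k + 1, .succ _ _ _ _ _ hsp hwA hlA hk⟩
      · exact ⟨0, .zero _ _ _ _ hl hlA⟩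
    · exact ⟨0, .zero _ _ _ _ hw hwA⟩

/-- There are finitely many pairs of a type and a set of labels, so one bound on the number of
splits serves them all. -/
theorem exists_near_uniform (d : ℕ) : ∃ N, ∀ π₀ π : IntervalExchange d, π₀.IsNonclassical →
    π₀.InSink → Relation.ReflTransGen Step π₀ π → ∀ A : Finset (Fin d), A ⊂ Finset.univ →
      Near A N π := by
  have key : ∀ t : IntervalExchange d × Finset (Fin d), ∃ k, ∀ π₀ : IntervalExchange d,
      π₀.IsNonclassical → π₀.InSink → Relation.ReflTransGen Step π₀ t.1 → t.2 ⊂ Finset.univ →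
        Near t.2 k t.1 := by
    intro t
    by_cases h : ∃ k, Near t.2 k t.1
    · obtain ⟨k, hk⟩ := h
      exact ⟨k, fun _ _ _ _ _ => hk⟩
    · exact ⟨0, fun π₀ hnc hsink hr hA => absurd (hnc.exists_near hsink hr hA) h⟩
  choose k hk using key
  obtain ⟨N, hN⟩ := Finite.exists_le k
  exact ⟨N, fun π₀ π hnc hsink hr A hA => (hk (π, A) π₀ hnc hsink hr hA).mono (hN (π, A))⟩

/-- Short widths for which the winner of a split exceeds the loser by one. -/
theorem exists_split_direction (d : ℕ) : ∃ K : ℝ, 0 ≤ K ∧ ∀ (π π' : IntervalExchange d) (w l : Fin d),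
    Split π w l π' → ∃ y : Fin d → ℝ, (∀ β, 0 ≤ y β) ∧ π.SwitchCondition y ∧ y l + 1 ≤ y w ∧
      ∑ β, y β ≤ K := by
  have key : ∀ t : IntervalExchange d × Fin d × Fin d, ∃ K : ℝ, ∀ π', Split t.1 t.2.1 t.2.2 π' →
      ∃ y : Fin d → ℝ, (∀ β, 0 ≤ y β) ∧ t.1.SwitchCondition y ∧ y t.2.2 + 1 ≤ y t.2.1 ∧
        ∑ β, y β ≤ K := by
    rintro ⟨π, w, l⟩
    by_cases h : ∃ x : Fin d → ℝ, (∀ α, 0 < x α) ∧ π.SwitchCondition x ∧ x l < x w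
    · obtain ⟨x, hx, hs, hlt⟩ := h
      have hpos : 0 < x w - x l := sub_pos.2 hlt
      -- Admissible widths are rescaled so that the winner exceeds the loser by exactly 1;
      -- finiteness then bounds their total.
      refine ⟨∑ β, ((x w - x l)⁻¹ • x) β, fun _ _ => ⟨(x w - x l)⁻¹ • x, fun β => ?_,
        hs.smul _, ?_, le_rfl⟩⟩
      · exact mul_nonneg (inv_nonneg.2 hpos.le) (hx β).le
      · simp only [Pi.smul_apply, smul_eq_mul]
        have : (x w - x l)⁻¹ * x w - (x w - x l)⁻¹ * x l = 1 := by
          rw [← mul_sub]; exact inv_mul_cancel₀ hpos.ne'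
        linarith
    · exact ⟨0, fun π' hs => absurd hs.2 h⟩
  choose K hK using key
  obtain ⟨N, hN⟩ := Finite.exists_le K
  refine ⟨max N 0, le_max_right _ _, fun π π' w l hs => ?_⟩
  obtain ⟨y, h1, h2, h3, h4⟩ := hK (π, w, l) π' hs
  exact ⟨y, h1, h2, h3, h4.trans ((hN _).trans (le_max_left _ _))⟩

theorem Enlarged.mono {A₀ : Finset (Fin d)} {C C' : ℝ} {Q : Matrix (Fin d) (Fin d) ℝ}
    (h : Enlarged A₀ C Q) (hC : 0 < C) (hCC : C ≤ C') : Enlarged A₀ C' Q := by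
  obtain ⟨A, hA, hdist, hL⟩ := h
  exact ⟨A, hA, hdist.mono hC hCC, hL⟩

theorem StageFamily.imp {π : IntervalExchange d} {Q : Matrix (Fin d) (Fin d) ℝ}
    {P P' : Matrix (Fin d) (Fin d) ℝ → Prop}
    {F : List (ℕ × IntervalExchange d × Matrix (Fin d) (Fin d) ℝ)} (hF : StageFamily π Q P F)
    (h : ∀ R, P R → P' R) : StageFamily π Q P' F :=
  ⟨hF.path, fun x hx => h _ (hF.good x hx), hF.disjoint⟩

/-- A split between two bands of the set keeps it distributed, and the split has a definite
probability. -/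
theorem measure_stageCone_le_split {π₀ : IntervalExchange d} {p : EuclideanSpace ℝ (Fin d)}
    (hd : 0 < d) (hnc : π₀.IsNonclassical) (hp : BasePoint π₀ p) {n : ℕ}
    {π π' : IntervalExchange d} {Q : Matrix (Fin d) (Fin d) ℝ} (h : SplitPath n π₀ π Q)
    {w l : Fin d} (hs : Split π w l π') {C K M : ℝ} (hC : 1 < C) (hK : 0 ≤ K)
    {y : Fin d → ℝ} (hy0 : ∀ β, 0 ≤ y β) (hys : π.SwitchCondition y) (hywl : y l + 1 ≤ y w)
    (hyK : ∑ β, y β ≤ K) (hmax : ∀ β, colNorm Q β ≤ M) (hl : M / C ≤ colNorm Q l) :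
    π₀.modelMeasure (π₀.stageCone p Q) ≤ ENNReal.ofReal ((1 + C * K) ^ d) *
      π₀.modelMeasure (π₀.stageCone p (Q * splitMatrix w l)) := by
  have hone := h.one_le_colNorm
  obtain ⟨v, hv⟩ := hp.exists_stageCoord_eq h hys
  have hM : M ≤ C * colNorm Q l := by
    rwa [div_le_iff₀ (by linarith), mul_comm] at hl
  have hM0 : 0 ≤ M := by linarith [hone l, hmax l]
  have key := measure_coneBody_le_half π₀.modelMeasure (L := π₀.stageCoord p Q) (q := colNorm Q)
    (fun α => by linarith [hone α]) (w := w) (l := l) (v := v) (by rw [hv]; exact hy0)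
    (by rw [hv]; exact hywl) (c := C * K) (by
      rw [hv]
      calc ∑ β, colNorm Q β * y β ≤ ∑ β, M * y β :=
            Finset.sum_le_sum fun β _ => mul_le_mul_of_nonneg_right (hmax β) (hy0 β)
        _ = M * ∑ β, y β := by rw [Finset.mul_sum]
        _ ≤ M * K := mul_le_mul_of_nonneg_left hyK hM0
        _ ≤ C * colNorm Q l * K := mul_le_mul_of_nonneg_right hM hK
        _ = _ := by ring)
  rw [hp.stageCone_split h hs]
  refine key.trans ?_
  have hpow : (1 + C * K) ^ Module.finrank ℝ (ℝ × π₀.directions) ≤ (1 + C * K) ^ d :=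
    pow_le_pow_right₀ (by nlinarith) (finrank_model (hnc.rev_nonempty hd))
  exact mul_le_mul_left (ENNReal.ofReal_le_ofReal hpow) _

/-- Induction on the number of splits inside `A₀` still needed. `C` is quantified inside the
induction because every such split worsens it. -/
theorem exists_family_of_near (hd : 0 < d) (k : ℕ) : ∀ C : ℝ, 1 < C →
    ∃ c C₁ : ℝ, 0 < c ∧ c < 1 ∧ 1 < C₁ ∧ ∀ (π₀ : IntervalExchange d) (p : EuclideanSpace ℝ (Fin d)),
      π₀.IsNonclassical → π₀.InSink → BasePoint π₀ p →
      ∀ (n : ℕ) (π : IntervalExchange d) (Q : Matrix (Fin d) (Fin d) ℝ), SplitPath n π₀ π Q →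
      ∀ A₀ : Finset (Fin d), Distributed C Q A₀ → ContainsLargest Q A₀ → Near A₀ k π →
      ∃ F, StageFamily π Q (Enlarged A₀ C₁) F ∧ (∀ x ∈ F, 0 < x.1) ∧
        ENNReal.ofReal c * π₀.modelMeasure (π₀.stageCone p Q) ≤ totalVol π₀ p Q F := by
  obtain ⟨K, hK, hdir⟩ := exists_split_direction d
  induction k with
  | zero =>
    intro C hC
    obtain ⟨C₁, hC₁, hcrit⟩ := exists_family_half_of_critical hC hd
    refine ⟨1 / 2, C₁, by norm_num, by norm_num, hC₁,
      fun π₀ p hnc hsink hp n π Q h A₀ hdist hL hnear => ?_⟩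
    cases hnear with
    | zero _ _ s a ha haA => exact hcrit π₀ p hnc hsink hp n π Q h A₀ hdist hL ⟨s, a, ha, haA⟩
  | succ k ih =>
    intro C hC
    obtain ⟨C₁, hC₁, hcrit⟩ := exists_family_half_of_critical hC hd
    -- A split inside `A₀` at most doubles the largest column and decreases none, so ratios stay at
    -- most `2 * C`; the `+ 1` gives strictness.
    obtain ⟨c, C₂, hc0, hc1, hC₂, hnext⟩ := ih (2 * C + 1) (by linarith)
    set D := (1 + C * K) ^ d with hD
    have hD1 : 1 ≤ D := one_le_pow₀ (by nlinarith)
    -- Proportion `1 / 2` if an outside band is already critical; otherwise at least `1 / D` for the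
    -- prescribed split, times `c` afterwards.
    refine ⟨min (1 / 2) (c / D), max C₁ C₂, by positivity, ?_, lt_max_of_lt_left hC₁,
      fun π₀ p hnc hsink hp n π Q h A₀ hdist hL hnear => ?_⟩
    · exact (min_le_left _ _).trans_lt (by norm_num)
    cases hnear with
    | zero _ _ s a ha haA =>
      obtain ⟨F, hF, hpos, hvol⟩ := hcrit π₀ p hnc hsink hp n π Q h A₀ hdist hL ⟨s, a, ha, haA⟩
      refine ⟨F, hF.imp fun R hR => hR.mono (by linarith) (le_max_left _ _), hpos, ?_⟩
      exact (mul_le_mul_left (ENNReal.ofReal_le_ofReal (min_le_left _ _)) _).trans hvol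
    | succ _ _ π' w l hs hw hl hnear =>
      have hone := h.one_le_colNorm
      obtain ⟨M, hM, hmax, ⟨α₀, hα₀, hα₀M⟩, hmin⟩ := hdist.bounds hC hL hone
      obtain ⟨y, hy0, hys, hywl, hyK⟩ := hdir π π' w l hs
      have hMC : 0 < M / C := by positivity
      have hle : ∀ α, colNorm Q α ≤ colNorm (Q * splitMatrix w l) α := fun α => by
        rw [colNorm_mul_splitMatrix h.nonneg]
        have := hone w
        split_ifs <;> linarith
      have hdist' : Distributed (2 * C + 1) (Q * splitMatrix w l) A₀ := by
        refine distributed_of_bounds (a := M / C) (b := 2 * M) hMC ?_ fun α hα =>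
          ⟨(hmin α hα).trans (hle α), ?_⟩
        · have : (2 * C + 1) * (M / C) = 2 * M + M / C := by field_simp
          linarith
        · rw [colNorm_mul_splitMatrix h.nonneg]
          have h1 := hmax w
          have h2 := hmax α
          split_ifs <;> linarith
      have hL' : ContainsLargest (Q * splitMatrix w l) A₀ := by
        refine containsLargest_of_forall_exists hd fun β => ?_
        by_cases hβ : β = l
        · exact ⟨l, hl, hβ ▸ le_rfl⟩
        · refine ⟨α₀, hα₀, le_trans ?_ (hle α₀)⟩
          rw [colNorm_mul_splitMatrix h.nonneg, if_neg hβ, add_zero, hα₀M]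
          exact hmax β
      obtain ⟨F, hF, -, hvol⟩ := hnext π₀ p hnc hsink hp (n + 1) π' _ (h.snoc hs) A₀ hdist' hL' hnear
      refine ⟨liftFamily w l F,
        (hF.lift hs).imp fun R hR => hR.mono (by linarith) (le_max_right _ _), fun x hx => ?_, ?_⟩
      · obtain ⟨z, -, rfl⟩ := List.mem_map.1 hx
        simp only; omega
      · rw [totalVol_lift]
        refine le_trans ?_ hvol
        have hchild := measure_stageCone_le_split hd hnc hp h hs hC hK hy0 hys hywl hyK hmax
          (hmin l hl)
        calc ENNReal.ofReal (min (1 / 2) (c / D)) * π₀.modelMeasure (π₀.stageCone p Q)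
            ≤ ENNReal.ofReal (c / D) * (ENNReal.ofReal D *
              π₀.modelMeasure (π₀.stageCone p (Q * splitMatrix w l))) := by
              gcongr
              exact min_le_right _ _
          _ = _ := by
            rw [← mul_assoc, ← ENNReal.ofReal_mul (by positivity), div_mul_cancel₀ _ (by positivity)]

/-! ### Volumes of stages -/

theorem isClosed_configSpace (π : IntervalExchange d) : IsClosed π.configSpace := by
  have hc : ∀ α, Continuous fun x : EuclideanSpace ℝ (Fin d) => x α := fun α => by fun_prop
  have h1 : IsClosed {x : EuclideanSpace ℝ (Fin d) | ∀ α, 0 ≤ x α} := by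
    simp only [Set.ofPred_forall]
    exact isClosed_iInter fun α => isClosed_le continuous_const (hc α)
  have h2 : IsClosed {x : EuclideanSpace ℝ (Fin d) | ∑ α, x α = 1} :=
    isClosed_eq (continuous_finsetSum _ fun α _ => hc α) continuous_const
  have h3 : IsClosed {x : EuclideanSpace ℝ (Fin d) | π.SwitchCondition x} :=
    isClosed_eq (continuous_finsetSum _ fun α _ => hc α) (continuous_finsetSum _ fun α _ => hc α)
  exact h1.inter (h2.inter h3)

theorem SplitPath.stageSet_subset {n : ℕ} {π₀ π : IntervalExchange d}
    {Q : Matrix (Fin d) (Fin d) ℝ} (h : SplitPath n π₀ π Q) : π.stageSet Q ⊆ π₀.configSpace := by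
  intro x hx
  obtain ⟨h1, h2, h3⟩ := (mem_stageSet_iff h x).1 hx
  refine ⟨fun α => ?_, h2, h1⟩
  have := h.mulVec_nonneg h3 α
  rwa [mulVec_inv_mulVec h.isUnit_det] at this

/-- The volume of a stage is proportional to the measure of its truncated cone. -/
theorem BasePoint.exists_vol_eq {π₀ : IntervalExchange d} {p : EuclideanSpace ℝ (Fin d)}
    (hp : BasePoint π₀ p) (hrev : ∀ s, (π₀.rev s).Nonempty) :
    ∃ b : ℝ≥0∞, ∀ (n : ℕ) (π : IntervalExchange d) (Q : Matrix (Fin d) (Fin d) ℝ),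
      SplitPath n π₀ π Q →
        π₀.vol (π.stageSet Q) = b * π₀.modelMeasure (π₀.stageCone p Q) := by
  set κ := ∫⁻ t in Set.Ioc (0 : ℝ) 1, ENNReal.ofReal |t ^ Module.finrank ℝ π₀.directions| with hκ
  refine ⟨(Measure.hausdorffMeasure ((d : ℝ) - 2) π₀.configSpace)⁻¹ * κ⁻¹, fun n π Q h => ?_⟩
  rw [vol, cond_apply (isClosed_configSpace π₀).measurableSet,
    Set.inter_eq_right.2 h.stageSet_subset, hp.measure_stageCone h, finrank_directions hrev, ← hκ,
    mul_assoc, ← mul_assoc κ⁻¹, ENNReal.inv_mul_cancel (lintegral_pow_ne_zero _)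
      (lintegral_pow_ne_top _), one_mul]

end IntervalExchange

theorem mainTheorem9 (d : ℕ) (C₀ : ℝ) (hC₀ : 1 < C₀) :
    ∃ c₁ C₁ : ℝ, 0 < c₁ ∧ c₁ < 1 ∧ 1 < C₁ ∧
      ∀ π₀ : IntervalExchange d, π₀.IsNonclassical → π₀.InSink →
      ∀ (n : ℕ) (π : IntervalExchange d) (Q : Matrix (Fin d) (Fin d) ℝ),
        IntervalExchange.SplitPath n π₀ π Q →
      ∀ A₀ : Finset (Fin d), A₀ ⊂ Finset.univ →
        IntervalExchange.Distributed C₀ Q A₀ → IntervalExchange.ContainsLargest Q A₀ →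
      ∃ (k : ℕ) (m : Fin k → ℕ) (ρ : Fin k → IntervalExchange d)
        (R : Fin k → Matrix (Fin d) (Fin d) ℝ),
        (∀ θ, 0 < m θ ∧ IntervalExchange.SplitPath (m θ) π (ρ θ) (R θ)) ∧
        (∀ θ θ', θ ≠ θ' →
          Disjoint (intrinsicInterior ℝ ((ρ θ).stageSet (Q * R θ)))
            (intrinsicInterior ℝ ((ρ θ').stageSet (Q * R θ')))) ∧
        ENNReal.ofReal c₁ * π₀.vol (π.stageSet Q) ≤
          ∑ θ, π₀.vol ((ρ θ).stageSet (Q * R θ)) ∧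
        ∀ θ, ∃ A : Finset (Fin d), A₀ ⊂ A ∧
          IntervalExchange.Distributed C₁ (Q * R θ) A ∧
          IntervalExchange.ContainsLargest (Q * R θ) A := by
  open IntervalExchange in
  rcases Nat.eq_zero_or_pos d with rfl | hd
  -- For `d = 0` no proper subset of the labels exists, so any constants do.
  · refine ⟨1 / 2, 2, by norm_num, by norm_num, by norm_num, fun π₀ _ _ n π Q _ A₀ hA => ?_⟩
    exact absurd (Subsingleton.elim A₀ Finset.univ) hA.ne
  obtain ⟨N, hN⟩ := exists_near_uniform d
  obtain ⟨c, C, hc0, hc1, hC, hfam⟩ := exists_family_of_near hd N C₀ hC₀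
  refine ⟨c, C, hc0, hc1, hC, fun π₀ hnc hsink n π Q h A₀ hA hdist hL => ?_⟩
  obtain ⟨x, -, hxs, hx1⟩ := hnc.1.exists_sum_eq_one hd
  have hp : BasePoint π₀ (WithLp.toLp 2 x) := ⟨hx1, hxs⟩
  obtain ⟨F, hF, hpos, hvol⟩ := hfam π₀ _ hnc hsink hp n π Q h A₀ hdist hL
    (hN π₀ π hnc hsink h.reach A₀ hA)
  obtain ⟨b, hb⟩ := hp.exists_vol_eq (hnc.rev_nonempty hd)
  refine ⟨F.length, fun θ => (F.get θ).1, fun θ => (F.get θ).2.1, fun θ => (F.get θ).2.2,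
    fun θ => ⟨hpos _ (F.get_mem θ), hF.path _ (F.get_mem θ)⟩, fun θ θ' hne => ?_, ?_,
    fun θ => hF.good _ (F.get_mem θ)⟩
  · have hpw := List.pairwise_iff_get.1 hF.disjoint
    rcases lt_or_gt_of_ne hne with hlt | hlt
    · exact hpw _ _ hlt
    · exact (hpw _ _ hlt).symm
  · rw [hb n π Q h, Finset.sum_congr rfl fun θ _ => hb _ _ _ (h.trans (hF.path _ (F.get_mem θ))),
      ← Finset.mul_sum, mul_left_comm]
    refine mul_le_mul_right (hvol.trans (le_of_eq ?_)) b
    rw [totalVol, ← Fin.sum_univ_fun_getElem]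
    rfl
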